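/- Let $S,A$ be Polish spaces, $P$ a probability kernel from $S\times A$ to $S$, $c:S\times A\to\mathbb R$ bounded and measurable, $\gamma\in(0,1)$, $\mu$ a probability measure on $A$ and $0<\tau<1$. For a policy $\pi$ (a probability kernel from $S$ to $A$) let $$V^\pi_\tau(s)=\mathbb E^\pi_s\Big[\sum_{n\ge0}\gamma^n\big(c(s_n,a_n)+\tau\,\mathrm{KL}(\pi(\cdot|s_n)|\mu)\big)\Big]\in\mathbb R\cup\{\infty\},\qquad V^\pi_\tau(\rho)=\int_S V^\pi_\tau\,d\rho,$$ $Q^\pi_\tau(s,a)=c(s,a)+\gamma\int_S V^\pi_\tau(s')P(ds'|s,a)$, $P_\pi(ds'|s)=\int_A P(ds'|s,a)\pi(da|s)$, $P^\pi(ds',da'|s,a)=P(ds'|s,a)\pi(da'|s')$, and, for $\rho\in\mathcal P(S)$, $\beta\in\mathcal P(S\times A)$, $d^\pi_\rho=(1-\gamma)\sum_{n\ge0}\gamma^n \rho P_\pi^n$ and $d^\pi_\beta=(1-\gamma)\sum_{n\ge0}\gamma^n\beta (P^\pi)^n$. Let $\Pi_\mu$ be the class of policies $\pi(da|s)=\frac{e^{f(s,a)}}{\int_A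 e^{f(s,a')}\mu(da')}\mu(da)$ with $f$ bounded and measurable. Let $\phi:S\times A\to\mathbb R^N$ be measurable with $|\phi|\le1$, and write $Q(s,a;\theta)=\langle\theta,\phi(s,a)\rangle$. Assume that for every $\pi\in\Pi_\mu$ there is $\theta_\pi\in\mathbb R^N$ with $Q^\pi_\tau=\langle\theta_\pi,\phi\rangle$ on $S\times A$. Fix $\beta\in\mathcal P(S\times A)$ such that $\lambda_\beta:=\lambda_{\min}\big(\int\phi\phi^\top d\beta\big)>0$, and put $\Gamma=\lambda_\beta(1-\gamma)(1-\sqrt\gamma)$. Let $\eta:[0,\infty)\to[1,\infty)$ be non-decreasing with $\eta_0>1/\Gamma$, and let $(\theta_t,\pi_t)_{t\ge0}$, with $\theta_0\in\mathbb R^N$ and $\pi_0\in\Pi_\mu$, solve the actor-critic flow $$\frac{d\theta_t}{dt}=-\eta_t\int_{S\times A}\big(Q(s,a;\theta_t)-\mathrm T^{\pi_t}Q(\cdot;\theta_t)(s,a)\big)\phi(s,a)\,d^{\pi_t}_\beta(ds,da),\qquad \partial_t\pi_t(da|s)=-A_t(s,a)\,\pi_t(da|s),$$ where $$\mathrm T^\pi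 f(s,a)=c(s,a)+\gamma\int f\,dP^\pi(\cdot|s,a)+\tau\gamma\int_S\mathrm{KL}(\pi(\cdot|s')|\mu)P(ds'|s,a),$$ $$A_t(s,a)=Q(s,a;\theta_t)+\tau\ln\tfrac{d\pi_t}{d\mu}(s,a)-\int_A\big(Q(s,a';\theta_t)+\tau\ln\tfrac{d\pi_t}{d\mu}(s,a')\big)\pi_t(da'|s);$$ the equation for $\pi_t$ is understood pointwise in $(s,a)$ for a positive version of the density $d\pi_t/d\mu$. Suppose that $$\frac{2\sqrt2\,\gamma}{\sqrt{\Gamma^2-\Gamma\tau/\eta_0}}<1 .$$ Let $\rho\in\mathcal P(S)$ and let $\pi^*$ be an optimal policy, i.e. $V^{\pi^*}_\tau(\rho)=\min_\pi V^\pi_\tau(\rho)$ over all policies. Then $V^{\pi^*}_\tau(\rho)$ and $\int_S\mathrm{KL}(\pi^*(\cdot|s)|\pi_0(\cdot|s))\,d^{\pi^*}_\rho(ds)$ are finite, $\min_{r\in[0,t]}V^{\pi_r}_\tau(\rho)$ is attained and finite for all $t\ge0$, and there is $d_1>0$, independent of $t$, such that for all $t>0$ $$\min_{r\in[0,t]}V^{\pi_r}_\tau(\rho)-V^{\pi^*}_\tau(\rho)\le\frac{\tau}{2(1-\gamma)(1-e^{-\frac\tau2t})}\Big(e^{-\frac\tau2t}\int_S\mathrm{KL}(\pi^*(\cdot|s)|\pi_0(\cdot|s))\,d^{\pi^*}_\rho(ds)+d_1\int_0^te^{-\frac\tau2(t-r)}\frac1{\eta_r}\,dr\Big).$$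 Moreover, if $\eta_t=\sqrt t+\eta_0$ for all $t\ge0$, then $\min_{r\in[0,t]}V^{\pi_r}_\tau(\rho)-V^{\pi^*}_\tau(\rho)=O(1/\sqrt t)$ as $t\to\infty$. -/

import Mathlib

open MeasureTheory ProbabilityTheory Set Filter Asymptotics
open scoped ENNReal Topology

namespace ActorCritic

/-- An entropy-regularised Markov decision process: state space `S`, action space `A`,
transition kernel `P`, bounded cost `c`, discount factor `γ ∈ (0,1)`, reference probability
measure `μ` on the actions, and regularisation parameter `τ > 0`. -/
structure RegMDP (S A : Type*) [MeasurableSpace S] [MeasurableSpace A] where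
  P : Kernel (S × A) S
  markov_P : IsMarkovKernel P
  c : S × A → ℝ
  measurable_c : Measurable c
  bounded_c : ∃ C : ℝ, ∀ x, |c x| ≤ C
  γ : ℝ
  γ_pos : 0 < γ
  γ_lt_one : γ < 1
  μ : Measure A
  prob_μ : IsProbabilityMeasure μ
  τ : ℝ
  τ_pos : 0 < τ

attribute [instance] RegMDP.markov_P RegMDP.prob_μ

/-- Stochastic policies: the probability kernels from states to actions. -/
structure Policy (S A : Type*) [MeasurableSpace S] [MeasurableSpace A] where
  kernel : Kernel S A
  markov : IsMarkovKernel kernel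

attribute [instance] Policy.markov

/-- The discounted occupancy measure `(1 - γ) ∑ₙ γⁿ κⁿ ν` of a kernel `κ` on `X` with initial
distribution `ν` (here `κ ^ n` is the `n`-fold composition of `κ`, `κ ^ 0` the identity). -/
noncomputable def occupancy {X : Type*} [MeasurableSpace X] (γ : ℝ) (κ : Kernel X X)
    (ν : Measure X) : Measure X :=
  ENNReal.ofReal (1 - γ) • Measure.sum fun n : ℕ => ENNReal.ofReal (γ ^ n) • ((κ ^ n) ∘ₘ ν)

/-- The smallest eigenvalue of a symmetric real matrix (its spectrum is finite, and nonempty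
when the matrix has positive size; for size zero the value is `0`). -/
noncomputable def lambdaMin {N : ℕ} (B : Matrix (Fin N) (Fin N) ℝ) : ℝ :=
  sInf (spectrum ℝ B)

/-- The matrix `∫ φ φᵀ dβ`. -/
noncomputable def featureCov {X : Type*} [MeasurableSpace X] {N : ℕ}
    (φ : X → EuclideanSpace ℝ (Fin N)) (β : Measure X) : Matrix (Fin N) (Fin N) ℝ :=
  Matrix.of fun i j => ∫ x, φ x i * φ x j ∂β

namespace RegMDP

variable {S A : Type*} [MeasurableSpace S] [MeasurableSpace A] (M : RegMDP S A)

/-- The state transition kernel `P_π(ds'|s) = ∫ P(ds'|s,a) π(da|s)`. -/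
noncomputable def stateKernel (π : Policy S A) : Kernel S S :=
  M.P ∘ₖ (Kernel.id ×ₖ π.kernel)

/-- The state-action transition kernel `P^π(ds',da'|s,a) = P(ds'|s,a) π(da'|s')`. -/
noncomputable def stateActionKernel (π : Policy S A) : Kernel (S × A) (S × A) :=
  M.P ⊗ₖ Kernel.prodMkLeft (S × A) π.kernel

instance (π : Policy S A) : IsMarkovKernel (M.stateActionKernel π) := by
  unfold stateActionKernel; infer_instance

/-- The law of the controlled process `(sₙ, aₙ)ₙ` under the policy `π` started at `s₀ = s`. -/
noncomputable def pathLaw (π : Policy S A) (s : S) : Measure (ℕ → S × A) :=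
  Kernel.trajMeasure (X := fun _ => S × A) (Measure.dirac s ⊗ₘ π.kernel)
    (fun n => (M.stateActionKernel π).comap
      (fun x : (i : Finset.Iic n) → S × A => x ⟨n, Finset.mem_Iic.2 le_rfl⟩)
      (measurable_pi_apply _))

/-- Expected discounted cost `𝔼ₛ^π [∑ₙ γⁿ c(sₙ,aₙ)]`. -/
noncomputable def costValue (π : Policy S A) (s : S) : ℝ :=
  ∫ ω, ∑' n : ℕ, M.γ ^ n * M.c (ω n) ∂(M.pathLaw π s)

/-- Expected discounted entropy `𝔼ₛ^π [∑ₙ γⁿ KL(π(·|sₙ)|μ)] ∈ [0,∞]`. -/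
noncomputable def entropyValue (π : Policy S A) (s : S) : ℝ≥0∞ :=
  ∫⁻ ω, ∑' n : ℕ, ENNReal.ofReal (M.γ ^ n) *
    InformationTheory.klDiv (π.kernel (ω n).1) M.μ ∂(M.pathLaw π s)

/-- The regularised value function
`V^π(s) = 𝔼ₛ^π [∑ₙ γⁿ (c(sₙ,aₙ) + τ KL(π(·|sₙ)|μ))] ∈ ℝ ∪ {∞}`. -/
noncomputable def value (π : Policy S A) (s : S) : EReal :=
  (M.costValue π s : EReal) + ((ENNReal.ofReal M.τ * M.entropyValue π s : ℝ≥0∞) : EReal)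

/-- `V^π(ρ) = ∫ V^π(s) ρ(ds) ∈ ℝ ∪ {∞}`; the bounded part and the nonnegative part of `V^π` are
integrated separately. -/
noncomputable def valueAt (π : Policy S A) (ρ : Measure S) : EReal :=
  ((∫ s, M.costValue π s ∂ρ : ℝ) : EReal) +
    ((ENNReal.ofReal M.τ * ∫⁻ s, M.entropyValue π s ∂ρ : ℝ≥0∞) : EReal)

/-- `π` minimises `V^π(ρ)` among all stochastic policies. -/
def IsOptimal (ρ : Measure S) (π : Policy S A) : Prop :=
  ∀ π' : Policy S A, M.valueAt π ρ ≤ M.valueAt π' ρ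

/-- The state-action value function `Q^π(s,a) = c(s,a) + γ ∫ V^π(s') P(ds'|s,a)`
(used for policies whose value function is finite). -/
noncomputable def qValue (π : Policy S A) (x : S × A) : ℝ :=
  M.c x + M.γ * ∫ s', (M.value π s').toReal ∂(M.P x)

/-- The Bellman operator
`T^π f (s,a) = c(s,a) + γ ∫ f dP^π(·|s,a) + τ γ ∫ KL(π(·|s')|μ) P(ds'|s,a)`. -/
noncomputable def bellman (π : Policy S A) (f : S × A → ℝ) (x : S × A) : ℝ :=
  M.c x + M.γ * ∫ y, f y ∂(M.stateActionKernel π x)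
    + M.τ * M.γ * ∫ s', (InformationTheory.klDiv (π.kernel s') M.μ).toReal ∂(M.P x)

/-- `p` is an everywhere positive version of the density `dπ/dμ (s,a)`. -/
structure IsDensity (π : Policy S A) (p : S × A → ℝ) : Prop where
  measurable : Measurable p
  pos : ∀ x, 0 < p x
  eq_withDensity : ∀ s, π.kernel s = M.μ.withDensity fun a => ENNReal.ofReal (p (s, a))

/-- The density `exp f(s,a) / ∫ exp f(s,a') μ(da')`. -/
noncomputable def gibbsDensity (f : S × A → ℝ) (x : S × A) : ℝ :=
  Real.exp (f x) / ∫ a', Real.exp (f (x.1, a')) ∂M.μ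

/-- `π` belongs to the class `Π_μ` of admissible policies, and `p` is its density, given by the
formula `p(s,a) = exp f(s,a) / ∫ exp f(s,a') μ(da')` with `f` bounded and measurable. -/
def IsAdmissibleWith (π : Policy S A) (p : S × A → ℝ) : Prop :=
  ∃ f : S × A → ℝ, Measurable f ∧ (∃ C : ℝ, ∀ x, |f x| ≤ C) ∧
    p = M.gibbsDensity f ∧ M.IsDensity π p

/-- The class `Π_μ` of admissible policies. -/
def IsAdmissible (π : Policy S A) : Prop :=
  ∃ p : S × A → ℝ, M.IsAdmissibleWith π p

variable {N : ℕ} (φ : S × A → EuclideanSpace ℝ (Fin N))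

/-- The linear critic `Q(s,a;θ) = ⟨θ, φ(s,a)⟩`. -/
noncomputable def critic (θ : EuclideanSpace ℝ (Fin N)) (x : S × A) : ℝ :=
  inner ℝ θ (φ x)

/-- Realisability: for each admissible `π` there is `θ_π` with `Q^π = ⟨θ_π, φ⟩`. -/
def Realisable : Prop :=
  ∀ π : Policy S A, M.IsAdmissible π →
    ∃ θπ : EuclideanSpace ℝ (Fin N), ∀ x, M.qValue π x = critic φ θπ x

/-- The semi-gradient
`g(θ,π) = ∫ (Q(s,a;θ) - T^π Q(·;θ)(s,a)) φ(s,a) d_β^π(ds,da)`. -/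
noncomputable def semiGradient (β : Measure (S × A)) (θ : EuclideanSpace ℝ (Fin N))
    (π : Policy S A) : EuclideanSpace ℝ (Fin N) :=
  ∫ x, (critic φ θ x - M.bellman π (critic φ θ) x) • φ x
    ∂(occupancy M.γ (M.stateActionKernel π) β)

/-- The approximate soft advantage
`A(s,a;θ) = Q(s,a;θ) + τ ln p(s,a) - ∫ (Q(s,a';θ) + τ ln p(s,a')) π(da'|s)`, `p = dπ/dμ`. -/
noncomputable def advantage (θ : EuclideanSpace ℝ (Fin N)) (π : Policy S A) (p : S × A → ℝ)
    (x : S × A) : ℝ :=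
  critic φ θ x + M.τ * Real.log (p x)
    - ∫ a', (critic φ θ (x.1, a') + M.τ * Real.log (p (x.1, a'))) ∂(π.kernel x.1)

/-- `(θ_t, π_t)_{t ≥ 0}` solves the coupled actor-critic flow with time-scale separation `η`:
`π_0 ∈ Π_μ`, `dθ_t/dt = -η_t g(θ_t,π_t)` and `∂_t π_t(da|s) = -A_t(s,a) π_t(da|s)`. The latter
equation is read on densities: `∂_t p_t(s,a) = -A_t(s,a) p_t(s,a)` for some version `p_t` of
`dπ_t/dμ`. At `t = 0` the derivatives are one-sided. Only times `t ≥ 0` matter. -/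
structure IsFlow (β : Measure (S × A)) (η : ℝ → ℝ) (θ : ℝ → EuclideanSpace ℝ (Fin N))
    (π : ℝ → Policy S A) : Prop where
  critic_eq : ∀ t, 0 ≤ t →
    HasDerivWithinAt θ (-(η t • M.semiGradient φ β (θ t) (π t))) (Ici 0) t
  actor_eq : ∃ p : ℝ → S × A → ℝ,
    M.IsAdmissibleWith (π 0) (p 0) ∧
    (∀ t, 0 ≤ t → M.IsDensity (π t) (p t)) ∧
    ∀ t, 0 ≤ t → ∀ x : S × A,
      HasDerivWithinAt (fun r => p r x) (-(M.advantage φ (θ t) (π t) (p t) x * p t x)) (Ici 0) t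

/-- The constant `Γ = λ_β (1 - γ)(1 - √γ)`, with `λ_β = λ_min(∫ φ φᵀ dβ)`. -/
noncomputable def Gam (β : Measure (S × A)) : ℝ :=
  lambdaMin (featureCov φ β) * (1 - M.γ) * (1 - √M.γ)

/-- `∫ KL(π*(·|s)|π₀(·|s)) d_ρ^{π*}(ds) ∈ [0,∞]`. -/
noncomputable def initialKL (ρ : Measure S) (πstar π₀ : Policy S A) : ℝ≥0∞ :=
  ∫⁻ s, InformationTheory.klDiv (πstar.kernel s) (π₀.kernel s)
    ∂(occupancy M.γ (M.stateKernel πstar) ρ)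

end RegMDP

end ActorCritic

/-! ### Bounded measurable functions -/

namespace ActorCritic

/-! The proof is a Lyapunov argument for the actor coupled to a tracking estimate for the critic.
Let Y(t) be the integral of KL(π*|π_t) against the state occupancy measure of π*, and let ϑ_t be the
parameter with Q^{π_t} = ⟨ϑ_t, φ⟩.

Actor. Since the log-density of π_t has time derivative -A_t, Y' is the integral of A_t against the
state-action occupancy measure of π*. For an exact critic, `performance_difference` identifies this
with (1-γ)(V* - V_t) - τY. A critic error θ_t - ϑ_t adds the difference of its integrals under π*
and π_t. The linearised Pinsker inequality `integral_sub_integral_tilted_le` bounds this by τY/2 +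
|θ_t - ϑ_t|²/τ. Thus Y' ≤ (1-γ)(V* - V_t) - τY/2 + |θ_t - ϑ_t|²/τ (`integral_advantage_le`). The
integrating factor exp(τt/2), with Y ≥ 0 and V_r bounded below by its minimum, gives the claim up to
the weighted integral of the squared critic error.

Critic. The temporal-difference operator is coercive with constant Γ (`gam_mul_sq_le`), so the
squared error decays at rate 2Γη_t, up to the drift of ϑ_t, which is Lipschitz in time.
`integral_tracking_error_le` converts this into a bound by the weighted integral of 1/η. As η is
only monotone, the division by η goes through a second mean value inequality.

Stability. Both estimates need uniform bounds. Log-densities are controlled by the supremum of |θ|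
through variation of constants (`abs_log_density_le`). They feed back into the critic through the
entropy with slope 2γ, and a maximum argument closes the loop because Γ > 2γ (`norm_critic_le`).
Bounded log-densities keep π_t in Π_μ, so realisability applies at every time. No density of π* is
needed: comparison with π_0 makes its total entropy finite, and this suffices. -/

/-- Bounded measurable real functions. -/
structure BddMeas {X : Type*} [MeasurableSpace X] (f : X → ℝ) : Prop where
  measurable : Measurable f
  bdd : ∃ C : ℝ, ∀ x, |f x| ≤ C

namespace BddMeas

variable {X Y : Type*} [MeasurableSpace X] [MeasurableSpace Y] {f g : X → ℝ}

theorem const (c : ℝ) : BddMeas fun _ : X => c := ⟨measurable_const, |c|, fun _ => le_rfl⟩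

theorem add (hf : BddMeas f) (hg : BddMeas g) : BddMeas fun x => f x + g x := by
  obtain ⟨C, hC⟩ := hf.bdd
  obtain ⟨D, hD⟩ := hg.bdd
  exact ⟨hf.measurable.add hg.measurable, C + D,
    fun x => (abs_add_le _ _).trans (add_le_add (hC x) (hD x))⟩

theorem neg (hf : BddMeas f) : BddMeas fun x => -f x := by
  obtain ⟨C, hC⟩ := hf.bdd
  exact ⟨hf.measurable.neg, C, fun x => by simpa using hC x⟩

theorem sub (hf : BddMeas f) (hg : BddMeas g) : BddMeas fun x => f x - g x := by
  simpa [sub_eq_add_neg] using hf.add hg.neg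

theorem mul (hf : BddMeas f) (hg : BddMeas g) : BddMeas fun x => f x * g x := by
  obtain ⟨C, hC⟩ := hf.bdd
  obtain ⟨D, hD⟩ := hg.bdd
  refine ⟨hf.measurable.mul hg.measurable, C * D, fun x => ?_⟩
  rw [abs_mul]
  exact mul_le_mul (hC x) (hD x) (abs_nonneg _) ((abs_nonneg _).trans (hC x))

theorem const_mul (c : ℝ) (hf : BddMeas f) : BddMeas fun x => c * f x := (const c).mul hf

theorem comp (hf : BddMeas f) {k : Y → X} (hk : Measurable k) : BddMeas fun y => f (k y) := by
  obtain ⟨C, hC⟩ := hf.bdd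
  exact ⟨hf.measurable.comp hk, C, fun y => hC _⟩

theorem integrable (hf : BddMeas f) (ν : Measure X) [IsFiniteMeasure ν] : Integrable f ν := by
  obtain ⟨C, hC⟩ := hf.bdd
  exact Integrable.of_bound hf.measurable.aestronglyMeasurable C (ae_of_all _ hC)

theorem integral_kernel (hf : BddMeas f) (κ : Kernel Y X) [IsMarkovKernel κ] :
    BddMeas fun y => ∫ x, f x ∂κ y := by
  obtain ⟨C, hC⟩ := hf.bdd
  refine ⟨(hf.measurable.stronglyMeasurable.integral_kernel).measurable, C, fun y => ?_⟩
  have := norm_integral_le_of_norm_le_const (μ := κ y) (f := f) (ae_of_all _ hC)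
  simpa using this

theorem integral_kernel_prod {f : X × Y → ℝ} (hf : BddMeas f) (κ : Kernel X Y)
    [IsMarkovKernel κ] : BddMeas fun x => ∫ y, f (x, y) ∂κ x := by
  obtain ⟨C, hC⟩ := hf.bdd
  refine ⟨(hf.measurable.stronglyMeasurable.integral_kernel_prod_right').measurable, C,
    fun y => ?_⟩
  have := norm_integral_le_of_norm_le_const (μ := κ y) (f := fun x => f (y, x))
    (ae_of_all _ fun x => hC (y, x))
  simpa using this

end BddMeas

theorem abs_integral_le_of_abs_le {X : Type*} [MeasurableSpace X] {f : X → ℝ} {C : ℝ}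
    (hC : ∀ x, |f x| ≤ C) (ν : Measure X) [IsProbabilityMeasure ν] : |∫ x, f x ∂ν| ≤ C := by
  have := norm_integral_le_of_norm_le_const (μ := ν) (f := f) (ae_of_all _ hC)
  simpa using this

/-! ### Discounted occupancy measures -/

section Occupancy

variable {X : Type*} [MeasurableSpace X] {γ : ℝ} (κ : Kernel X X)

instance isMarkovKernel_pow [IsMarkovKernel κ] (n : ℕ) : IsMarkovKernel (κ ^ n) := by
  induction n with
  | zero => rw [pow_zero]; exact inferInstanceAs (IsMarkovKernel (Kernel.id : Kernel X X))
  | succ n ih => rw [pow_succ]; exact inferInstanceAs (IsMarkovKernel ((κ ^ n) ∘ₖ κ))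

theorem pow_zero_comp_measure (ν : Measure X) : (κ ^ 0 : Kernel X X) ∘ₘ ν = ν := by
  rw [pow_zero]; exact Measure.id_comp

theorem pow_succ_comp_measure (n : ℕ) (ν : Measure X) :
    (κ ^ (n + 1)) ∘ₘ ν = κ ∘ₘ ((κ ^ n) ∘ₘ ν) := by
  rw [pow_succ', Measure.comp_assoc]; rfl

theorem lintegral_occupancy (γ : ℝ) (ν : Measure X) (f : X → ℝ≥0∞) :
    ∫⁻ x, f x ∂occupancy γ κ ν =
      ENNReal.ofReal (1 - γ) * ∑' n : ℕ, ENNReal.ofReal (γ ^ n) * ∫⁻ x, f x ∂((κ ^ n) ∘ₘ ν) := by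
  simp [occupancy, lintegral_smul_measure, lintegral_sum_measure]

theorem tsum_ofReal_pow (h0 : 0 < γ) (h1 : γ < 1) :
    ENNReal.ofReal (1 - γ) * ∑' n : ℕ, ENNReal.ofReal (γ ^ n) = 1 := by
  rw [← ENNReal.ofReal_tsum_of_nonneg (fun n => by positivity)
    (summable_geometric_of_lt_one h0.le h1), tsum_geometric_of_lt_one h0.le h1,
    ← ENNReal.ofReal_mul (by linarith), mul_inv_cancel₀ (by linarith), ENNReal.ofReal_one]

theorem isProbabilityMeasure_occupancy [IsMarkovKernel κ] (h0 : 0 < γ) (h1 : γ < 1)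
    (ν : Measure X) [IsProbabilityMeasure ν] : IsProbabilityMeasure (occupancy γ κ ν) := by
  constructor
  have := lintegral_occupancy κ γ ν 1
  simp only [Pi.one_apply, lintegral_one, measure_univ, mul_one] at this
  rw [this, tsum_ofReal_pow h0 h1]

/-- The occupancy measure as a kernel in the initial state. -/
noncomputable def occKernel (γ : ℝ) : Kernel X X where
  toFun x := occupancy γ κ (Measure.dirac x)
  measurable' := by
    refine Measure.measurable_of_measurable_coe _ fun s hs => ?_
    have : (fun x => occupancy γ κ (Measure.dirac x) s) = fun x =>
        ENNReal.ofReal (1 - γ) * ∑' n : ℕ, ENNReal.ofReal (γ ^ n) * (κ ^ n) x s := by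
      ext x
      rw [← lintegral_indicator_one hs, lintegral_occupancy]
      simp [lintegral_indicator_one hs, Measure.dirac_bind (κ ^ _).measurable]
    rw [this]
    exact (Measurable.tsum fun n => ((κ ^ n).measurable_coe hs).const_mul _).const_mul _

theorem occKernel_apply (x : X) : occKernel κ γ x = occupancy γ κ (Measure.dirac x) := rfl

theorem isMarkovKernel_occKernel [IsMarkovKernel κ] (h0 : 0 < γ) (h1 : γ < 1) :
    IsMarkovKernel (occKernel κ γ) :=
  ⟨fun _ => isProbabilityMeasure_occupancy κ h0 h1 _⟩

theorem occKernel_comp (ν : Measure X) : occKernel κ γ ∘ₘ ν = occupancy γ κ ν := by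
  ext s hs
  rw [Measure.bind_apply hs (Kernel.aemeasurable _), ← lintegral_indicator_one hs,
    lintegral_occupancy]
  have : ∀ x, occKernel κ γ x s =
      ENNReal.ofReal (1 - γ) * ∑' n : ℕ, ENNReal.ofReal (γ ^ n) * (κ ^ n) x s := by
    intro y
    rw [occKernel_apply, ← lintegral_indicator_one hs, lintegral_occupancy]
    simp [lintegral_indicator_one hs, Measure.dirac_bind (κ ^ _).measurable]
  simp_rw [this]
  rw [lintegral_const_mul _
    (Measurable.tsum fun n => ((κ ^ n).measurable_coe hs).const_mul _),
    lintegral_tsum fun n => (((κ ^ n).measurable_coe hs).const_mul _).aemeasurable]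
  congr 2
  ext n
  rw [lintegral_const_mul _ ((κ ^ n).measurable_coe hs), lintegral_indicator_one hs,
    Measure.bind_apply hs (Kernel.aemeasurable _)]

/-- Splitting off the term n = 0 of the series leaves γ times its shift. This fixed-point equation
stands in for the series in the coercivity and performance-difference arguments. -/
theorem occupancy_eq_add (h0 : 0 < γ) (ν : Measure X) :
    occupancy γ κ ν =
      ENNReal.ofReal (1 - γ) • ν + ENNReal.ofReal γ • (κ ∘ₘ occupancy γ κ ν) := by
  ext s hs
  have h1 : (κ ∘ₘ occupancy γ κ ν) s = ENNReal.ofReal (1 - γ) *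
      ∑' n : ℕ, ENNReal.ofReal (γ ^ n) * ((κ ^ (n + 1)) ∘ₘ ν) s := by
    rw [Measure.bind_apply hs (Kernel.aemeasurable _), lintegral_occupancy]
    simp_rw [pow_succ_comp_measure]
    congr 3
    ext n
    rw [Measure.bind_apply (m := (κ ^ n) ∘ₘ ν) hs (Kernel.aemeasurable _)]
  rw [Measure.add_apply, Measure.smul_apply, Measure.smul_apply, h1,
    ← lintegral_indicator_one hs, lintegral_occupancy, tsum_eq_zero_add' ENNReal.summable]
  rw [pow_zero_comp_measure]
  simp only [lintegral_indicator_one hs, smul_eq_mul, pow_zero,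
    ENNReal.ofReal_one, one_mul, mul_add]
  congr 1
  rw [mul_left_comm, ← ENNReal.tsum_mul_left (a := ENNReal.ofReal γ)]
  refine congrArg (ENNReal.ofReal (1 - γ) * ·) (tsum_congr fun n => ?_)
  rw [pow_succ', ENNReal.ofReal_mul h0.le, mul_assoc]

theorem integral_comp_measure {Y : Type*} [MeasurableSpace Y] (η : Kernel X Y) [IsMarkovKernel η]
    (ν : Measure X) [IsProbabilityMeasure ν] {f : Y → ℝ} (hf : BddMeas f) :
    ∫ y, f y ∂(η ∘ₘ ν) = ∫ x, ∫ y, f y ∂η x ∂ν := by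
  rw [Measure.comp_eq_comp_const_apply, Kernel.integral_comp, Kernel.const_apply]
  exact hf.integrable _

theorem integral_occupancy_eq_add [IsMarkovKernel κ] (h0 : 0 < γ) (h1 : γ < 1)
    (ν : Measure X) [IsProbabilityMeasure ν] {f : X → ℝ} (hf : BddMeas f) :
    ∫ x, f x ∂occupancy γ κ ν =
      (1 - γ) * ∫ x, f x ∂ν + γ * ∫ x, ∫ y, f y ∂κ x ∂occupancy γ κ ν := by
  have := isProbabilityMeasure_occupancy κ h0 h1 ν
  conv_lhs => rw [occupancy_eq_add κ h0 ν]
  rw [integral_add_measure, integral_smul_measure, integral_smul_measure,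
    integral_comp_measure _ _ hf, ENNReal.toReal_ofReal (by linarith),
    ENNReal.toReal_ofReal h0.le, smul_eq_mul, smul_eq_mul]
  · exact (hf.integrable _).smul_measure ENNReal.ofReal_ne_top
  · exact (hf.integrable _).smul_measure ENNReal.ofReal_ne_top

theorem integral_occupancy_eq_integral_occKernel [IsMarkovKernel κ] (h0 : 0 < γ) (h1 : γ < 1)
    (ν : Measure X) [IsProbabilityMeasure ν] {f : X → ℝ} (hf : BddMeas f) :
    ∫ x, f x ∂occupancy γ κ ν = ∫ x, ∫ y, f y ∂occKernel κ γ x ∂ν := by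
  have := isMarkovKernel_occKernel κ h0 h1
  rw [← occKernel_comp, integral_comp_measure _ _ hf]

/-- The kernel commutes with its own powers, so one step may be taken before or after averaging.
Together with `occupancy_eq_add` this yields the one-step equation in the starting point. -/
theorem occupancy_comp (ν : Measure X) :
    occupancy γ κ (κ ∘ₘ ν) = κ ∘ₘ occupancy γ κ ν := by
  ext s hs
  rw [Measure.bind_apply hs (Kernel.aemeasurable _), lintegral_occupancy,
    ← lintegral_indicator_one hs, lintegral_occupancy]
  congr 3
  ext n
  rw [lintegral_indicator_one hs, ← Measure.bind_apply (m := (κ ^ n) ∘ₘ ν) hs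
    (Kernel.aemeasurable _), ← pow_succ_comp_measure, pow_succ, Measure.comp_assoc]
  rfl

/-- The discounted sum of `f` along the chain satisfies the one-step equation. -/
theorem integral_occKernel_eq [IsMarkovKernel κ] (h0 : 0 < γ) (h1 : γ < 1)
    {f : X → ℝ} (hf : BddMeas f) (x : X) :
    ∫ y, f y ∂occKernel κ γ x =
      (1 - γ) * f x + γ * ∫ z, ∫ y, f y ∂occKernel κ γ z ∂κ x := by
  have h2 := isMarkovKernel_occKernel κ h0 h1
  rw [← integral_occupancy_eq_integral_occKernel κ h0 h1 _ hf]
  conv_rhs => rw [← Measure.dirac_bind κ.measurable x]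
  rw [occupancy_comp, occKernel_apply, integral_occupancy_eq_add κ h0 h1 _ hf]
  have := isProbabilityMeasure_occupancy κ h0 h1 (Measure.dirac x)
  rw [integral_comp_measure _ _ hf, integral_dirac' _ _ hf.measurable.stronglyMeasurable]

end Occupancy

/-! ### Path measures of Markov chains and their marginals -/

section Path

variable {X : Type*} [MeasurableSpace X] (κ : Kernel X X) [IsMarkovKernel κ]

/-- The path measure of the homogeneous Markov chain with kernel `κ` and initial law `ν`. -/
noncomputable def chainMeasure (ν : Measure X) : Measure (ℕ → X) :=
  Kernel.trajMeasure (X := fun _ => X) ν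
    (fun n => κ.comap (fun x : (i : Finset.Iic n) → X => x ⟨n, Finset.mem_Iic.2 le_rfl⟩)
      (measurable_pi_apply _))

instance (ν : Measure X) [IsProbabilityMeasure ν] : IsProbabilityMeasure (chainMeasure κ ν) := by
  unfold chainMeasure; infer_instance

/-- Induction on n: the law of coordinate n+1 given the past depends on coordinate n only. This
links expectations over trajectories to the powers of κ inside the occupancy measure. -/
theorem map_eval_chainMeasure (ν : Measure X) [IsProbabilityMeasure ν] (n : ℕ) :
    (chainMeasure κ ν).map (fun ω => ω n) = (κ ^ n) ∘ₘ ν := by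
  induction n with
  | zero =>
    rw [pow_zero_comp_measure, chainMeasure, Kernel.trajMeasure, Measure.map_comp _ _ (by fun_prop)]
    have hf : (fun x : ℕ → X ↦ x 0) =
      (fun x : (i : Finset.Iic 0) → X ↦ x ⟨0, Finset.mem_Iic.2 le_rfl⟩) ∘
        Preorder.frestrictLe 0 := rfl
    rw [hf, Kernel.map_comp_right _ (Preorder.measurable_frestrictLe 0) (by fun_prop), Kernel.traj_map_frestrictLe,
      Kernel.partialTraj_self, ← Measure.map_comp _ _ (by fun_prop), Measure.id_comp,
      Measure.map_map (by fun_prop) (by fun_prop)]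
    exact Measure.map_id
  | succ n ih =>
    have h := Kernel.map_frestrictLe_trajMeasure_compProd_eq_map_trajMeasure
      (X := fun _ => X) (μ₀ := ν)
      (κ := fun n => κ.comap (fun x : (i : Finset.Iic n) → X => x ⟨n, Finset.mem_Iic.2 le_rfl⟩)
      (measurable_pi_apply _)) (a := n)
    have h2 := congrArg Measure.snd h
    rw [Measure.snd_compProd, Measure.snd, Measure.map_map measurable_snd (by fun_prop)] at h2
    rw [pow_succ_comp_measure, ← ih]
    refine h2.symm.trans ?_
    ext s hs
    rw [Measure.bind_apply hs (Kernel.aemeasurable _), Measure.bind_apply hs (Kernel.aemeasurable _),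
      lintegral_map (Kernel.measurable_coe _ hs) (by fun_prop),
      lintegral_map (Kernel.measurable_coe _ hs) (by fun_prop)]
    rfl

variable {γ : ℝ}

theorem lintegral_chainMeasure_tsum (ν : Measure X) [IsProbabilityMeasure ν]
    {f : X → ℝ≥0∞} (hf : Measurable f) :
    ENNReal.ofReal (1 - γ) *
        ∫⁻ ω, ∑' n : ℕ, ENNReal.ofReal (γ ^ n) * f (ω n) ∂chainMeasure κ ν =
      ∫⁻ x, f x ∂occupancy γ κ ν := by
  rw [lintegral_occupancy, lintegral_tsum (f := fun n (ω : ℕ → X) => ENNReal.ofReal (γ ^ n) * f (ω n)) fun n =>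
    ((hf.comp (measurable_pi_apply n)).const_mul _).aemeasurable]
  congr 2
  ext n
  rw [lintegral_const_mul _ (f := fun ω : ℕ → X => f (ω n))
    (hf.comp (measurable_pi_apply n)), ← map_eval_chainMeasure,
    lintegral_map hf (by fun_prop)]

theorem integral_chainMeasure_tsum (h0 : 0 < γ) (h1 : γ < 1) (ν : Measure X)
    [IsProbabilityMeasure ν] {f : X → ℝ} (hf : BddMeas f) :
    (1 - γ) * ∫ ω, ∑' n : ℕ, γ ^ n * f (ω n) ∂chainMeasure κ ν =
      ∫ x, f x ∂occupancy γ κ ν := by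
  obtain ⟨C, hC⟩ := hf.bdd
  have := isProbabilityMeasure_occupancy κ h0 h1 ν
  have hint : ∀ n : ℕ, BddMeas fun ω : ℕ → X => γ ^ n * f (ω n) := fun n =>
    (hf.comp (measurable_pi_apply n)).const_mul _
  have hsum : Summable fun n : ℕ => ∫ ω, ‖γ ^ n * f (ω n)‖ ∂chainMeasure κ ν := by
    refine Summable.of_nonneg_of_le (fun n => by positivity) (fun n => ?_)
      ((summable_geometric_of_lt_one h0.le h1).mul_right C)
    refine (le_abs_self _).trans (abs_integral_le_of_abs_le (fun ω => ?_) _)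
    rw [norm_mul, norm_pow, Real.norm_of_nonneg h0.le, abs_mul, abs_norm, abs_pow, abs_of_pos h0]
    exact mul_le_mul_of_nonneg_left (hC _) (by positivity)
  rw [integral_tsum_of_summable_integral_norm (fun n => (hint n).integrable _) hsum |>.symm]
  have hocc : Integrable f (Measure.sum fun n : ℕ => ENNReal.ofReal (γ ^ n) • ((κ ^ n) ∘ₘ ν)) := by
    have h := (hf.integrable (occupancy γ κ ν))
    rw [occupancy] at h
    exact (integrable_smul_measure (by simpa using h1) ENNReal.ofReal_ne_top).1 h
  rw [occupancy, integral_smul_measure, integral_sum_measure hocc, smul_eq_mul,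
    ENNReal.toReal_ofReal (by linarith)]
  congr 2
  ext n
  rw [integral_smul_measure, ENNReal.toReal_ofReal (by positivity), integral_const_mul, smul_eq_mul,
    ← map_eval_chainMeasure, integral_map (measurable_pi_apply n).aemeasurable hf.measurable.aestronglyMeasurable]

end Path

end ActorCritic

/-! ### Relative entropy and exponential tilting -/

namespace ActorCritic

open InformationTheory

/-- The jointly measurable Radon–Nikodym derivative of kernels replaces the pointwise ones, and the
set of s with `κ s ≪ μ` is measurable. Both rest on the countability assumption, which Polish spaces
satisfy. -/
theorem measurable_klDiv_kernel {S A : Type*} [MeasurableSpace S] [MeasurableSpace A]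
    [MeasurableSpace.CountableOrCountablyGenerated S A] (κ : Kernel S A) [IsMarkovKernel κ]
    (μ : Measure A) [IsProbabilityMeasure μ] : Measurable fun s => klDiv (κ s) μ := by
  classical
  have h : (fun s => klDiv (κ s) μ) = fun s => if κ s ≪ Kernel.const S μ s then
      ∫⁻ a, ENNReal.ofReal (klFun (κ.rnDeriv (Kernel.const S μ) s a).toReal) ∂μ else ⊤ := by
    ext s
    rw [klDiv_eq_lintegral_klFun]
    by_cases hs : κ s ≪ μ
    · rw [if_pos hs, if_pos (by simpa using hs)]
      refine lintegral_congr_ae ?_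
      have := Kernel.rnDeriv_eq_rnDeriv_measure (κ := κ) (η := Kernel.const S μ) (a := s)
      rw [Kernel.const_apply] at this
      filter_upwards [this] with a ha
      rw [ha]
    · rw [if_neg hs, if_neg (by simpa using hs)]
  rw [h]
  refine Measurable.ite (Kernel.measurableSet_absolutelyContinuous _ _) ?_ measurable_const
  have hm : Measurable fun x : S × A =>
      ENNReal.ofReal (klFun (κ.rnDeriv (Kernel.const S μ) x.1 x.2).toReal) :=
    (measurable_klFun.comp
      (Kernel.measurable_rnDeriv κ (Kernel.const S μ)).ennreal_toReal).ennreal_ofReal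
  exact hm.lintegral_prod_right'

section Tilted

variable {A : Type*} [MeasurableSpace A] {μ ν : Measure A} [IsProbabilityMeasure μ]
  [IsProbabilityMeasure ν] {h : A → ℝ}

theorem BddMeas.exp (hh : BddMeas h) : BddMeas fun a => Real.exp (h a) := by
  obtain ⟨C, hC⟩ := hh.bdd
  refine ⟨hh.measurable.exp, Real.exp C, fun x => ?_⟩
  rw [Real.abs_exp]
  exact Real.exp_le_exp.2 ((le_abs_self _).trans (hC x))

/-- Tilting the reference measure shifts the log-likelihood ratio by -h plus a constant. This
expresses KL(π*|π_t) through KL(π*|μ) and the log-density of π_t, so that only the latter depends on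
time. -/
theorem klDiv_tilted_right (hν : klDiv ν μ ≠ ⊤) (hh : BddMeas h) :
    klDiv ν (μ.tilted h) =
      ENNReal.ofReal ((klDiv ν μ).toReal - ∫ a, h a ∂ν + Real.log (∫ a, Real.exp (h a) ∂μ)) := by
  obtain ⟨hac, hint⟩ := klDiv_ne_top_iff.1 hν
  have hexp : Integrable (fun a => Real.exp (h a)) μ := hh.exp.integrable μ
  have := isProbabilityMeasure_tilted hexp
  rw [klDiv_of_ac_of_integrable (hac.trans (absolutelyContinuous_tilted hexp))
    (integrable_llr_tilted_right hac (hh.integrable ν) hint hexp),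
    integral_llr_tilted_right hac (hh.integrable ν) hexp hint,
    toReal_klDiv_of_measure_eq hac (by simp)]
  simp

/-- Gibbs variational inequality. -/
theorem integral_le_toReal_klDiv_add_log (hν : klDiv ν μ ≠ ⊤) (hh : BddMeas h) :
    ∫ a, h a ∂ν ≤ (klDiv ν μ).toReal + Real.log (∫ a, Real.exp (h a) ∂μ) := by
  obtain ⟨hac, hint⟩ := klDiv_ne_top_iff.1 hν
  have hexp : Integrable (fun a => Real.exp (h a)) μ := hh.exp.integrable μ
  have := isProbabilityMeasure_tilted hexp
  have h1 := integral_llr_add_sub_measure_univ_nonneg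
    (hac.trans (absolutelyContinuous_tilted hexp))
    (integrable_llr_tilted_right hac (hh.integrable ν) hint hexp)
  rw [integral_llr_tilted_right hac (hh.integrable ν) hexp hint] at h1
  rw [toReal_klDiv_of_measure_eq hac (by simp)]
  simp at h1
  linarith

/-- A linearised form of Pinsker's inequality. -/
theorem integral_sub_integral_tilted_le (hν : klDiv ν μ ≠ ⊤) (hh : BddMeas h)
    (hh1 : ∫ a, Real.exp (h a) ∂μ = 1) {g : A → ℝ} (hg : BddMeas g) {e τ : ℝ}
    (he : ∀ a, |g a| ≤ e) (hτ : 0 < τ) :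
    ∫ a, g a ∂ν - ∫ a, g a ∂(μ.tilted h) ≤
      τ / 2 * ((klDiv ν μ).toReal - ∫ a, h a ∂ν) + e ^ 2 / τ := by
  have hexp : Integrable (fun a => Real.exp (h a)) μ := hh.exp.integrable μ
  have := isProbabilityMeasure_tilted hexp
  set m := ∫ a, g a ∂(μ.tilted h)
  have hsub := hasSubgaussianMGF_of_mem_Icc (μ := μ.tilted h) hg.measurable.aemeasurable
    (a := -e) (b := e) (ae_of_all _ fun a => abs_le.1 (he a))
  -- Hoeffding's lemma for values in [-e, e]. The parameter 2/τ is chosen so that the relative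
  -- entropy ends up with coefficient τ/2.
  have hmgf := hsub.mgf_le (2 / τ)
  -- Including h in the Gibbs test function makes its exponential moment under μ the moment
  -- generating function of g - m under the tilted measure.
  have hb : BddMeas fun a => h a + 2 / τ * (g a - m) :=
    hh.add ((hg.sub (BddMeas.const m)).const_mul _)
  have hI : ∫ a, Real.exp (h a + 2 / τ * (g a - m)) ∂μ =
      mgf (fun a => g a - m) (μ.tilted h) (2 / τ) := by
    rw [mgf, integral_tilted, hh1]
    simp [Real.exp_add]
  have hc : (((‖e - -e‖₊ / 2) ^ 2 : NNReal) : ℝ) = e ^ 2 := by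
    push_cast
    rw [Real.norm_eq_abs, div_pow, sq_abs]
    ring
  have key := integral_le_toReal_klDiv_add_log hν hb
  have hlog : Real.log (∫ a, Real.exp (h a + 2 / τ * (g a - m)) ∂μ) ≤ e ^ 2 * (2 / τ) ^ 2 / 2 := by
    rw [hI, Real.log_le_iff_le_exp]
    · rw [hc] at hmgf
      exact hmgf
    · rw [← hI]
      exact integral_exp_pos (hb.exp.integrable μ)
  have h3 : ∫ a, (h a + 2 / τ * (g a - m)) ∂ν = ∫ a, h a ∂ν + 2 / τ * (∫ a, g a ∂ν - m) := by
    rw [integral_add (hh.integrable ν) (((hg.sub (BddMeas.const m)).const_mul _).integrable ν),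
      integral_const_mul, integral_sub (hg.integrable ν) (integrable_const _)]
    simp
  rw [h3] at key
  have h4 : 2 / τ * (∫ a, g a ∂ν - m) ≤
      (klDiv ν μ).toReal - ∫ a, h a ∂ν + e ^ 2 * (2 / τ) ^ 2 / 2 := by linarith
  have h5 := mul_le_mul_of_nonneg_left h4 (by positivity : 0 ≤ τ / 2)
  calc _ = τ / 2 * (2 / τ * (∫ a, g a ∂ν - m)) := by field_simp
    _ ≤ _ := h5
    _ = _ := by field_simp

/-- With the normalisation `hh1`, the log-likelihood ratio of the tilted measure is h itself almost
everywhere. -/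
theorem klDiv_tilted_left (hh : BddMeas h) (hh1 : ∫ a, Real.exp (h a) ∂μ = 1) :
    klDiv (μ.tilted h) μ = ENNReal.ofReal (∫ a, h a ∂μ.tilted h) := by
  have hexp : Integrable (fun a => Real.exp (h a)) μ := hh.exp.integrable μ
  have := isProbabilityMeasure_tilted hexp
  have hac : μ.tilted h ≪ μ := tilted_absolutelyContinuous _ _
  have hllr : llr (μ.tilted h) μ =ᵐ[μ.tilted h] h := by
    filter_upwards [hac.ae_le (log_rnDeriv_tilted_left_self hexp)] with a ha
    rw [llr, ha, hh1, Real.log_one, sub_zero]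
  rw [klDiv_of_ac_of_integrable hac ((integrable_congr hllr).2 (hh.integrable _)),
    integral_congr_ae hllr]
  simp

theorem integral_tilted_nonneg (hh : BddMeas h) (hh1 : ∫ a, Real.exp (h a) ∂μ = 1) :
    0 ≤ ∫ a, h a ∂μ.tilted h := by
  have hexp : Integrable (fun a => Real.exp (h a)) μ := hh.exp.integrable μ
  have := isProbabilityMeasure_tilted hexp
  have hac : μ.tilted h ≪ μ := tilted_absolutelyContinuous _ _
  have hllr : llr (μ.tilted h) μ =ᵐ[μ.tilted h] h := by
    filter_upwards [hac.ae_le (log_rnDeriv_tilted_left_self hexp)] with a ha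
    rw [llr, ha, hh1, Real.log_one, sub_zero]
  have h2 := integral_llr_add_sub_measure_univ_nonneg hac
    ((integrable_congr hllr).2 (hh.integrable _))
  rw [integral_congr_ae hllr] at h2
  simpa using h2

end Tilted

/-! ### Transition kernels and occupancy measures of a policy -/

namespace RegMDP

variable {S A : Type*} [MeasurableSpace S] [MeasurableSpace A] (M : RegMDP S A) (π : Policy S A)

instance : IsMarkovKernel (M.stateKernel π) := by unfold stateKernel; infer_instance

theorem lintegral_stateKernel (s : S) {f : S → ℝ≥0∞} (hf : Measurable f) :
    ∫⁻ s', f s' ∂M.stateKernel π s = ∫⁻ a, ∫⁻ s', f s' ∂M.P (s, a) ∂π.kernel s := by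
  rw [stateKernel, Kernel.lintegral_comp _ _ _ hf, Kernel.lintegral_id_prod hf.lintegral_kernel]

theorem lintegral_stateActionKernel (x : S × A) {f : S × A → ℝ≥0∞} (hf : Measurable f) :
    ∫⁻ y, f y ∂M.stateActionKernel π x = ∫⁻ s', ∫⁻ a', f (s', a') ∂π.kernel s' ∂M.P x := by
  rw [stateActionKernel, Kernel.lintegral_compProd _ _ _ hf]
  simp

theorem integral_stateKernel (s : S) {f : S → ℝ} (hf : BddMeas f) :
    ∫ s', f s' ∂M.stateKernel π s = ∫ a, ∫ s', f s' ∂M.P (s, a) ∂π.kernel s := by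
  rw [stateKernel, Kernel.integral_comp]
  · rw [Kernel.prod_apply, Kernel.id_apply, integral_prod]
    · rw [integral_dirac']
      exact (((hf.integral_kernel M.P).integral_kernel_prod
        (Kernel.const S (π.kernel s))).measurable).stronglyMeasurable
    · exact (hf.integral_kernel M.P).integrable _
  · have : IsMarkovKernel (M.P ∘ₖ (Kernel.id ×ₖ π.kernel)) := by infer_instance
    exact hf.integrable _

theorem integral_stateActionKernel (x : S × A) {f : S × A → ℝ} (hf : BddMeas f) :
    ∫ y, f y ∂M.stateActionKernel π x = ∫ s', ∫ a', f (s', a') ∂π.kernel s' ∂M.P x := by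
  have h := hf.integrable (M.stateActionKernel π x)
  rw [stateActionKernel] at h ⊢
  rw [ProbabilityTheory.integral_compProd h]
  simp

/-- Product form is preserved by one step of the state-action chain, because actions are always
redrawn from π. Iterating, the state-action occupancy factors through the state occupancy. -/
theorem stateActionKernel_comp_compProd (ν : Measure S) [IsProbabilityMeasure ν] :
    M.stateActionKernel π ∘ₘ (ν ⊗ₘ π.kernel) = (M.stateKernel π ∘ₘ ν) ⊗ₘ π.kernel := by
  ext s hs
  have hm : Measurable (s.indicator (1 : S × A → ℝ≥0∞)) := measurable_one.indicator hs
  rw [← lintegral_indicator_one hs, ← lintegral_indicator_one hs,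
    Measure.lintegral_bind (Kernel.aemeasurable _) hm.aemeasurable,
    Measure.lintegral_compProd hm.lintegral_kernel, Measure.lintegral_compProd hm,
    Measure.lintegral_bind (Kernel.aemeasurable _)
      hm.lintegral_kernel_prod_right'.aemeasurable]
  simp_rw [lintegral_stateActionKernel M π _ hm,
    lintegral_stateKernel M π _ hm.lintegral_kernel_prod_right']

theorem pow_stateActionKernel_comp_compProd (ν : Measure S) [IsProbabilityMeasure ν] (n : ℕ) :
    (M.stateActionKernel π ^ n) ∘ₘ (ν ⊗ₘ π.kernel) =
      ((M.stateKernel π ^ n) ∘ₘ ν) ⊗ₘ π.kernel := by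
  induction n with
  | zero => rw [pow_zero_comp_measure, pow_zero_comp_measure]
  | succ n ih =>
    rw [pow_succ_comp_measure, pow_succ_comp_measure, ih, stateActionKernel_comp_compProd]

theorem occupancy_compProd (ν : Measure S) [IsProbabilityMeasure ν] :
    occupancy M.γ (M.stateActionKernel π) (ν ⊗ₘ π.kernel) =
      occupancy M.γ (M.stateKernel π) ν ⊗ₘ π.kernel := by
  have := isProbabilityMeasure_occupancy (M.stateKernel π) M.γ_pos M.γ_lt_one ν
  ext s hs
  have hm : Measurable (s.indicator (1 : S × A → ℝ≥0∞)) := measurable_one.indicator hs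
  rw [← lintegral_indicator_one hs, ← lintegral_indicator_one hs, lintegral_occupancy,
    Measure.lintegral_compProd hm, lintegral_occupancy]
  simp_rw [pow_stateActionKernel_comp_compProd, Measure.lintegral_compProd hm]

theorem integral_occupancy_stateKernel {ν : Measure S} [IsProbabilityMeasure ν] {f : S → ℝ}
    (hf : BddMeas f) :
    ∫ s, f s ∂occupancy M.γ (M.stateKernel π) ν = (1 - M.γ) * ∫ s, f s ∂ν +
      M.γ * ∫ x, ∫ s', f s' ∂M.P x ∂(occupancy M.γ (M.stateKernel π) ν ⊗ₘ π.kernel) := by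
  have := isProbabilityMeasure_occupancy (M.stateKernel π) M.γ_pos M.γ_lt_one ν
  rw [integral_occupancy_eq_add _ M.γ_pos M.γ_lt_one _ hf,
    Measure.integral_compProd ((hf.integral_kernel M.P).integrable _)]
  simp_rw [integral_stateKernel M π _ hf]

end RegMDP

end ActorCritic

/-! ### Value functions, and their Bellman equations for bounded log-densities -/

namespace ActorCritic

open InformationTheory

namespace RegMDP

variable {S A : Type*} [MeasurableSpace S] [MeasurableSpace A] {M : RegMDP S A} {π : Policy S A}
  {p : S × A → ℝ}

theorem bddMeas_c (M : RegMDP S A) : BddMeas M.c := ⟨M.measurable_c, M.bounded_c⟩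

namespace IsDensity

theorem integral_eq_one (hp : M.IsDensity π p) (s : S) : ∫ a, p (s, a) ∂M.μ = 1 := by
  have h : π.kernel s univ = 1 := measure_univ
  rw [hp.eq_withDensity, withDensity_apply _ MeasurableSet.univ, Measure.restrict_univ] at h
  rw [integral_eq_lintegral_of_nonneg_ae (ae_of_all _ fun a => (hp.pos _).le)
    (hp.measurable.comp measurable_prodMk_left).aestronglyMeasurable, h]
  rfl

theorem integral_exp_log (hp : M.IsDensity π p) (s : S) :
    ∫ a, Real.exp (Real.log (p (s, a))) ∂M.μ = 1 := by
  simp_rw [Real.exp_log (hp.pos _)]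
  exact hp.integral_eq_one s

/-- This brings policies with a positive density within reach of the tilting lemmas; the normalising
integral equals 1. -/
theorem kernel_eq_tilted (hp : M.IsDensity π p) (s : S) :
    π.kernel s = M.μ.tilted fun a => Real.log (p (s, a)) := by
  rw [Measure.tilted, hp.integral_exp_log, hp.eq_withDensity]
  simp_rw [Real.exp_log (hp.pos _), div_one]

theorem integral_kernel (hp : M.IsDensity π p) (s : S) (g : A → ℝ) :
    ∫ a, g a ∂π.kernel s = ∫ a, p (s, a) * g a ∂M.μ := by
  rw [hp.kernel_eq_tilted, integral_tilted, hp.integral_exp_log]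
  simp_rw [Real.exp_log (hp.pos _), div_one, smul_eq_mul]

theorem klDiv_eq (hp : M.IsDensity π p) (hb : BddMeas fun x => Real.log (p x)) (s : S) :
    klDiv (π.kernel s) M.μ = ENNReal.ofReal (∫ a, Real.log (p (s, a)) ∂π.kernel s) := by
  rw [hp.kernel_eq_tilted]
  exact klDiv_tilted_left (hb.comp measurable_prodMk_left) (hp.integral_exp_log s)

theorem integral_log_nonneg (hp : M.IsDensity π p) (hb : BddMeas fun x => Real.log (p x)) (s : S) :
    0 ≤ ∫ a, Real.log (p (s, a)) ∂π.kernel s := by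
  rw [hp.kernel_eq_tilted]
  exact integral_tilted_nonneg (hb.comp measurable_prodMk_left) (hp.integral_exp_log s)

theorem toReal_klDiv_eq (hp : M.IsDensity π p) (hb : BddMeas fun x => Real.log (p x)) (s : S) :
    (klDiv (π.kernel s) M.μ).toReal = ∫ a, Real.log (p (s, a)) ∂π.kernel s := by
  rw [hp.klDiv_eq hb, ENNReal.toReal_ofReal (hp.integral_log_nonneg hb s)]

theorem bddMeas_klDiv (hp : M.IsDensity π p) (hb : BddMeas fun x => Real.log (p x)) :
    BddMeas fun s => (klDiv (π.kernel s) M.μ).toReal := by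
  simp_rw [hp.toReal_klDiv_eq hb]
  exact hb.integral_kernel_prod π.kernel

end IsDensity

variable (M π)

/-- The expected discounted sum of `k` along the state-action chain started from `x`. -/
noncomputable def discounted (k : S × A → ℝ) (x : S × A) : ℝ :=
  (1 - M.γ)⁻¹ * ∫ y, k y ∂occKernel (M.stateActionKernel π) M.γ x

variable {M}

theorem bddMeas_discounted {k : S × A → ℝ} (hk : BddMeas k) : BddMeas (M.discounted π k) := by
  have := isMarkovKernel_occKernel (M.stateActionKernel π) M.γ_pos M.γ_lt_one
  exact (hk.integral_kernel _).const_mul _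

theorem discounted_eq {k : S × A → ℝ} (hk : BddMeas k) (x : S × A) :
    M.discounted π k x = k x + M.γ * ∫ y, M.discounted π k y ∂M.stateActionKernel π x := by
  have h1 : 1 - M.γ ≠ 0 := by have := M.γ_lt_one; linarith
  rw [discounted, integral_occKernel_eq _ M.γ_pos M.γ_lt_one hk]
  simp_rw [discounted]
  rw [integral_const_mul]
  field_simp

theorem integral_occupancy_eq_discounted {k : S × A → ℝ} (hk : BddMeas k) (ν : Measure S)
    [IsProbabilityMeasure ν] :
    (1 - M.γ)⁻¹ * ∫ x, k x ∂occupancy M.γ (M.stateActionKernel π) (ν ⊗ₘ π.kernel) =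
      ∫ s, ∫ a, M.discounted π k (s, a) ∂π.kernel s ∂ν := by
  rw [integral_occupancy_eq_integral_occKernel _ M.γ_pos M.γ_lt_one _ hk, ← integral_const_mul,
    ← Measure.integral_compProd ((bddMeas_discounted π hk).integrable _)]
  rfl

theorem integral_dirac_compProd_discounted {k : S × A → ℝ} (hk : BddMeas k) (s : S) :
    (1 - M.γ)⁻¹ *
        ∫ x, k x ∂occupancy M.γ (M.stateActionKernel π) (Measure.dirac s ⊗ₘ π.kernel) =
      ∫ a, M.discounted π k (s, a) ∂π.kernel s := by
  rw [integral_occupancy_eq_discounted π hk, integral_dirac']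
  exact ((bddMeas_discounted π hk).integral_kernel_prod π.kernel).measurable.stronglyMeasurable

theorem costValue_eq (s : S) :
    M.costValue π s = ∫ a, M.discounted π M.c (s, a) ∂π.kernel s := by
  have h1 : 1 - M.γ ≠ 0 := by have := M.γ_lt_one; linarith
  rw [← integral_dirac_compProd_discounted π M.bddMeas_c,
    ← integral_chainMeasure_tsum _ M.γ_pos M.γ_lt_one _ M.bddMeas_c, ← mul_assoc,
    inv_mul_cancel₀ h1, one_mul]
  rfl

theorem bddMeas_costValue : BddMeas (M.costValue π) := by
  have h : M.costValue π = fun s => ∫ a, M.discounted π M.c (s, a) ∂π.kernel s :=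
    funext (costValue_eq π)
  rw [h]
  exact (bddMeas_discounted π M.bddMeas_c).integral_kernel_prod π.kernel

theorem integral_costValue (ν : Measure S) [IsProbabilityMeasure ν] :
    ∫ s, M.costValue π s ∂ν =
      (1 - M.γ)⁻¹ * ∫ x, M.c x ∂(occupancy M.γ (M.stateKernel π) ν ⊗ₘ π.kernel) := by
  simp_rw [costValue_eq π]
  rw [← integral_occupancy_eq_discounted π M.bddMeas_c, occupancy_compProd]

section Entropy

variable [MeasurableSpace.CountableOrCountablyGenerated S A]

theorem measurable_klDiv : Measurable fun s => klDiv (π.kernel s) M.μ :=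
  measurable_klDiv_kernel _ _

theorem entropyValue_eq (s : S) :
    ENNReal.ofReal (1 - M.γ) * M.entropyValue π s =
      ∫⁻ x, klDiv (π.kernel x.1) M.μ
        ∂occupancy M.γ (M.stateActionKernel π) (Measure.dirac s ⊗ₘ π.kernel) :=
  lintegral_chainMeasure_tsum _ _ ((measurable_klDiv π).comp measurable_fst)

/-- Tonelli in [0,∞], with no finiteness assumed: it has to apply to the optimal policy before its
entropy is known to be finite. -/
theorem lintegral_entropyValue (ν : Measure S) [IsProbabilityMeasure ν] :
    ENNReal.ofReal (1 - M.γ) * ∫⁻ s, M.entropyValue π s ∂ν =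
      ∫⁻ s, klDiv (π.kernel s) M.μ ∂occupancy M.γ (M.stateKernel π) ν := by
  have hm : Measurable fun x : S × A => klDiv (π.kernel x.1) M.μ :=
    (measurable_klDiv π).comp measurable_fst
  have := isProbabilityMeasure_occupancy (M.stateKernel π) M.γ_pos M.γ_lt_one ν
  -- Quantified over the initial law because it is used both for ν and for each Dirac mass.
  have h : ∀ ν : Measure S, IsProbabilityMeasure ν → ∫⁻ x, klDiv (π.kernel x.1) M.μ
      ∂occupancy M.γ (M.stateActionKernel π) (ν ⊗ₘ π.kernel) =
      ∫⁻ s, ∫⁻ a, ∫⁻ y, klDiv (π.kernel y.1) M.μ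
        ∂occKernel (M.stateActionKernel π) M.γ (s, a) ∂π.kernel s ∂ν := by
    intro ν _
    rw [← occKernel_comp, Measure.lintegral_bind (Kernel.aemeasurable _) hm.aemeasurable,
      Measure.lintegral_compProd hm.lintegral_kernel]
  have h2 : ∫⁻ x, klDiv (π.kernel x.1) M.μ
      ∂occupancy M.γ (M.stateActionKernel π) (ν ⊗ₘ π.kernel) =
      ∫⁻ s, klDiv (π.kernel s) M.μ ∂occupancy M.γ (M.stateKernel π) ν := by
    rw [occupancy_compProd, Measure.lintegral_compProd hm]
    simp
  rw [← lintegral_const_mul' _ _ ENNReal.ofReal_ne_top]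
  simp_rw [entropyValue_eq π]
  rw [← h2, h ν inferInstance]
  refine lintegral_congr fun s => ?_
  rw [h _ inferInstance, lintegral_dirac']
  exact hm.lintegral_kernel.lintegral_kernel_prod_right'

variable {π}

theorem IsDensity.entropyValue_eq (hp : M.IsDensity π p) (hb : BddMeas fun x => Real.log (p x))
    (s : S) : M.entropyValue π s = ENNReal.ofReal (∫ a, M.discounted π
      (fun x => (klDiv (π.kernel x.1) M.μ).toReal) (s, a) ∂π.kernel s) := by
  have h1 : 0 < 1 - M.γ := by have := M.γ_lt_one; linarith
  have hk : BddMeas fun x : S × A => (klDiv (π.kernel x.1) M.μ).toReal :=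
    (hp.bddMeas_klDiv hb).comp measurable_fst
  have := isProbabilityMeasure_occupancy (M.stateActionKernel π) M.γ_pos M.γ_lt_one
    (Measure.dirac s ⊗ₘ π.kernel)
  have h2 := RegMDP.entropyValue_eq (M := M) π s
  have h3 : ∀ s, klDiv (π.kernel s) M.μ = ENNReal.ofReal (klDiv (π.kernel s) M.μ).toReal :=
    fun s => (ENNReal.ofReal_toReal (by rw [hp.klDiv_eq hb]; exact ENNReal.ofReal_ne_top)).symm
  have h4 : ∫⁻ x, klDiv (π.kernel x.1) M.μ
      ∂occupancy M.γ (M.stateActionKernel π) (Measure.dirac s ⊗ₘ π.kernel) =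
      ENNReal.ofReal (∫ x, (klDiv (π.kernel x.1) M.μ).toReal
        ∂occupancy M.γ (M.stateActionKernel π) (Measure.dirac s ⊗ₘ π.kernel)) := by
    rw [ofReal_integral_eq_lintegral_ofReal (hk.integrable _)
      (ae_of_all _ fun _ => ENNReal.toReal_nonneg)]
    exact lintegral_congr fun x => h3 x.1
  rw [h4] at h2
  rw [← integral_dirac_compProd_discounted π hk, ENNReal.ofReal_mul (by positivity), ← h2,
    ← mul_assoc, ← ENNReal.ofReal_mul (by positivity), inv_mul_cancel₀ h1.ne', ENNReal.ofReal_one,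
    one_mul]

end Entropy

/-- The running cost including the entropy regularisation. -/
noncomputable def regCost (M : RegMDP S A) (π : Policy S A) (x : S × A) : ℝ :=
  M.c x + M.τ * (klDiv (π.kernel x.1) M.μ).toReal

/-- The value function as a real number (meaningful when the value is finite). -/
noncomputable def realValue (M : RegMDP S A) (π : Policy S A) (s : S) : ℝ := (M.value π s).toReal

theorem qValue_eq (x : S × A) : M.qValue π x = M.c x + M.γ * ∫ s', M.realValue π s' ∂M.P x := rfl

theorem discounted_klDiv_nonneg (x : S × A) :
    0 ≤ M.discounted π (fun x => (klDiv (π.kernel x.1) M.μ).toReal) x := by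
  have h1 : 0 < 1 - M.γ := by have := M.γ_lt_one; linarith
  exact mul_nonneg (by positivity) (integral_nonneg fun _ => ENNReal.toReal_nonneg)

namespace IsDensity

variable {π} (hp : M.IsDensity π p)
  (hb : BddMeas fun x => Real.log (p x))
include hp hb

theorem bddMeas_regCost : BddMeas (M.regCost π) :=
  M.bddMeas_c.add (((hp.bddMeas_klDiv hb).comp measurable_fst).const_mul _)

theorem discounted_regCost (x : S × A) : M.discounted π (M.regCost π) x =
    M.discounted π M.c x +
      M.τ * M.discounted π (fun x => (klDiv (π.kernel x.1) M.μ).toReal) x := by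
  have := isMarkovKernel_occKernel (M.stateActionKernel π) M.γ_pos M.γ_lt_one
  have hk : BddMeas fun x : S × A => (klDiv (π.kernel x.1) M.μ).toReal :=
    (hp.bddMeas_klDiv hb).comp measurable_fst
  simp only [discounted, regCost]
  rw [integral_add (M.bddMeas_c.integrable _) ((hk.const_mul _).integrable _), integral_const_mul]
  ring

variable [MeasurableSpace.CountableOrCountablyGenerated S A]

theorem value_eq_coe (s : S) : M.value π s =
    ((∫ a, M.discounted π (M.regCost π) (s, a) ∂π.kernel s : ℝ) : EReal) := by
  have hk : BddMeas fun x : S × A => (klDiv (π.kernel x.1) M.μ).toReal :=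
    (hp.bddMeas_klDiv hb).comp measurable_fst
  simp_rw [hp.discounted_regCost hb]
  rw [integral_add (((bddMeas_discounted π M.bddMeas_c).comp measurable_prodMk_left).integrable _)
    ((((bddMeas_discounted π hk).comp measurable_prodMk_left).const_mul _).integrable _),
    integral_const_mul, value, hp.entropyValue_eq hb, costValue_eq, EReal.coe_add,
    ← ENNReal.ofReal_mul M.τ_pos.le, EReal.coe_ennreal_ofReal, max_eq_left]
  exact mul_nonneg M.τ_pos.le (integral_nonneg fun a => discounted_klDiv_nonneg π (s, a))

theorem realValue_eq_discounted (s : S) :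
    M.realValue π s = ∫ a, M.discounted π (M.regCost π) (s, a) ∂π.kernel s := by
  rw [realValue, hp.value_eq_coe hb, EReal.toReal_coe]

theorem bddMeas_realValue : BddMeas (M.realValue π) := by
  rw [funext (hp.realValue_eq_discounted hb)]
  exact (bddMeas_discounted π (hp.bddMeas_regCost hb)).integral_kernel_prod π.kernel

theorem bddMeas_qValue : BddMeas (M.qValue π) :=
  M.bddMeas_c.add (((hp.bddMeas_realValue hb).integral_kernel M.P).const_mul _)

theorem realValue_eq (s : S) : M.realValue π s =
    ∫ a, (M.qValue π (s, a) + M.τ * Real.log (p (s, a))) ∂π.kernel s := by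
  -- The discounted regularised cost includes the entropy of the current state, whereas Q starts
  -- charging entropy at the next one; the two differ by exactly this term.
  have hd : ∀ x, M.discounted π (M.regCost π) x =
      M.qValue π x + M.τ * (klDiv (π.kernel x.1) M.μ).toReal := by
    intro x
    rw [discounted_eq π (hp.bddMeas_regCost hb), integral_stateActionKernel M π x
      (bddMeas_discounted π (hp.bddMeas_regCost hb)), qValue_eq, regCost]
    simp_rw [hp.realValue_eq_discounted hb]
    ring
  rw [hp.realValue_eq_discounted hb]
  simp_rw [hd]
  have hq := ((hp.bddMeas_qValue hb).comp (measurable_prodMk_left (x := s))).integrable (π.kernel s)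
  rw [integral_add hq (integrable_const _), integral_add hq
    (((hb.comp (measurable_prodMk_left (x := s))).const_mul _).integrable _),
    integral_const_mul M.τ (fun a => Real.log (p (s, a))), ← hp.toReal_klDiv_eq hb]
  simp

theorem bellman_qValue (x : S × A) : M.bellman π (M.qValue π) x = M.qValue π x := by
  rw [bellman, integral_stateActionKernel M π x (hp.bddMeas_qValue hb), qValue_eq π x]
  simp_rw [hp.realValue_eq hb]
  have hq := hp.bddMeas_qValue hb
  have h : ∀ s, ∫ a, (M.qValue π (s, a) + M.τ * Real.log (p (s, a))) ∂π.kernel s =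
      ∫ a, M.qValue π (s, a) ∂π.kernel s + M.τ * (klDiv (π.kernel s) M.μ).toReal := by
    intro s
    rw [integral_add ((hq.comp (measurable_prodMk_left (x := s))).integrable _)
      (((hb.comp (measurable_prodMk_left (x := s))).const_mul _).integrable _),
      integral_const_mul, ← hp.toReal_klDiv_eq hb]
  simp_rw [h]
  rw [integral_add ((hq.integral_kernel_prod π.kernel).integrable _)
    (((hp.bddMeas_klDiv hb).const_mul _).integrable _), integral_const_mul]
  ring

theorem valueAt_eq (ρ : Measure S) [IsProbabilityMeasure ρ] :
    M.valueAt π ρ = ((∫ s, M.realValue π s ∂ρ : ℝ) : EReal) := by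
  have hk : BddMeas fun x : S × A => (klDiv (π.kernel x.1) M.μ).toReal :=
    (hp.bddMeas_klDiv hb).comp measurable_fst
  have hD := (bddMeas_discounted (M := M) π hk).integral_kernel_prod π.kernel
  have h : ∀ s, M.realValue π s = M.costValue π s + M.τ * ∫ a, M.discounted π
      (fun x => (klDiv (π.kernel x.1) M.μ).toReal) (s, a) ∂π.kernel s := by
    intro s
    rw [hp.realValue_eq_discounted hb, costValue_eq]
    simp_rw [hp.discounted_regCost hb]
    rw [integral_add
      (((bddMeas_discounted π M.bddMeas_c).comp measurable_prodMk_left).integrable _)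
      ((((bddMeas_discounted π hk).comp measurable_prodMk_left).const_mul _).integrable _),
      integral_const_mul]
  have hnn : ∀ s, 0 ≤ ∫ a, M.discounted π
      (fun x => (klDiv (π.kernel x.1) M.μ).toReal) (s, a) ∂π.kernel s :=
    fun s => integral_nonneg fun a => discounted_klDiv_nonneg π (s, a)
  simp_rw [h]
  rw [integral_add ((bddMeas_costValue π).integrable _) ((hD.const_mul _).integrable _),
    integral_const_mul, valueAt]
  simp_rw [hp.entropyValue_eq hb]
  rw [← ofReal_integral_eq_lintegral_ofReal (hD.integrable _) (ae_of_all _ hnn),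
    EReal.coe_add, ← ENNReal.ofReal_mul M.τ_pos.le, EReal.coe_ennreal_ofReal, max_eq_left]
  exact mul_nonneg M.τ_pos.le (integral_nonneg hnn)

end IsDensity

end RegMDP

end ActorCritic

/-! ### Performance difference and comparison with a policy of finite entropy -/

namespace ActorCritic

open InformationTheory

namespace RegMDP

variable {S A : Type*} [MeasurableSpace S] [MeasurableSpace A] {M : RegMDP S A}
  {π π' : Policy S A} {p : S × A → ℝ}

/-- The state occupancy measure of a policy. -/
noncomputable def stateOcc (M : RegMDP S A) (π : Policy S A) (ρ : Measure S) : Measure S :=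
  occupancy M.γ (M.stateKernel π) ρ

instance (ρ : Measure S) [IsProbabilityMeasure ρ] : IsProbabilityMeasure (M.stateOcc π ρ) :=
  isProbabilityMeasure_occupancy (M.stateKernel π) M.γ_pos M.γ_lt_one ρ

/-- The total entropy `∫ KL(π(·|s)|μ) d_ρ^π(ds)`. -/
noncomputable def totalEntropy (M : RegMDP S A) (π : Policy S A) (ρ : Measure S) : ℝ≥0∞ :=
  ∫⁻ s, klDiv (π.kernel s) M.μ ∂M.stateOcc π ρ

variable {ρ : Measure S} [IsProbabilityMeasure ρ]
  [MeasurableSpace.CountableOrCountablyGenerated S A]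

theorem totalEntropy_ne_top (h : M.valueAt π ρ ≠ ⊤) : M.totalEntropy π ρ ≠ ⊤ := by
  rw [totalEntropy, stateOcc, ← lintegral_entropyValue]
  refine ENNReal.mul_ne_top ENNReal.ofReal_ne_top fun h2 => h ?_
  rw [valueAt, h2, ENNReal.mul_top (by simpa using M.τ_pos)]
  simp

/-- A density-free formula for the value: finite total entropy is enough, so it covers the optimal
policy. -/
theorem valueAt_eq_of_ne_top (h : M.totalEntropy π ρ ≠ ⊤) :
    M.valueAt π ρ = (((1 - M.γ)⁻¹ * (∫ x, M.c x ∂(M.stateOcc π ρ ⊗ₘ π.kernel) +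
      M.τ * (M.totalEntropy π ρ).toReal) : ℝ) : EReal) := by
  have h1 : 0 < 1 - M.γ := by have := M.γ_lt_one; linarith
  have h2 : ∫⁻ s, M.entropyValue π s ∂ρ =
      ENNReal.ofReal ((1 - M.γ)⁻¹ * (M.totalEntropy π ρ).toReal) := by
    rw [ENNReal.ofReal_mul (by positivity), ENNReal.ofReal_toReal h, totalEntropy, stateOcc,
      ← lintegral_entropyValue, ← mul_assoc, ← ENNReal.ofReal_mul (by positivity),
      inv_mul_cancel₀ h1.ne', ENNReal.ofReal_one, one_mul]
  rw [valueAt, h2, integral_costValue, ← ENNReal.ofReal_mul M.τ_pos.le, EReal.coe_ennreal_ofReal,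
    max_eq_left (mul_nonneg M.τ_pos.le (mul_nonneg (by positivity) ENNReal.toReal_nonneg)),
    ← EReal.coe_add]
  congr 1
  rw [stateOcc]
  ring

/-- Performance difference lemma. -/
theorem performance_difference (hp : M.IsDensity π p) (hb : BddMeas fun x => Real.log (p x))
    (K : ℝ) :
    (1 - M.γ) * ((1 - M.γ)⁻¹ * (∫ x, M.c x ∂(M.stateOcc π' ρ ⊗ₘ π'.kernel) + M.τ * K) -
        ∫ s, M.realValue π s ∂ρ) =
      ∫ x, (M.qValue π x + M.τ * Real.log (p x)) ∂(M.stateOcc π' ρ ⊗ₘ π'.kernel) -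
        ∫ s, ∫ a, (M.qValue π (s, a) + M.τ * Real.log (p (s, a))) ∂π.kernel s ∂M.stateOcc π' ρ +
        M.τ * (K - ∫ x, Real.log (p x) ∂(M.stateOcc π' ρ ⊗ₘ π'.kernel)) := by
  have h1 : 1 - M.γ ≠ 0 := by have := M.γ_lt_one; linarith
  -- The fixed-point equation of the occupancy measure of π', tested on the value of π, replaces the
  -- usual telescoping sum. The entropy term `K` cancels on both sides, so it may be arbitrary.
  have h2 := M.integral_occupancy_stateKernel π' (ν := ρ) (hp.bddMeas_realValue hb)
  have h3 : ∫ x, M.qValue π x ∂(M.stateOcc π' ρ ⊗ₘ π'.kernel) =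
      ∫ x, M.c x ∂(M.stateOcc π' ρ ⊗ₘ π'.kernel) +
        M.γ * ∫ x, ∫ s', M.realValue π s' ∂M.P x ∂(M.stateOcc π' ρ ⊗ₘ π'.kernel) := by
    simp_rw [qValue_eq]
    rw [integral_add (M.bddMeas_c.integrable _)
      ((((hp.bddMeas_realValue hb).integral_kernel M.P).const_mul _).integrable _),
      integral_const_mul]
  rw [integral_add ((hp.bddMeas_qValue hb).integrable _) ((hb.const_mul _).integrable _),
    integral_const_mul, h3]
  simp_rw [← hp.realValue_eq hb]
  rw [← stateOcc] at h2
  rw [h2]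
  field_simp
  ring

section Transport

variable {d : Measure S}

theorem ae_klDiv_ne_top (h : ∫⁻ s, klDiv (π'.kernel s) M.μ ∂d ≠ ⊤) :
    ∀ᵐ s ∂d, klDiv (π'.kernel s) M.μ ≠ ⊤ :=
  (ae_lt_top (measurable_klDiv π') h).mono fun _ => ne_of_lt

theorem integral_toReal_klDiv (h : ∫⁻ s, klDiv (π'.kernel s) M.μ ∂d ≠ ⊤) :
    ∫ s, (klDiv (π'.kernel s) M.μ).toReal ∂d = (∫⁻ s, klDiv (π'.kernel s) M.μ ∂d).toReal :=
  integral_toReal (measurable_klDiv π').aemeasurable (ae_lt_top (measurable_klDiv π') h)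

variable [IsProbabilityMeasure d]

/-- The linearised Pinsker inequality integrated over states. The policy π' need not have bounded
log-density: its entropy is finite for almost every state, which is all the pointwise inequality
asks. -/
theorem integral_sub_integral_policy_le (hp : M.IsDensity π p)
    (hb : BddMeas fun x => Real.log (p x)) (h : ∫⁻ s, klDiv (π'.kernel s) M.μ ∂d ≠ ⊤)
    {g : S × A → ℝ} (hg : BddMeas g) {e : ℝ} (he : ∀ x, |g x| ≤ e) :
    ∫ x, g x ∂(d ⊗ₘ π'.kernel) - ∫ s, ∫ a, g (s, a) ∂π.kernel s ∂d ≤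
      M.τ / 2 * ((∫⁻ s, klDiv (π'.kernel s) M.μ ∂d).toReal -
        ∫ x, Real.log (p x) ∂(d ⊗ₘ π'.kernel)) + e ^ 2 / M.τ := by
  have hK := integrable_toReal_of_lintegral_ne_top (measurable_klDiv π').aemeasurable h
  have hl := (hb.integral_kernel_prod π'.kernel).integrable d
  have hKl : Integrable (fun s => (klDiv (π'.kernel s) M.μ).toReal -
      ∫ a, Real.log (p (s, a)) ∂π'.kernel s) d := hK.sub hl
  rw [Measure.integral_compProd (hg.integrable _), Measure.integral_compProd (hb.integrable _),
    ← integral_toReal_klDiv h,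
    ← integral_sub ((hg.integral_kernel_prod π'.kernel).integrable d)
      ((hg.integral_kernel_prod π.kernel).integrable d),
    ← integral_sub hK hl, ← integral_const_mul]
  have h2 : e ^ 2 / M.τ = ∫ _, e ^ 2 / M.τ ∂d := by simp
  rw [h2, ← integral_add (hKl.const_mul _) (integrable_const _)]
  refine integral_mono_ae (((hg.integral_kernel_prod π'.kernel).integrable d).sub
      ((hg.integral_kernel_prod π.kernel).integrable d))
    ((hKl.const_mul _).add (integrable_const _)) ?_
  filter_upwards [ae_klDiv_ne_top h] with s hs
  have := integral_sub_integral_tilted_le hs (hb.comp (measurable_prodMk_left (x := s)))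
    (hp.integral_exp_log s) (hg.comp (measurable_prodMk_left (x := s))) (fun a => he (s, a)) M.τ_pos
  rw [← hp.kernel_eq_tilted] at this
  exact this

theorem toReal_sub_integral_log_nonneg (hp : M.IsDensity π p)
    (hb : BddMeas fun x => Real.log (p x)) (h : ∫⁻ s, klDiv (π'.kernel s) M.μ ∂d ≠ ⊤) :
    0 ≤ (∫⁻ s, klDiv (π'.kernel s) M.μ ∂d).toReal - ∫ x, Real.log (p x) ∂(d ⊗ₘ π'.kernel) := by
  -- The Pinsker bound with g = 0 and e = 0 is exactly nonnegativity of the averaged relative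
  -- entropy.
  have h1 := integral_sub_integral_policy_le hp hb h (BddMeas.const 0) (e := 0) (by simp)
  simp only [integral_zero, sub_self, ne_eq, OfNat.ofNat_ne_zero, not_false_eq_true, zero_pow,
    zero_div, add_zero] at h1
  exact nonneg_of_mul_nonneg_right h1 (half_pos M.τ_pos)

theorem lintegral_klDiv_policy (hp : M.IsDensity π p)
    (hb : BddMeas fun x => Real.log (p x)) (h : ∫⁻ s, klDiv (π'.kernel s) M.μ ∂d ≠ ⊤) :
    ∫⁻ s, klDiv (π'.kernel s) (π.kernel s) ∂d =
      ENNReal.ofReal ((∫⁻ s, klDiv (π'.kernel s) M.μ ∂d).toReal -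
        ∫ x, Real.log (p x) ∂(d ⊗ₘ π'.kernel)) := by
  have hK := integrable_toReal_of_lintegral_ne_top (measurable_klDiv π').aemeasurable h
  have hl := (hb.integral_kernel_prod π'.kernel).integrable d
  have hKl : Integrable (fun s => (klDiv (π'.kernel s) M.μ).toReal -
      ∫ a, Real.log (p (s, a)) ∂π'.kernel s) d := hK.sub hl
  rw [Measure.integral_compProd (hb.integrable _), ← integral_toReal_klDiv h,
    ← integral_sub hK hl, ofReal_integral_eq_lintegral_ofReal hKl]
  · refine lintegral_congr_ae ?_
    filter_upwards [ae_klDiv_ne_top h] with s hs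
    rw [hp.kernel_eq_tilted, klDiv_tilted_right hs (hb.comp (measurable_prodMk_left (x := s))),
      hp.integral_exp_log, Real.log_one, add_zero]
  · filter_upwards [ae_klDiv_ne_top h] with s hs
    have := integral_le_toReal_klDiv_add_log hs (hb.comp (measurable_prodMk_left (x := s)))
    rw [hp.integral_exp_log, Real.log_one, add_zero] at this
    exact sub_nonneg.2 this

end Transport

end RegMDP

end ActorCritic

/-! ### Bounds and Lipschitz dependence of values on the policy -/

namespace ActorCritic

open InformationTheory

namespace RegMDP

section Critic

variable {S A : Type*} {N : ℕ} {φ : S × A → EuclideanSpace ℝ (Fin N)}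

theorem abs_critic_le (hφ : ∀ x, ‖φ x‖ ≤ 1) (v : EuclideanSpace ℝ (Fin N)) (x : S × A) :
    |critic φ v x| ≤ ‖v‖ :=
  (abs_real_inner_le_norm _ _).trans (mul_le_of_le_one_right (norm_nonneg _) (hφ x))

theorem critic_sub (v w : EuclideanSpace ℝ (Fin N)) (x : S × A) :
    critic φ (v - w) x = critic φ v x - critic φ w x := inner_sub_left _ _ _

end Critic

variable {S A : Type*} [MeasurableSpace S] [MeasurableSpace A] {M : RegMDP S A}
  {π π' : Policy S A} {p p' : S × A → ℝ}

theorem abs_discounted_le {k : S × A → ℝ} {C : ℝ} (hC : ∀ x, |k x| ≤ C) (x : S × A) :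
    |M.discounted π k x| ≤ (1 - M.γ)⁻¹ * C := by
  have h1 : 0 < 1 - M.γ := by have := M.γ_lt_one; linarith
  have := isMarkovKernel_occKernel (M.stateActionKernel π) M.γ_pos M.γ_lt_one
  rw [discounted, abs_mul, abs_of_pos (inv_pos.2 h1)]
  exact mul_le_mul_of_nonneg_left (abs_integral_le_of_abs_le hC _) (inv_pos.2 h1).le

/-- A common bound on the value functions of policies with log-density bounded by `L`, when the
cost is bounded by `C`. -/
noncomputable def valueBound (M : RegMDP S A) (C L : ℝ) : ℝ := (1 - M.γ)⁻¹ * (C + M.τ * L)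

theorem abs_toReal_klDiv_le (hp : M.IsDensity π p) (hm : BddMeas fun x => Real.log (p x))
    {L : ℝ} {s : S} (hL : ∀ a, Real.log (p (s, a)) ≤ L) :
    |(klDiv (π.kernel s) M.μ).toReal| ≤ L := by
  rw [abs_of_nonneg ENNReal.toReal_nonneg, hp.toReal_klDiv_eq hm]
  have h : ∫ a, Real.log (p (s, a)) ∂π.kernel s ≤ ∫ _, L ∂π.kernel s :=
    integral_mono ((hm.comp measurable_prodMk_left).integrable _) (integrable_const _) hL
  simpa using h

section

variable [MeasurableSpace.CountableOrCountablyGenerated S A] {C L : ℝ}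

theorem abs_realValue_le (hp : M.IsDensity π p) (hC : ∀ x, |M.c x| ≤ C)
    (hL : ∀ x, |Real.log (p x)| ≤ L) (s : S) : |M.realValue π s| ≤ M.valueBound C L := by
  have hm : BddMeas fun x => Real.log (p x) := ⟨hp.measurable.log, L, hL⟩
  rw [hp.realValue_eq_discounted hm]
  refine abs_integral_le_of_abs_le (fun a => abs_discounted_le (fun x => ?_) _) _
  refine (abs_add_le _ _).trans (add_le_add (hC x) ?_)
  rw [abs_mul, abs_of_pos M.τ_pos]
  exact mul_le_mul_of_nonneg_left
    (abs_toReal_klDiv_le hp hm fun a => (le_abs_self _).trans (hL _)) M.τ_pos.le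

theorem abs_qValue_le (hp : M.IsDensity π p) (hC : ∀ x, |M.c x| ≤ C)
    (hL : ∀ x, |Real.log (p x)| ≤ L) (x : S × A) : |M.qValue π x| ≤ M.valueBound C L := by
  have h1 : 0 < 1 - M.γ := by have := M.γ_lt_one; linarith
  have hL0 : 0 ≤ L := (abs_nonneg _).trans (hL x)
  have h2 : |M.γ * ∫ s', M.realValue π s' ∂M.P x| ≤ M.γ * M.valueBound C L := by
    rw [abs_mul, abs_of_pos M.γ_pos]
    exact mul_le_mul_of_nonneg_left
      (abs_integral_le_of_abs_le (abs_realValue_le hp hC hL) _) M.γ_pos.le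
  have h3 : M.valueBound C L = (C + M.τ * L) + M.γ * M.valueBound C L := by
    rw [valueBound]; field_simp; ring
  rw [qValue_eq]
  have h4 := mul_nonneg M.τ_pos.le hL0
  refine (abs_add_le _ _).trans ?_
  have := hC x
  linarith

/-- A contraction argument: any bound D on the difference of values improves to γD plus a multiple
of δ through the Bellman equation, so the supremum satisfies the resulting fixed-point bound. -/
theorem abs_realValue_sub_le (hp : M.IsDensity π p) (hp' : M.IsDensity π' p')
    (hC : ∀ x, |M.c x| ≤ C) (hL : ∀ x, |Real.log (p x)| ≤ L) (hL' : ∀ x, |Real.log (p' x)| ≤ L)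
    {δ : ℝ} (hδ : ∀ x, |p x - p' x| ≤ δ) (hδ' : ∀ x, |Real.log (p x) - Real.log (p' x)| ≤ δ)
    (s : S) : |M.realValue π s - M.realValue π' s| ≤
      (1 - M.γ)⁻¹ * (M.τ + M.valueBound C L + M.τ * L) * δ := by
  have h1 : 0 < 1 - M.γ := by have := M.γ_lt_one; linarith
  have hm : BddMeas fun x => Real.log (p x) := ⟨hp.measurable.log, L, hL⟩
  have hm' : BddMeas fun x => Real.log (p' x) := ⟨hp'.measurable.log, L, hL'⟩
  have hbp : ∀ (p : S × A → ℝ) (π : Policy S A), M.IsDensity π p →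
      (∀ x, |Real.log (p x)| ≤ L) → BddMeas p := by
    intro p π hp hL
    refine ⟨hp.measurable, Real.exp L, fun x => ?_⟩
    rw [abs_of_pos (hp.pos x), ← Real.exp_log (hp.pos x)]
    exact Real.exp_le_exp.2 ((le_abs_self _).trans (hL x))
  have hv := hp.bddMeas_realValue hm
  have hv' := hp'.bddMeas_realValue hm'
  have hq := hp.bddMeas_qValue hm
  have hq' := hp'.bddMeas_qValue hm'
  have step : ∀ D : ℝ, (∀ s, |M.realValue π s - M.realValue π' s| ≤ D) → ∀ s,
      |M.realValue π s - M.realValue π' s| ≤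
        M.γ * D + (M.τ + M.valueBound C L + M.τ * L) * δ := by
    intro D hD s
    have hqD : ∀ x, |M.qValue π x - M.qValue π' x| ≤ M.γ * D := by
      intro x
      rw [qValue_eq, qValue_eq, add_sub_add_left_eq_sub, ← mul_sub,
        ← integral_sub (hv.integrable _) (hv'.integrable _), abs_mul, abs_of_pos M.γ_pos]
      exact mul_le_mul_of_nonneg_left (abs_integral_le_of_abs_le hD _) M.γ_pos.le
    set k : A → ℝ := fun a => M.qValue π (s, a) + M.τ * Real.log (p (s, a))
    set k' : A → ℝ := fun a => M.qValue π' (s, a) + M.τ * Real.log (p' (s, a))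
    have hk : BddMeas k := (hq.add (hm.const_mul _)).comp measurable_prodMk_left
    have hk' : BddMeas k' := (hq'.add (hm'.const_mul _)).comp measurable_prodMk_left
    have hps : BddMeas fun a => p (s, a) := (hbp p π hp hL).comp measurable_prodMk_left
    have hps' : BddMeas fun a => p' (s, a) := (hbp p' π' hp' hL').comp measurable_prodMk_left
    -- Separates the change of the integrand from the change of the policy integrating it.
    have e1 : M.realValue π s - M.realValue π' s =
        ∫ a, (k a - k' a) ∂π.kernel s + ∫ a, (p (s, a) - p' (s, a)) * k' a ∂M.μ := by
      rw [hp.realValue_eq hm, hp'.realValue_eq hm', integral_sub (hk.integrable _)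
        (hk'.integrable _)]
      simp_rw [sub_mul]
      rw [integral_sub ((hps.mul hk').integrable _) ((hps'.mul hk').integrable _),
        ← hp.integral_kernel, ← hp'.integral_kernel]
      ring
    have b1 : |∫ a, (k a - k' a) ∂π.kernel s| ≤ M.γ * D + M.τ * δ := by
      refine abs_integral_le_of_abs_le (fun a => ?_) _
      have : k a - k' a = (M.qValue π (s, a) - M.qValue π' (s, a)) +
          M.τ * (Real.log (p (s, a)) - Real.log (p' (s, a))) := by simp only [k, k']; ring
      rw [this]
      refine (abs_add_le _ _).trans (add_le_add (hqD _) ?_)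
      rw [abs_mul, abs_of_pos M.τ_pos]
      exact mul_le_mul_of_nonneg_left (hδ' _) M.τ_pos.le
    have b2 : |∫ a, (p (s, a) - p' (s, a)) * k' a ∂M.μ| ≤
        δ * (M.valueBound C L + M.τ * L) := by
      refine abs_integral_le_of_abs_le (fun a => ?_) _
      rw [abs_mul]
      refine mul_le_mul (hδ _) ((abs_add_le _ _).trans
        (add_le_add (abs_qValue_le hp' hC hL' _) ?_)) (abs_nonneg _) ((abs_nonneg _).trans (hδ (s, a)))
      rw [abs_mul, abs_of_pos M.τ_pos]
      exact mul_le_mul_of_nonneg_left (hL' _) M.τ_pos.le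
    rw [e1]
    refine (abs_add_le _ _).trans ((add_le_add b1 b2).trans (le_of_eq ?_))
    ring
  -- Finiteness of the supremum is what allows the term γD to be absorbed on the left.
  obtain ⟨B, hB⟩ := (hv.sub hv').bdd
  have : Nonempty S := ⟨s⟩
  have hbdd : BddAbove (range fun s => |M.realValue π s - M.realValue π' s|) :=
    ⟨B, by rintro _ ⟨s, rfl⟩; exact hB s⟩
  have h2 := ciSup_le (step _ fun s => le_ciSup hbdd s)
  refine (le_ciSup hbdd s).trans ?_
  rw [mul_assoc, inv_mul_eq_div, le_div_iff₀ h1]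
  linarith

theorem abs_qValue_sub_le {D : ℝ} (hp : M.IsDensity π p) (hp' : M.IsDensity π' p')
    (hm : BddMeas fun x => Real.log (p x)) (hm' : BddMeas fun x => Real.log (p' x))
    (hD : ∀ s, |M.realValue π s - M.realValue π' s| ≤ D) (x : S × A) :
    |M.qValue π x - M.qValue π' x| ≤ D := by
  rw [qValue_eq, qValue_eq, add_sub_add_left_eq_sub, ← mul_sub,
    ← integral_sub ((hp.bddMeas_realValue hm).integrable _)
      ((hp'.bddMeas_realValue hm').integrable _), abs_mul, abs_of_pos M.γ_pos]
  have h := abs_integral_le_of_abs_le hD (M.P x)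
  exact (mul_le_of_le_one_left (abs_nonneg _) M.γ_lt_one.le).trans h

end

/-! ### The linear critic and coercivity of temporal differences -/

section Critic

variable {N : ℕ} {φ : S × A → EuclideanSpace ℝ (Fin N)}

theorem bddMeas_critic (hm : Measurable φ) (hφ : ∀ x, ‖φ x‖ ≤ 1)
    (v : EuclideanSpace ℝ (Fin N)) : BddMeas (critic φ v) :=
  ⟨measurable_const.inner hm, ‖v‖, abs_critic_le hφ v⟩

/-- Subtracting the smallest eigenvalue times the identity leaves a positive semidefinite matrix,
since the spectrum is merely shifted; the quadratic form of the feature covariance is the second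
moment of the critic. -/
theorem lambdaMin_mul_sq_le (hm : Measurable φ) (hφ : ∀ x, ‖φ x‖ ≤ 1)
    (β : Measure (S × A)) [IsProbabilityMeasure β] (v : EuclideanSpace ℝ (Fin N)) :
    lambdaMin (featureCov φ β) * ‖v‖ ^ 2 ≤ ∫ x, critic φ v x ^ 2 ∂β := by
  set B := featureCov φ β with hBdef
  set l := lambdaMin B with hl
  have hcoord : ∀ i, BddMeas fun x => φ x i := fun i =>
    ⟨(measurable_pi_apply i).comp ((PiLp.continuous_ofLp 2 _).measurable.comp hm), 1,
      fun x => (PiLp.norm_apply_le (φ x) i).trans (hφ x)⟩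
  have hherm : B.IsHermitian := by
    ext i j
    simp [hBdef, featureCov, mul_comm]
  have hpsd : (B - algebraMap ℝ (Matrix (Fin N) (Fin N) ℝ) l).PosSemidef := by
    rw [Matrix.posSemidef_iff_isHermitian_and_spectrum_nonneg]
    refine ⟨?_, ?_⟩
    · refine hherm.sub ?_
      ext i j
      simp [Matrix.algebraMap_matrix_apply, eq_comm]
    · rw [← spectrum.sub_singleton_eq]
      rintro _ ⟨a, ha, _, rfl, rfl⟩
      exact sub_nonneg.2 (csInf_le Matrix.finite_real_spectrum.bddBelow ha)
  have h := hpsd.dotProduct_mulVec_nonneg v.ofLp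
  rw [Matrix.sub_mulVec, dotProduct_sub] at h
  have e1 : star v.ofLp ⬝ᵥ (algebraMap ℝ (Matrix (Fin N) (Fin N) ℝ) l).mulVec v.ofLp =
      l * ‖v‖ ^ 2 := by
    rw [Algebra.algebraMap_eq_smul_one, Matrix.smul_mulVec, Matrix.one_mulVec, dotProduct_smul,
      EuclideanSpace.norm_sq_eq]
    simp [dotProduct, sq]
  have e2 : star v.ofLp ⬝ᵥ B.mulVec v.ofLp = ∫ x, critic φ v x ^ 2 ∂β := by
    have hc : ∀ x, critic φ v x ^ 2 = ∑ i, ∑ j, v i * v j * (φ x i * φ x j) := by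
      intro x
      rw [critic, PiLp.inner_apply, sq, Finset.sum_mul_sum]
      refine Finset.sum_congr rfl fun i _ => Finset.sum_congr rfl fun j _ => ?_
      simp
      ring
    simp_rw [hc]
    rw [integral_finsetSum _ fun i _ => integrable_finsetSum _ fun j _ =>
      (((hcoord i).mul (hcoord j)).const_mul _).integrable _]
    simp only [dotProduct, Matrix.mulVec, Finset.mul_sum]
    refine Finset.sum_congr rfl fun i _ => ?_
    rw [integral_finsetSum _ fun j _ => (((hcoord i).mul (hcoord j)).const_mul _).integrable _]
    refine Finset.sum_congr rfl fun j _ => ?_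
    rw [integral_const_mul]
    simp [hBdef, featureCov]
    ring
  rw [e1, e2] at h
  linarith

theorem sq_integral_le {X : Type*} [MeasurableSpace X] (ν : Measure X) [IsProbabilityMeasure ν]
    {f : X → ℝ} (hf : BddMeas f) : (∫ x, f x ∂ν) ^ 2 ≤ ∫ x, f x ^ 2 ∂ν := by
  set m := ∫ x, f x ∂ν
  have h : 0 ≤ ∫ x, (f x - m) ^ 2 ∂ν := integral_nonneg fun x => sq_nonneg _
  have e : ∀ x, (f x - m) ^ 2 = f x * f x - 2 * m * f x + m ^ 2 := fun x => by ring
  simp_rw [e] at h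
  rw [integral_add (((hf.mul hf).sub (hf.const_mul _)).integrable _) (integrable_const _),
    integral_sub ((hf.mul hf).integrable _) ((hf.const_mul _).integrable _),
    integral_const_mul] at h
  simp only [integral_const, probReal_univ, smul_eq_mul, one_mul] at h
  simp_rw [sq]
  change 0 ≤ _ - 2 * m * m + m ^ 2 at h
  linarith

variable {β : Measure (S × A)} [IsProbabilityMeasure β]

/-- Coercivity of the temporal-difference operator on the span of the features. -/
theorem gam_mul_sq_le (hm : Measurable φ) (hφ : ∀ x, ‖φ x‖ ≤ 1)
    (π : Policy S A) (v : EuclideanSpace ℝ (Fin N)) :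
    M.Gam φ β * ‖v‖ ^ 2 ≤
      ∫ x, (critic φ v x - M.γ * ∫ y, critic φ v y ∂M.stateActionKernel π x) * critic φ v x
        ∂occupancy M.γ (M.stateActionKernel π) β := by
  set κ := M.stateActionKernel π
  have hd := isProbabilityMeasure_occupancy κ M.γ_pos M.γ_lt_one β
  set d := occupancy M.γ κ β
  set f := critic φ v
  have hγ1 := M.γ_lt_one
  have hγ0 := M.γ_pos
  have hf : BddMeas f := bddMeas_critic hm hφ v
  have hf2 : BddMeas fun x => f x ^ 2 := by simpa only [sq] using hf.mul hf
  have hk : BddMeas fun x => ∫ y, f y ∂κ x := hf.integral_kernel κ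
  have hk2 : BddMeas fun x => ∫ y, f y ^ 2 ∂κ x := hf2.integral_kernel κ
  have hs1 : √M.γ ^ 2 = M.γ := Real.sq_sqrt hγ0.le
  have hs0 : 0 < √M.γ := Real.sqrt_pos.2 hγ0
  have hslt : √M.γ < 1 := by
    rw [Real.sqrt_lt' one_pos]; simpa using hγ1
  have hocc := integral_occupancy_eq_add κ hγ0 hγ1 β hf2
  have hl := lambdaMin_mul_sq_le hm hφ β v
  have hk2n : 0 ≤ ∫ x, ∫ y, f y ^ 2 ∂κ x ∂d :=
    integral_nonneg fun x => integral_nonneg fun y => sq_nonneg _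
  -- Young's inequality weighted by √γ for the cross term, followed by Jensen's inequality for the
  -- kernel.
  have key : ∀ x, (1 - √M.γ / 2) * f x ^ 2 - √M.γ / 2 * M.γ * ∫ y, f y ^ 2 ∂κ x ≤
      (f x - M.γ * ∫ y, f y ∂κ x) * f x := by
    intro x
    have h1 := sq_integral_le (κ x) hf
    set b := ∫ y, f y ∂κ x
    have h2 := mul_le_mul_of_nonneg_left h1 (by positivity : 0 ≤ √M.γ / 2 * M.γ)
    have h3 : 0 ≤ √M.γ / 2 * (f x - √M.γ * b) ^ 2 := by positivity
    have h4 : √M.γ / 2 * (f x - √M.γ * b) ^ 2 =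
        √M.γ / 2 * f x ^ 2 - M.γ * b * f x + √M.γ / 2 * M.γ * b ^ 2 := by
      linear_combination (√M.γ / 2 * b ^ 2 - b * f x) * hs1
    linarith
  have h5 := integral_mono (μ := d)
    (((hf2.const_mul _).sub (hk2.const_mul _)).integrable _)
    (((hf.sub (hk.const_mul _)).mul hf).integrable _) key
  rw [integral_sub ((hf2.const_mul _).integrable _) ((hk2.const_mul _).integrable _),
    integral_const_mul, integral_const_mul] at h5
  refine le_trans ?_ h5
  have h6 : 0 ≤ ∫ x, f x ^ 2 ∂β := integral_nonneg fun x => sq_nonneg _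
  -- Dropping one or the other term of the occupancy equation: here the initial law, so that the two
  -- halves of √γ add up to 1 - √γ; in `h8` the transition, which produces the factor 1 - γ and
  -- brings in β.
  have h7 : M.γ * ∫ x, ∫ y, f y ^ 2 ∂κ x ∂d ≤ ∫ x, f x ^ 2 ∂d := by
    rw [hocc]
    have : 0 ≤ (1 - M.γ) * ∫ x, f x ^ 2 ∂β := mul_nonneg (by linarith) h6
    linarith
  have h8 : (1 - M.γ) * ∫ x, f x ^ 2 ∂β ≤ ∫ x, f x ^ 2 ∂d := by
    rw [hocc]
    have : 0 ≤ M.γ * ∫ x, ∫ y, f y ^ 2 ∂κ x ∂d := by positivity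
    linarith
  have h9 : (1 - √M.γ) * ∫ x, f x ^ 2 ∂d ≤ (1 - √M.γ / 2) * ∫ x, f x ^ 2 ∂d -
      √M.γ / 2 * M.γ * ∫ x, ∫ y, f y ^ 2 ∂κ x ∂d := by
    have := mul_le_mul_of_nonneg_left h7 (by positivity : 0 ≤ √M.γ / 2)
    linarith
  refine le_trans ?_ h9
  calc M.Gam φ β * ‖v‖ ^ 2
      = (1 - √M.γ) * ((1 - M.γ) * (lambdaMin (featureCov φ β) * ‖v‖ ^ 2)) := by
        rw [Gam]; ring
    _ ≤ (1 - √M.γ) * ((1 - M.γ) * ∫ x, f x ^ 2 ∂β) :=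
        mul_le_mul_of_nonneg_left (mul_le_mul_of_nonneg_left hl (by linarith)) (by linarith)
    _ ≤ _ := mul_le_mul_of_nonneg_left h8 (by linarith)

variable {π : Policy S A}

theorem bddMeas_bellman (hK : BddMeas fun s => (klDiv (π.kernel s) M.μ).toReal)
    {f : S × A → ℝ} (hf : BddMeas f) : BddMeas (M.bellman π f) :=
  (M.bddMeas_c.add ((hf.integral_kernel _).const_mul _)).add ((hK.integral_kernel M.P).const_mul _)

theorem inner_semiGradient (hm : Measurable φ) (hφ : ∀ x, ‖φ x‖ ≤ 1)
    (hK : BddMeas fun s => (klDiv (π.kernel s) M.μ).toReal) (v θ : EuclideanSpace ℝ (Fin N)) :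
    inner ℝ v (M.semiGradient φ β θ π) =
      ∫ x, (critic φ θ x - M.bellman π (critic φ θ) x) * critic φ v x
        ∂occupancy M.γ (M.stateActionKernel π) β := by
  have hd := isProbabilityMeasure_occupancy (M.stateActionKernel π) M.γ_pos M.γ_lt_one β
  have hb := (bddMeas_critic hm hφ θ).sub (bddMeas_bellman hK (bddMeas_critic hm hφ θ))
  have hint : Integrable (fun x => (critic φ θ x - M.bellman π (critic φ θ) x) • φ x)
      (occupancy M.γ (M.stateActionKernel π) β) := by
    obtain ⟨C, hC⟩ := hb.bdd
    refine Integrable.of_bound (hb.measurable.smul hm).aestronglyMeasurable C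
      (ae_of_all _ fun x => ?_)
    rw [norm_smul]
    exact (mul_le_of_le_one_right (norm_nonneg _) (hφ x)).trans (hC x)
  rw [semiGradient, ← integral_inner hint]
  refine integral_congr_ae (ae_of_all _ fun x => ?_)
  simp only [critic, inner_smul_right]

/-- Q^π is a fixed point of the Bellman operator, so subtracting its equation removes the cost and
entropy terms and leaves the linear operator of `gam_mul_sq_le` acting on the error. -/
theorem inner_semiGradient_sub_ge [MeasurableSpace.CountableOrCountablyGenerated S A]
    (hm : Measurable φ) (hφ : ∀ x, ‖φ x‖ ≤ 1)
    (hp : M.IsDensity π p) (hb : BddMeas fun x => Real.log (p x))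
    (θ θπ : EuclideanSpace ℝ (Fin N)) (hθ : ∀ x, M.qValue π x = critic φ θπ x) :
    M.Gam φ β * ‖θ - θπ‖ ^ 2 ≤ inner ℝ (θ - θπ) (M.semiGradient φ β θ π) := by
  refine (gam_mul_sq_le hm hφ π (θ - θπ)).trans (le_of_eq ?_)
  rw [inner_semiGradient hm hφ (hp.bddMeas_klDiv hb)]
  refine integral_congr_ae (ae_of_all _ fun x => ?_)
  simp only
  congr 1
  have h := hp.bellman_qValue hb x
  rw [funext hθ] at h
  simp_rw [critic_sub]
  rw [integral_sub ((bddMeas_critic hm hφ θ).integrable _)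
    ((bddMeas_critic hm hφ θπ).integrable _)]
  conv_lhs => rw [← h]
  simp only [bellman]
  ring

/-- Coercivity around zero rather than around the true parameter: cost and entropy are treated as
bounded forcing. It serves the a priori bound on θ, where only the entropy bound `K` is at hand. -/
theorem inner_semiGradient_ge (hm : Measurable φ) (hφ : ∀ x, ‖φ x‖ ≤ 1) {C K : ℝ}
    (hC : ∀ x, |M.c x| ≤ C) (hKm : BddMeas fun s => (klDiv (π.kernel s) M.μ).toReal)
    (hK : ∀ s, |(klDiv (π.kernel s) M.μ).toReal| ≤ K) (θ : EuclideanSpace ℝ (Fin N)) :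
    M.Gam φ β * ‖θ‖ ^ 2 - (C + M.τ * M.γ * K) * ‖θ‖ ≤
      inner ℝ θ (M.semiGradient φ β θ π) := by
  have hd := isProbabilityMeasure_occupancy (M.stateActionKernel π) M.γ_pos M.γ_lt_one β
  have h1 := gam_mul_sq_le (M := M) (β := β) hm hφ π θ
  have hc := bddMeas_critic hm hφ θ
  have h2 : |∫ x, (M.c x + M.τ * M.γ * ∫ s', (klDiv (π.kernel s') M.μ).toReal ∂M.P x) *
      critic φ θ x ∂occupancy M.γ (M.stateActionKernel π) β| ≤ (C + M.τ * M.γ * K) * ‖θ‖ := by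
    refine abs_integral_le_of_abs_le (fun x => ?_) _
    have h0 : 0 ≤ M.τ * M.γ := mul_nonneg M.τ_pos.le M.γ_pos.le
    rw [abs_mul]
    have h3 : |M.c x + M.τ * M.γ * ∫ s', (klDiv (π.kernel s') M.μ).toReal ∂M.P x| ≤
        C + M.τ * M.γ * K := by
      refine (abs_add_le _ _).trans (add_le_add (hC x) ?_)
      rw [abs_mul, abs_of_nonneg h0]
      exact mul_le_mul_of_nonneg_left (abs_integral_le_of_abs_le hK _) h0
    exact mul_le_mul h3 (abs_critic_le hφ θ x) (abs_nonneg _) ((abs_nonneg _).trans h3)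
  rw [inner_semiGradient hm hφ hKm]
  have e : ∀ x, (critic φ θ x - M.bellman π (critic φ θ) x) * critic φ θ x =
      (critic φ θ x - M.γ * ∫ y, critic φ θ y ∂M.stateActionKernel π x) * critic φ θ x -
      (M.c x + M.τ * M.γ * ∫ s', (klDiv (π.kernel s') M.μ).toReal ∂M.P x) * critic φ θ x := by
    intro x
    simp only [bellman]
    ring
  simp_rw [e]
  rw [integral_sub (((hc.sub ((hc.integral_kernel _).const_mul _)).mul hc).integrable _)
    (((M.bddMeas_c.add ((hKm.integral_kernel M.P).const_mul _)).mul hc).integrable _)]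
  have := (abs_le.1 h2).2
  linarith

end Critic

end RegMDP

end ActorCritic

/-! ### Real analysis: monotone weights, tracking errors and a convolution bound -/

namespace ActorCritic

section RealAnalysis

/-- A superlevel set of an antitone function is an initial interval up to one endpoint, so the
hypothesis on primitives applies at its supremum. -/
theorem setIntegral_superlevel_le {h ψ : ℝ → ℝ} (hh : Antitone h) {T K : ℝ} (hT : 0 ≤ T)
    (hK : ∀ s ∈ Icc 0 T, ∫ r in (0 : ℝ)..s, ψ r ≤ K) (y : ℝ) :
    ∫ r in Ioc 0 T, {r | y < h r}.indicator ψ r ≤ K := by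
  have hmeas : MeasurableSet {r | y < h r} := measurableSet_lt measurable_const hh.measurable
  rw [setIntegral_indicator hmeas]
  set Z := Ioc 0 T ∩ {r | y < h r} with hZ
  rcases Z.eq_empty_or_nonempty with he | hne
  · rw [he]
    -- An empty superlevel set requires 0 ≤ K, which is the hypothesis at s = 0.
    simpa using hK 0 ⟨le_rfl, hT⟩
  have hbdd : BddAbove Z := ⟨T, fun r hr => hr.1.2⟩
  set s := sSup Z
  have hs : s ∈ Icc 0 T := by
    obtain ⟨r, hr⟩ := hne
    exact ⟨hr.1.1.le.trans (le_csSup hbdd hr), csSup_le ⟨r, hr⟩ fun q hq => hq.1.2⟩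
  have h1 : Z ⊆ Ioc 0 s := fun r hr => ⟨hr.1.1, le_csSup hbdd hr⟩
  have h2 : Ioo 0 s ⊆ Z := by
    intro r hr
    obtain ⟨q, hq, hrq⟩ := exists_lt_of_lt_csSup hne hr.2
    exact ⟨⟨hr.1, hrq.le.trans hq.1.2⟩, lt_of_lt_of_le hq.2 (hh hrq.le)⟩
  have hae : Z =ᵐ[volume] Ioc 0 s :=
    (LE.le.eventuallyLE h1).antisymm
      (Ioo_ae_eq_Ioc.symm.le.trans (LE.le.eventuallyLE h2))
  rw [setIntegral_congr_set hae, ← intervalIntegral.integral_of_le hs.1]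
  exact hK s hs

/-- A second mean value inequality: integrating against an antitone nonnegative weight. -/
theorem integral_antitone_mul_le {h ψ : ℝ → ℝ} (hh : Antitone h) (hh0 : ∀ r, 0 ≤ h r)
    {T K : ℝ} (hT : 0 ≤ T) (hψ : IntervalIntegrable ψ volume 0 T)
    (hK : ∀ s ∈ Icc 0 T, ∫ r in (0 : ℝ)..s, ψ r ≤ K) :
    ∫ r in (0 : ℝ)..T, h r * ψ r ≤ h 0 * K := by
  set H := h 0
  have hψ' : IntegrableOn ψ (Ioc 0 T) := (intervalIntegrable_iff_integrableOn_Ioc_of_le hT).1 hψ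
  -- Layer-cake decomposition of the weight: integrating over y in (0, h 0] recovers h(r)ψ(r), and
  -- Fubini reduces the claim to superlevel sets.
  set F : ℝ → ℝ → ℝ := fun r y => {r | y < h r}.indicator ψ r with hF
  have hFint : Integrable (Function.uncurry F)
      ((volume.restrict (Ioc 0 T)).prod (volume.restrict (Ioc 0 H))) := by
    have h1 : Integrable (fun z : ℝ × ℝ => ψ z.1 * (1 : ℝ))
        ((volume.restrict (Ioc 0 T)).prod (volume.restrict (Ioc 0 H))) :=
      Integrable.mul_prod hψ' (integrable_const (1 : ℝ))
    have hms : MeasurableSet {z : ℝ × ℝ | z.2 < h z.1} :=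
      measurableSet_lt measurable_snd (hh.measurable.comp measurable_fst)
    have h2 := h1.indicator hms
    refine h2.congr (ae_of_all _ fun z => ?_)
    simp [hF, Function.uncurry, indicator]
  have hswap := integral_integral_swap hFint
  have hin : ∀ r ∈ Ioc 0 T, ∫ y in Ioc 0 H, F r y = h r * ψ r := by
    intro r hr
    have e : (fun y => F r y) = (Iio (h r)).indicator fun _ => ψ r := by
      ext y
      simp [hF, indicator]
    rw [e, setIntegral_indicator measurableSet_Iio, setIntegral_const, smul_eq_mul]
    congr 1
    have : Ioc 0 H ∩ Iio (h r) = Ioo 0 (h r) := by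
      ext y
      simp only [mem_inter_iff, mem_Ioc, mem_Iio, mem_Ioo]
      exact ⟨fun hy => ⟨hy.1.1, hy.2⟩, fun hy => ⟨⟨hy.1, hy.2.le.trans (hh hr.1.le)⟩, hy.2⟩⟩
    rw [this, measureReal_def, Real.volume_Ioo, sub_zero, ENNReal.toReal_ofReal (hh0 r)]
  rw [intervalIntegral.integral_of_le hT, ← setIntegral_congr_fun measurableSet_Ioc hin, hswap]
  calc ∫ y in Ioc 0 H, ∫ r in Ioc 0 T, F r y ≤ ∫ _ in Ioc 0 H, K :=
        integral_mono hFint.integral_prod_right (integrable_const _)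
          fun y => setIntegral_superlevel_le hh hT hK y
    _ = H * K := by
        rw [setIntegral_const, measureReal_def, Real.volume_Ioc, sub_zero,
          ENNReal.toReal_ofReal (hh0 0), smul_eq_mul]

theorem integral_exp_mul_eq {ω : ℝ} (hω : ω ≠ 0) (t : ℝ) :
    ∫ r in (0 : ℝ)..t, Real.exp (ω * r) = (Real.exp (ω * t) - 1) / ω := by
  have hd : ∀ r ∈ uIcc 0 t, HasDerivAt (fun r => Real.exp (ω * r) / ω) (Real.exp (ω * r)) r := by
    intro r _
    have h := (((hasDerivAt_id r).const_mul ω).exp).div_const ω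
    simp only [id, mul_one] at h
    rwa [mul_div_cancel_right₀ _ hω] at h
  rw [intervalIntegral.integral_eq_sub_of_hasDerivAt hd
    (Continuous.intervalIntegrable (by fun_prop) _ _)]
  simp
  ring

variable {E : Type*} [NormedAddCommGroup E] [InnerProductSpace ℝ E]

theorem norm_sq_sub_norm_sq (a b : E) : ‖a‖ ^ 2 - ‖b‖ ^ 2 = inner ℝ (a + b) (a - b) := by
  rw [inner_add_left, inner_sub_right, inner_sub_right, real_inner_comm a b,
    real_inner_self_eq_norm_sq, real_inner_self_eq_norm_sq]
  ring

/-- The target ϑ is only Lipschitz, so the chain rule is unavailable. Right difference quotients of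
the squared distance are written as inner products, the increment of ϑ is bounded by its Lipschitz
constant, and the limit is taken. -/
theorem deriv_norm_sq_sub_le {θ ϑ : ℝ → E} {θ' : E} {x K u' : ℝ} (hx : 0 ≤ x)
    (hθ : HasDerivWithinAt θ θ' (Ici 0) x)
    (hϑ : ∀ s t, 0 ≤ s → 0 ≤ t → ‖ϑ s - ϑ t‖ ≤ K * |s - t|)
    (hu : HasDerivAt (fun r => ‖θ r - ϑ r‖ ^ 2) u' x) :
    u' ≤ 2 * inner ℝ (θ x - ϑ x) θ' + 2 * K * ‖θ x - ϑ x‖ := by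
  have hsub : Ioi x ⊆ Ici (0 : ℝ) := fun y hy => hx.trans (le_of_lt hy)
  have hθr : HasDerivWithinAt θ θ' (Ioi x) x := hθ.mono hsub
  have s1 := (hasDerivWithinAt_iff_tendsto_slope' self_notMem_Ioi).1 hu.hasDerivWithinAt
  have s2 := (hasDerivWithinAt_iff_tendsto_slope' self_notMem_Ioi).1 hθr
  have hϑc : Tendsto ϑ (𝓝[>] x) (𝓝 (ϑ x)) := by
    rw [tendsto_iff_norm_sub_tendsto_zero]
    have hlim : Tendsto (fun y => K * |y - x|) (𝓝[>] x) (𝓝 0) := by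
      have : Continuous fun y : ℝ => K * |y - x| := by fun_prop
      have h := this.tendsto x
      simp only [sub_self, abs_zero, mul_zero] at h
      exact h.mono_left nhdsWithin_le_nhds
    refine squeeze_zero' (Eventually.of_forall fun _ => norm_nonneg _) ?_ hlim
    filter_upwards [self_mem_nhdsWithin] with y hy
    exact hϑ y x (hsub hy) hx
  have hec : Tendsto (fun y => (θ y - ϑ y) + (θ x - ϑ x)) (𝓝[>] x)
      (𝓝 ((θ x - ϑ x) + (θ x - ϑ x))) :=
    (hθr.continuousWithinAt.tendsto.sub hϑc).add tendsto_const_nhds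
  have hrhs := (hec.inner (𝕜 := ℝ) s2).add (hec.norm.const_mul K)
  refine (le_of_tendsto_of_tendsto s1 hrhs ?_).trans (le_of_eq ?_)
  · filter_upwards [self_mem_nhdsWithin] with y hy
    have hy0 : 0 < y - x := sub_pos.2 hy
    have e1 : ‖θ y - ϑ y‖ ^ 2 - ‖θ x - ϑ x‖ ^ 2 =
        inner ℝ ((θ y - ϑ y) + (θ x - ϑ x)) (θ y - θ x) -
        inner ℝ ((θ y - ϑ y) + (θ x - ϑ x)) (ϑ y - ϑ x) := by
      rw [← inner_sub_right, ← sub_sub_sub_comm, norm_sq_sub_norm_sq]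
    have e2 := neg_le_of_abs_le ((abs_real_inner_le_norm ((θ y - ϑ y) + (θ x - ϑ x))
      (ϑ y - ϑ x)).trans (mul_le_mul_of_nonneg_left (hϑ y x (hsub hy) hx) (norm_nonneg _)))
    rw [abs_of_pos hy0] at e2
    rw [slope_def_field, div_le_iff₀ hy0, e1, add_mul, slope_def_module, inner_smul_right,
      inv_mul_eq_div, div_mul_cancel₀ _ hy0.ne']
    linarith
  · have : ‖(θ x - ϑ x) + (θ x - ϑ x)‖ = 2 * ‖θ x - ϑ x‖ := by
      rw [← two_smul ℝ, norm_smul]; simp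
    rw [this, inner_add_left]
    ring

theorem lipschitzOnWith_of_norm_sub_le {F : Type*} [NormedAddCommGroup F] {f : ℝ → F} {s : Set ℝ}
    {K : ℝ} (h : ∀ x ∈ s, ∀ y ∈ s, ‖f x - f y‖ ≤ K * |x - y|) :
    LipschitzOnWith (Real.toNNReal K) f s := by
  refine LipschitzOnWith.of_dist_le_mul fun x hx y hy => ?_
  rw [dist_eq_norm, Real.dist_eq]
  exact (h x hx y hy).trans (mul_le_mul_of_nonneg_right (Real.le_coe_toNNReal K) (abs_nonneg _))

/-- The discounted integral of the squared tracking error of a fast linear-type flow is controlled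
by the discounted integral of the inverse speed. -/
theorem integral_tracking_error_le {θ ϑ g : ℝ → E} {η : ℝ → ℝ} {Γ G K E₀ ω : ℝ}
    (hΓ : 0 < Γ) (hω : 0 < ω) (hK : 0 ≤ K)
    (hη_mono : MonotoneOn η (Ici 0)) (hη_one : ∀ t, 0 ≤ t → 1 ≤ η t)
    (hθ : ∀ t, 0 ≤ t → HasDerivWithinAt θ (-(η t • g t)) (Ici 0) t)
    (hg : ∀ t, 0 ≤ t → Γ * ‖θ t - ϑ t‖ ^ 2 ≤ inner ℝ (θ t - ϑ t) (g t))
    (hG : ∀ t, 0 ≤ t → ‖g t‖ ≤ G) (hE : ∀ t, 0 ≤ t → ‖θ t - ϑ t‖ ≤ E₀)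
    (hϑ : ∀ s t, 0 ≤ s → 0 ≤ t → ‖ϑ s - ϑ t‖ ≤ K * |s - t|) :
    ∃ d : ℝ, 0 < d ∧ ∀ t, 0 < t → ∫ r in (0 : ℝ)..t, Real.exp (ω * r) * ‖θ r - ϑ r‖ ^ 2 ≤
      d * ∫ r in (0 : ℝ)..t, Real.exp (ω * r) * (1 / η r) := by
  have hE0 : 0 ≤ E₀ := (norm_nonneg _).trans (hE 0 le_rfl)
  have hG0 : 0 ≤ G := (norm_nonneg _).trans (hG 0 le_rfl)
  set u : ℝ → ℝ := fun r => ‖θ r - ϑ r‖ ^ 2 with hu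
  have hu0 : ∀ r, 0 ≤ u r := fun r => by positivity
  have huE : ∀ r, 0 ≤ r → u r ≤ E₀ ^ 2 := fun r hr =>
    pow_le_pow_left₀ (norm_nonneg _) (hE r hr) 2
  -- a globally antitone version of the inverse speed
  set h : ℝ → ℝ := fun r => 1 / η (max r 0) with hh
  have hηpos : ∀ r, 0 ≤ r → 0 < η r := fun r hr => lt_of_lt_of_le one_pos (hη_one r hr)
  have hanti : Antitone h := fun a b hab =>
    one_div_le_one_div_of_le (hηpos _ (le_max_right _ _))
      (hη_mono (mem_Ici.2 (le_max_right _ _)) (mem_Ici.2 (le_max_right _ _))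
        (max_le_max_right _ hab))
  have hh0 : ∀ r, 0 ≤ h r := fun r => (one_div_pos.2 (hηpos _ (le_max_right _ _))).le
  have hhr : ∀ r, 0 ≤ r → h r = 1 / η r := fun r hr => by simp [hh, max_eq_left hr]
  have hηint : ∀ T, 0 ≤ T → IntervalIntegrable η volume 0 T := fun T hT =>
    (hη_mono.mono (by rw [uIcc_of_le hT]; exact Icc_subset_Ici_self)).intervalIntegrable
  have hhint : ∀ T, IntervalIntegrable (fun r => Real.exp (ω * r) * h r) volume 0 T := fun T =>
    ((hanti.antitoneOn _).intervalIntegrable).continuousOn_mul (by fun_prop)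
  have hinteq : ∀ T, 0 ≤ T → ∫ r in (0 : ℝ)..T, Real.exp (ω * r) * (1 / η r) =
      ∫ r in (0 : ℝ)..T, Real.exp (ω * r) * h r := fun T hT => by
    refine intervalIntegral.integral_congr fun r hr => ?_
    rw [uIcc_of_le hT] at hr
    simp only [hhr r hr.1]
  -- Lipschitz bound for `u` on compact intervals
  have huL : ∀ T, 0 ≤ T → ∀ x ∈ Icc 0 T, ∀ y ∈ Icc 0 T,
      ‖u x - u y‖ ≤ (2 * E₀ * (η T * G + K)) * |x - y| := by
    intro T hT x hx y hy
    have h1 : ‖θ x - θ y‖ ≤ η T * G * ‖x - y‖ := by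
      refine Convex.norm_image_sub_le_of_norm_hasDerivWithin_le (s := Icc 0 T)
        (fun r hr => (hθ r hr.1).mono Icc_subset_Ici_self) (fun r hr => ?_) (convex_Icc _ _) hy hx
      rw [norm_neg, norm_smul, Real.norm_of_nonneg (hηpos r hr.1).le]
      exact mul_le_mul (hη_mono hr.1 hT hr.2) (hG r hr.1) (norm_nonneg _) (hηpos T hT).le
    have h2 := hϑ x y hx.1 hy.1
    have h3 : |‖θ x - ϑ x‖ - ‖θ y - ϑ y‖| ≤ (η T * G + K) * |x - y| := by
      refine (abs_norm_sub_norm_le _ _).trans ?_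
      rw [sub_sub_sub_comm]
      refine (norm_sub_le _ _).trans ?_
      rw [Real.norm_eq_abs] at h1
      linarith
    have h4 : u x - u y = (‖θ x - ϑ x‖ - ‖θ y - ϑ y‖) * (‖θ x - ϑ x‖ + ‖θ y - ϑ y‖) := by
      simp only [hu]; ring
    rw [h4, norm_mul, Real.norm_eq_abs, Real.norm_eq_abs,
      abs_of_nonneg (by positivity : 0 ≤ ‖θ x - ϑ x‖ + ‖θ y - ϑ y‖)]
    have h5 : ‖θ x - ϑ x‖ + ‖θ y - ϑ y‖ ≤ 2 * E₀ := by
      have := hE x hx.1; have := hE y hy.1; linarith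
    calc _ ≤ ((η T * G + K) * |x - y|) * (2 * E₀) :=
          mul_le_mul h3 h5 (by positivity) ((abs_nonneg _).trans h3)
      _ = _ := by ring
  -- Lipschitz regularity gives differentiability almost everywhere and the fundamental theorem of
  -- calculus, although ϑ may fail to be differentiable.
  have huac : ∀ T, 0 ≤ T → AbsolutelyContinuousOnInterval u 0 T := fun T hT =>
    LipschitzOnWith.absolutelyContinuousOnInterval
      (by rw [uIcc_of_le hT]; exact lipschitzOnWith_of_norm_sub_le (huL T hT))
  have heac : ∀ T, AbsolutelyContinuousOnInterval (fun r => Real.exp (ω * r)) 0 T := fun T =>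
    ContDiffOn.absolutelyContinuousOnInterval (ContDiff.contDiffOn (by fun_prop))
  set W : ℝ → ℝ := fun r => Real.exp (ω * r) * u r with hW
  set D : ℝ := 2 * K * E₀ + ω * E₀ ^ 2 with hD
  have hD0 : 0 ≤ D := by positivity
  have hWc : ∀ T, 0 ≤ T → ContinuousOn W (uIcc 0 T) := fun T hT =>
    ((heac T).fun_mul (huac T hT)).continuousOn
  -- The differential inequality for `W` reads W' ≤ -ψ. Its primitives are therefore at most W(0),
  -- hence at most E₀², and weighting by the antitone 1/η cancels η against the decay rate.
  set ψ : ℝ → ℝ := fun r => 2 * Γ * (η r * W r) - D * Real.exp (ω * r) with hψ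
  have hψint : ∀ T, 0 ≤ T → IntervalIntegrable ψ volume 0 T := fun T hT =>
    (((hηint T hT).mul_continuousOn (hWc T hT)).const_mul _).sub
      (Continuous.intervalIntegrable (by fun_prop) _ _)
  have hψle : ∀ s, 0 ≤ s → ∫ r in (0 : ℝ)..s, ψ r ≤ E₀ ^ 2 := by
    intro s hs
    have hac := (heac s).fun_mul (huac s hs)
    have hftc := hac.integral_deriv_eq_sub
    have hle : ∫ r in (0 : ℝ)..s, ψ r ≤ ∫ r in (0 : ℝ)..s, -deriv W r := by
      refine intervalIntegral.integral_mono_ae_restrict hs (hψint s hs)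
        hac.intervalIntegrable_deriv.neg ?_
      rw [EventuallyLE, ae_restrict_iff' measurableSet_Icc]
      filter_upwards [(huac s hs).ae_differentiableAt] with r hr hrs
      have hd : HasDerivAt u (deriv u r) r := (hr (by rwa [uIcc_of_le hs])).hasDerivAt
      have h1 := deriv_norm_sq_sub_le hrs.1 (hθ r hrs.1) hϑ hd
      have hexp : HasDerivAt (fun r => Real.exp (ω * r)) (Real.exp (ω * r) * ω) r := by
        simpa using ((hasDerivAt_id r).const_mul ω).exp
      have h2 := (hexp.mul hd).deriv
      change deriv W r = _ at h2
      rw [inner_neg_right, inner_smul_right] at h1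
      have h3 := mul_le_mul_of_nonneg_left (hg r hrs.1) (hηpos r hrs.1).le
      have h4 := mul_le_mul_of_nonneg_left (hE r hrs.1) (by positivity : 0 ≤ 2 * K)
      have h5 : deriv u r ≤ -(2 * Γ * η r * u r) + 2 * K * E₀ := by
        simp only [hu] at h3 ⊢
        linarith
      have h6 := mul_le_mul_of_nonneg_left (huE r hrs.1) hω.le
      have h7 : deriv u r + ω * u r ≤ -(2 * Γ * η r * u r) + D := by rw [hD]; linarith
      have h8 := mul_le_mul_of_nonneg_left h7 (Real.exp_pos (ω * r)).le
      rw [h2]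
      simp only [hψ, hW]
      linarith
    rw [intervalIntegral.integral_neg, hftc] at hle
    have hWs : 0 ≤ Real.exp (ω * s) * u s := mul_nonneg (Real.exp_pos _).le (hu0 s)
    have hW0 := huE 0 le_rfl
    simp only [mul_zero, Real.exp_zero, one_mul] at hle
    linarith
  have hmain : ∀ t, 0 ≤ t → 2 * Γ * ∫ r in (0 : ℝ)..t, W r ≤
      E₀ ^ 2 + D * ∫ r in (0 : ℝ)..t, Real.exp (ω * r) * h r := by
    intro t ht
    have h1 := integral_antitone_mul_le hanti hh0 ht (hψint t ht) fun s hs => hψle s hs.1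
    have h2 : ∫ r in (0 : ℝ)..t, h r * ψ r =
        ∫ r in (0 : ℝ)..t, (2 * Γ * W r - D * (Real.exp (ω * r) * h r)) := by
      refine intervalIntegral.integral_congr fun r hr => ?_
      rw [uIcc_of_le ht] at hr
      have := (hηpos r hr.1).ne'
      simp only [hψ, hhr r hr.1]
      field_simp
    rw [h2, intervalIntegral.integral_sub ((hWc t ht).intervalIntegrable.const_mul _)
      ((hhint t).const_mul _), intervalIntegral.integral_const_mul,
      intervalIntegral.integral_const_mul] at h1
    have h3 : h 0 * E₀ ^ 2 ≤ E₀ ^ 2 := by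
      rw [hhr 0 le_rfl]
      exact mul_le_of_le_one_left (by positivity)
        ((div_le_one (hηpos 0 le_rfl)).2 (hη_one 0 le_rfl))
    linarith
  have hη1 := hηpos 1 zero_le_one
  refine ⟨(2 * Γ)⁻¹ * (E₀ ^ 2 * η 1 + D) + E₀ ^ 2 * η 1 + 1, by positivity, fun t ht => ?_⟩
  rw [hinteq t ht.le]
  set I := ∫ r in (0 : ℝ)..t, Real.exp (ω * r) * h r with hI
  have hI0 : 0 ≤ I := intervalIntegral.integral_nonneg ht.le fun r _ =>
    mul_nonneg (Real.exp_pos _).le (hh0 r)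
  change ∫ r in (0 : ℝ)..t, W r ≤ _
  -- The initial term E₀² in `hmain` does not vanish as t tends to 0, while the right-hand side
  -- does. For t ≤ 1 the integrand is compared directly, using η(r) ≤ η(1); for t ≥ 1 the integral
  -- of exp(ωr)/η is at least 1/η(1) and absorbs E₀².
  rcases le_total t 1 with ht1 | ht1
  · have h1 : ∫ r in (0 : ℝ)..t, W r ≤
        ∫ r in (0 : ℝ)..t, E₀ ^ 2 * η 1 * (Real.exp (ω * r) * h r) := by
      refine intervalIntegral.integral_mono_on ht.le (hWc t ht.le).intervalIntegrable
        ((hhint t).const_mul _) fun r hr => ?_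
      have h2 : 1 ≤ η 1 * h r := by
        rw [hhr r hr.1, mul_one_div, one_le_div (hηpos r hr.1)]
        exact hη_mono hr.1 (mem_Ici.2 zero_le_one) (hr.2.trans ht1)
      have h3 : u r ≤ E₀ ^ 2 * (η 1 * h r) :=
        (huE r hr.1).trans (le_mul_of_one_le_right (by positivity) h2)
      have h4 := mul_le_mul_of_nonneg_left h3 (Real.exp_pos (ω * r)).le
      simp only [hW]
      linarith
    rw [intervalIntegral.integral_const_mul] at h1
    have h5 : 0 ≤ ((2 * Γ)⁻¹ * (E₀ ^ 2 * η 1 + D) + 1) * I := by positivity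
    linarith
  · have h1 : 1 ≤ η 1 * I := by
      have h2 : ∫ r in (0 : ℝ)..1, (1 / η 1 : ℝ) ≤ ∫ r in (0 : ℝ)..1, Real.exp (ω * r) * h r := by
        refine intervalIntegral.integral_mono_on zero_le_one (by simp) (hhint 1) fun r hr => ?_
        have h3 : 1 / η 1 ≤ h r := by
          rw [← hhr 1 zero_le_one]; exact hanti hr.2
        have h4 : 1 ≤ Real.exp (ω * r) := Real.one_le_exp (mul_nonneg hω.le hr.1)
        exact h3.trans (le_mul_of_one_le_left (hh0 r) h4)
      have h5 : ∫ r in (0 : ℝ)..1, Real.exp (ω * r) * h r ≤ I :=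
        intervalIntegral.integral_mono_interval le_rfl zero_le_one ht1
          (ae_of_all _ fun r => mul_nonneg (Real.exp_pos _).le (hh0 r)) (hhint t)
      rw [intervalIntegral.integral_const] at h2
      simp only [sub_zero, smul_eq_mul, one_mul] at h2
      have := h2.trans h5
      rwa [div_le_iff₀' hη1] at this
    have h2 := hmain t ht.le
    have h3 : E₀ ^ 2 ≤ E₀ ^ 2 * η 1 * I := by
      rw [mul_assoc]; exact le_mul_of_one_le_right (by positivity) h1
    have h4 : 2 * Γ * ∫ r in (0 : ℝ)..t, W r ≤ (E₀ ^ 2 * η 1 + D) * I := by linarith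
    have h5 : ∫ r in (0 : ℝ)..t, W r ≤ (2 * Γ)⁻¹ * ((E₀ ^ 2 * η 1 + D) * I) := by
      rw [inv_mul_eq_div, le_div_iff₀' (by positivity)]; exact h4
    have h6 : 0 ≤ (E₀ ^ 2 * η 1 + 1) * I := by positivity
    linarith

/-- The ratio √t/(√r + η₀) is at most 2 + (t - r), because √t ≤ √r + √(t-r). Half of the exponential
absorbs this linear growth and the other half is integrated. -/
theorem sqrt_mul_integral_exp_le {η₀ ω : ℝ} (hη₀ : 1 ≤ η₀) (hω : 0 < ω) {t : ℝ} (ht : 0 ≤ t) :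
    √t * ∫ r in (0 : ℝ)..t, Real.exp (-ω * (t - r)) * (1 / (√r + η₀)) ≤
      (2 + 2 / ω) * (2 / ω) := by
  have hpos : ∀ r, 0 < √r + η₀ := fun r => by positivity
  have h1 : √t * ∫ r in (0 : ℝ)..t, Real.exp (-ω * (t - r)) * (1 / (√r + η₀)) ≤
      ∫ r in (0 : ℝ)..t, (2 + 2 / ω) * Real.exp (-(ω / 2) * t) * Real.exp (ω / 2 * r) := by
    rw [← intervalIntegral.integral_const_mul]
    refine intervalIntegral.integral_mono_on ht ?_
      (Continuous.intervalIntegrable (by fun_prop) _ _) fun r hr => ?_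
    · refine Continuous.intervalIntegrable ?_ _ _
      have : Continuous fun r : ℝ => 1 / (√r + η₀) :=
        continuous_const.div (by fun_prop) fun r => (hpos r).ne'
      fun_prop
    set x := t - r with hx
    have hx0 : 0 ≤ x := sub_nonneg.2 hr.2
    have e1 : Real.exp (-(ω / 2) * t) * Real.exp (ω / 2 * r) = Real.exp (-(ω / 2) * x) := by
      rw [← Real.exp_add]; congr 1; rw [hx]; ring
    have e2 : Real.exp (-ω * x) = Real.exp (-(ω / 2) * x) * Real.exp (-(ω / 2) * x) := by
      rw [← Real.exp_add]; congr 1; ring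
    have h2 : √t ≤ √r + √x := by
      rw [show t = r + x by rw [hx]; ring]
      refine Real.sqrt_le_iff.2 ⟨by positivity, ?_⟩
      have := Real.sq_sqrt hr.1
      have := Real.sq_sqrt hx0
      nlinarith [Real.sqrt_nonneg r, Real.sqrt_nonneg x,
        mul_nonneg (Real.sqrt_nonneg r) (Real.sqrt_nonneg x)]
    have h3 : √x ≤ 1 + x := by
      refine Real.sqrt_le_iff.2 ⟨by positivity, ?_⟩
      nlinarith
    have h4 : √t * (1 / (√r + η₀)) ≤ 2 + x := by
      rw [mul_one_div, div_le_iff₀ (hpos r)]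
      have hr0 := Real.sqrt_nonneg r
      nlinarith [mul_nonneg hx0 hr0, mul_nonneg hx0 (sub_nonneg.2 hη₀)]
    have h5 : (2 + x) * Real.exp (-(ω / 2) * x) ≤ 2 + 2 / ω := by
      have h6 : ω / 2 * x ≤ Real.exp (ω / 2 * x) := by
        have := Real.add_one_le_exp (ω / 2 * x); linarith
      have h7 : Real.exp (-(ω / 2) * x) ≤ 1 := by
        rw [Real.exp_le_one_iff]
        nlinarith
      have h8 : x * Real.exp (-(ω / 2) * x) ≤ 2 / ω := by
        rw [neg_mul, Real.exp_neg, ← div_eq_mul_inv, div_le_iff₀ (Real.exp_pos _)]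
        have := mul_le_mul_of_nonneg_left h6 (by positivity : 0 ≤ 2 / ω)
        calc x = 2 / ω * (ω / 2 * x) := by field_simp
          _ ≤ _ := this
      linarith
    have hE0 := (Real.exp_pos (-(ω / 2) * x)).le
    calc √t * (Real.exp (-ω * x) * (1 / (√r + η₀)))
        = Real.exp (-ω * x) * (√t * (1 / (√r + η₀))) := by ring
      _ ≤ Real.exp (-ω * x) * (2 + x) := mul_le_mul_of_nonneg_left h4 (Real.exp_pos _).le
      _ = ((2 + x) * Real.exp (-(ω / 2) * x)) * Real.exp (-(ω / 2) * x) := by rw [e2]; ring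
      _ ≤ (2 + 2 / ω) * Real.exp (-(ω / 2) * x) := mul_le_mul_of_nonneg_right h5 hE0
      _ = _ := by rw [mul_assoc, e1]
  refine h1.trans ?_
  rw [intervalIntegral.integral_const_mul, integral_exp_mul_eq (by positivity)]
  have h2 : Real.exp (-(ω / 2) * t) * (Real.exp (ω / 2 * t) - 1) ≤ 1 := by
    rw [mul_sub, ← Real.exp_add]
    have := Real.exp_pos (-(ω / 2) * t)
    simp only [neg_mul, neg_add_cancel, Real.exp_zero, mul_one] at this ⊢
    linarith
  calc (2 + 2 / ω) * Real.exp (-(ω / 2) * t) * ((Real.exp (ω / 2 * t) - 1) / (ω / 2))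
      = (2 + 2 / ω) * (2 / ω) * (Real.exp (-(ω / 2) * t) * (Real.exp (ω / 2 * t) - 1)) := by
        field_simp
    _ ≤ (2 + 2 / ω) * (2 / ω) * 1 := mul_le_mul_of_nonneg_left h2 (by positivity)
    _ = _ := mul_one _

end RealAnalysis

end ActorCritic

/-! ### A priori bounds along the flow -/

namespace ActorCritic

open InformationTheory

theorem nonneg_of_hasDerivAt_of_le_left {u : ℝ → ℝ} {u' s : ℝ} (hs : 0 < s) (hu : HasDerivAt u u' s)
    (hmax : ∀ r ∈ Icc 0 s, u r ≤ u s) : 0 ≤ u' := by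
  have h1 := (hasDerivWithinAt_iff_tendsto_slope' self_notMem_Iio).1
    (hu.hasDerivWithinAt (s := Iio s))
  refine ge_of_tendsto h1 ?_
  filter_upwards [self_mem_nhdsWithin, Ioo_mem_nhdsLT hs] with r _ hr
  rw [slope_def_field]
  exact div_nonneg_of_nonpos (sub_nonpos.2 (hmax r ⟨hr.1.le, hr.2.le⟩)) (sub_nonpos.2 hr.2.le)

namespace RegMDP

variable {S A : Type*} [MeasurableSpace S] [MeasurableSpace A] {M : RegMDP S A}

/-- A probability density cannot lie entirely above or entirely below 1, so an oscillation bound on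
its logarithm is already an absolute bound. Only oscillations need to be followed along the flow. -/
theorem IsDensity.abs_log_le {π : Policy S A} {p : S × A → ℝ} (hp : M.IsDensity π p) {s : S}
    {L : ℝ} (hL : ∀ a a', |Real.log (p (s, a)) - Real.log (p (s, a'))| ≤ L) (a : A) :
    |Real.log (p (s, a))| ≤ L := by
  have h1 := hp.integral_eq_one s
  have hint : Integrable (fun a => p (s, a)) M.μ := by
    by_contra h
    rw [integral_undef h] at h1
    exact zero_ne_one h1
  have hle : ∀ b b', p (s, b) ≤ p (s, b') * Real.exp L := by
    intro b b'
    have h2 := (abs_le.1 (hL b b')).2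
    calc p (s, b) = Real.exp (Real.log (p (s, b))) := (Real.exp_log (hp.pos _)).symm
      _ ≤ Real.exp (Real.log (p (s, b')) + L) := Real.exp_le_exp.2 (by linarith)
      _ = _ := by rw [Real.exp_add, Real.exp_log (hp.pos _)]
  have h2 : p (s, a) ≤ Real.exp L := by
    have h := integral_mono (μ := M.μ) (integrable_const _) (hint.mul_const _) fun b => hle a b
    rw [integral_mul_const, h1] at h
    simpa using h
  have h3 : 1 ≤ p (s, a) * Real.exp L := by
    have h := integral_mono (μ := M.μ) hint (integrable_const _) fun b => hle b a
    rw [h1] at h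
    simpa using h
  have hpa := hp.pos (s, a)
  rw [abs_le]
  constructor
  · have h4 := Real.log_le_log one_pos h3
    rw [Real.log_one, Real.log_mul hpa.ne' (Real.exp_pos _).ne', Real.log_exp] at h4
    linarith
  · have h4 := Real.log_le_log hpa h2
    rwa [Real.log_exp] at h4

/-- The choice f = log p has normalising constant 1. Hence the flow stays in Π_μ as long as
log-densities stay bounded. -/
theorem IsDensity.isAdmissible {π : Policy S A} {p : S × A → ℝ} (hp : M.IsDensity π p)
    (hb : BddMeas fun x => Real.log (p x)) : M.IsAdmissible π := by
  refine ⟨p, fun x => Real.log (p x), hb.measurable, hb.bdd, ?_, hp⟩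
  ext x
  rw [gibbsDensity, hp.integral_exp_log, div_one, Real.exp_log (hp.pos x)]

theorem IsAdmissibleWith.exists_abs_log_le {π : Policy S A} {p : S × A → ℝ}
    (h : M.IsAdmissibleWith π p) : ∃ F : ℝ, 0 ≤ F ∧ ∀ x, |Real.log (p x)| ≤ F := by
  obtain ⟨f, hfm, ⟨C, hC⟩, hpf, hp⟩ := h
  have key : ∀ x : S × A, |Real.log (p x)| ≤ 2 * |C| := by
    rintro ⟨s, a⟩
    refine hp.abs_log_le (fun a a' => ?_) a
    have hlog : ∀ b, Real.log (p (s, b)) =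
        f (s, b) - Real.log (∫ a', Real.exp (f (s, a')) ∂M.μ) := by
      intro b
      have hI : 0 < ∫ a', Real.exp (f (s, a')) ∂M.μ :=
        integral_exp_pos (((BddMeas.mk hfm ⟨C, hC⟩).comp measurable_prodMk_left).exp.integrable _)
      rw [hpf, gibbsDensity, Real.log_div (Real.exp_pos _).ne' hI.ne', Real.log_exp]
    rw [hlog, hlog, sub_sub_sub_cancel_right]
    have := hC (s, a)
    have := hC (s, a')
    have := le_abs_self C
    refine (abs_sub _ _).trans ?_
    linarith
  exact ⟨2 * |C|, by positivity, key⟩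

section Flow

variable {N : ℕ} {φ : S × A → EuclideanSpace ℝ (Fin N)} {θ : ℝ → EuclideanSpace ℝ (Fin N)}
  {π : ℝ → Policy S A} {p : ℝ → S × A → ℝ}

theorem hasDerivWithinAt_log_density (hp : ∀ t, 0 ≤ t → M.IsDensity (π t) (p t))
    (hder : ∀ t, 0 ≤ t → ∀ x : S × A, HasDerivWithinAt (fun r => p r x)
      (-(M.advantage φ (θ t) (π t) (p t) x * p t x)) (Ici 0) t)
    {t : ℝ} (ht : 0 ≤ t) (x : S × A) :
    HasDerivWithinAt (fun r => Real.log (p r x)) (-M.advantage φ (θ t) (π t) (p t) x) (Ici 0) t := by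
  have hpos := ((hp t ht).pos x).ne'
  have h := (hder t ht x).log hpos
  rwa [← neg_mul, mul_div_cancel_right₀ _ hpos] at h

/-- Variation of constants for the differences of the log-densities along the actor flow. -/
theorem abs_log_density_le (hφ : ∀ x, ‖φ x‖ ≤ 1)
    (hp : ∀ t, 0 ≤ t → M.IsDensity (π t) (p t))
    (hder : ∀ t, 0 ≤ t → ∀ x : S × A, HasDerivWithinAt (fun r => p r x)
      (-(M.advantage φ (θ t) (π t) (p t) x * p t x)) (Ici 0) t)
    (hθ : ContinuousOn θ (Ici 0)) {F : ℝ} (hF : ∀ x, |Real.log (p 0 x)| ≤ F)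
    {t m : ℝ} (ht : 0 ≤ t) (hm : ∀ u ∈ Icc 0 t, ‖θ u‖ ≤ m) (x : S × A) :
    |Real.log (p t x)| ≤ 2 * F + 2 * m / M.τ := by
  have hτ := M.τ_pos
  obtain ⟨s, a₀⟩ := x
  have hF0 : 0 ≤ F := (abs_nonneg _).trans (hF (s, a₀))
  have hm0 : 0 ≤ m := (norm_nonneg _).trans (hm 0 ⟨le_rfl, ht⟩)
  -- Constant extension to negative times gives a continuous integrand on the whole line, so the
  -- primitive is differentiable at 0 as well.
  set θc : ℝ → EuclideanSpace ℝ (Fin N) := fun u => θ (max u 0) with hθc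
  have hθcc : Continuous θc :=
    hθ.comp_continuous (by fun_prop) fun u => mem_Ici.2 (le_max_right _ _)
  have hint : Continuous fun u => Real.exp (M.τ * u) • θc u := by fun_prop
  set Θ : ℝ → EuclideanSpace ℝ (Fin N) := fun r => ∫ u in (0 : ℝ)..r, Real.exp (M.τ * u) • θc u
  have hΘd : ∀ r, HasDerivAt Θ (Real.exp (M.τ * r) • θc r) r := fun r =>
    intervalIntegral.integral_hasDerivAt_right (hint.intervalIntegrable _ _)
      (hint.stronglyMeasurableAtFilter _ _) hint.continuousAt
  have hΘt : ‖Θ t‖ ≤ m * ((Real.exp (M.τ * t) - 1) / M.τ) := by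
    rw [← integral_exp_mul_eq hτ.ne', ← intervalIntegral.integral_const_mul]
    refine intervalIntegral.norm_integral_le_of_norm_le ht (ae_of_all _ fun u hu => ?_)
      (Continuous.intervalIntegrable (by fun_prop) _ _)
    rw [norm_smul, Real.norm_of_nonneg (Real.exp_pos _).le, mul_comm]
    refine mul_le_mul_of_nonneg_right ?_ (Real.exp_pos _).le
    simp only [hθc, max_eq_left hu.1.le]
    exact hm u ⟨hu.1.le, hu.2⟩
  refine (hp t ht).abs_log_le (fun a a' => ?_) a₀
  -- In a difference over two actions at the same state the averaged term of the advantage cancels,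
  -- leaving a linear equation with damping τ. `D` is its conserved quantity.
  set D : ℝ → ℝ := fun r => Real.exp (M.τ * r) * (Real.log (p r (s, a)) - Real.log (p r (s, a'))) +
    inner ℝ (Θ r) (φ (s, a) - φ (s, a')) with hDdef
  have hD : ∀ r ∈ Ici (0 : ℝ), HasDerivWithinAt D 0 (Ici 0) r := by
    intro r hr
    have h1 := hasDerivWithinAt_log_density hp hder hr (s, a)
    have h2 := hasDerivWithinAt_log_density hp hder hr (s, a')
    have hexp : HasDerivWithinAt (fun r => Real.exp (M.τ * r)) (Real.exp (M.τ * r) * M.τ)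
        (Ici 0) r := by
      have h := ((hasDerivAt_id r).const_mul M.τ).exp
      simp only [id, mul_one] at h
      exact h.hasDerivWithinAt
    have h3 := (hΘd r).hasDerivWithinAt (s := Ici 0)
    have h4 := (hexp.mul (h1.sub h2)).add
      (h3.inner ℝ (hasDerivWithinAt_const r (Ici 0) (φ (s, a) - φ (s, a'))))
    refine h4.congr_deriv ?_
    simp only [Pi.sub_apply, inner_zero_right, inner_smul_left, hθc, max_eq_left (mem_Ici.1 hr),
      inner_sub_right, advantage, critic, RCLike.conj_to_real]
    ring
  have hconst : D t = D 0 := by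
    have h := Convex.norm_image_sub_le_of_norm_hasDerivWithin_le (C := 0) hD (by simp)
      (convex_Ici 0) (mem_Ici.2 le_rfl) (mem_Ici.2 ht)
    rw [zero_mul] at h
    exact sub_eq_zero.1 (norm_le_zero_iff.1 h)
  have hΘ0 : Θ 0 = 0 := intervalIntegral.integral_same
  simp only [hDdef, hΘ0, inner_zero_left, mul_zero, Real.exp_zero, one_mul, add_zero] at hconst
  have hin : |inner ℝ (Θ t) (φ (s, a) - φ (s, a'))| ≤
      m * ((Real.exp (M.τ * t) - 1) / M.τ) * 2 := by
    refine (abs_real_inner_le_norm _ _).trans (mul_le_mul hΘt ?_ (norm_nonneg _)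
      ((norm_nonneg _).trans hΘt))
    have := hφ (s, a)
    have := hφ (s, a')
    exact (norm_sub_le _ _).trans (by linarith)
  have h5 : Real.exp (M.τ * t) * |Real.log (p t (s, a)) - Real.log (p t (s, a'))| ≤
      2 * F + m * ((Real.exp (M.τ * t) - 1) / M.τ) * 2 := by
    rw [← abs_of_pos (Real.exp_pos (M.τ * t)), ← abs_mul, abs_of_pos (Real.exp_pos (M.τ * t)),
      eq_sub_of_add_eq hconst]
    refine (abs_sub _ _).trans (add_le_add ((abs_sub _ _).trans ?_) hin)
    have := hF (s, a)
    have := hF (s, a')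
    linarith
  have h6 : 1 ≤ Real.exp (M.τ * t) := Real.one_le_exp (mul_nonneg hτ.le ht)
  have h7 : 2 * F + m * ((Real.exp (M.τ * t) - 1) / M.τ) * 2 ≤
      Real.exp (M.τ * t) * (2 * F + 2 * m / M.τ) := by
    have e : Real.exp (M.τ * t) * (2 * F + 2 * m / M.τ) -
        (2 * F + m * ((Real.exp (M.τ * t) - 1) / M.τ) * 2) =
        2 * F * (Real.exp (M.τ * t) - 1) + 2 * m / M.τ := by
      field_simp
      ring
    have : 0 ≤ 2 * F * (Real.exp (M.τ * t) - 1) + 2 * m / M.τ :=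
      add_nonneg (mul_nonneg (by positivity) (by linarith)) (by positivity)
    linarith
  exact le_of_mul_le_mul_left (h5.trans h7) (Real.exp_pos _)

variable {β : Measure (S × A)} [IsProbabilityMeasure β] {η : ℝ → ℝ}

/-- Boundedness of the critic parameters along the flow. -/
theorem norm_critic_le (hφm : Measurable φ) (hφ : ∀ x, ‖φ x‖ ≤ 1)
    (hη_one : ∀ t, 0 ≤ t → 1 ≤ η t) (hΓ : 2 * M.γ < M.Gam φ β)
    (hθ : ∀ t, 0 ≤ t →
      HasDerivWithinAt θ (-(η t • M.semiGradient φ β (θ t) (π t))) (Ici 0) t)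
    (hp : ∀ t, 0 ≤ t → M.IsDensity (π t) (p t))
    (hder : ∀ t, 0 ≤ t → ∀ x : S × A, HasDerivWithinAt (fun r => p r x)
      (-(M.advantage φ (θ t) (π t) (p t) x * p t x)) (Ici 0) t)
    {C F : ℝ} (hC : ∀ x, |M.c x| ≤ C) (hF : ∀ x, |Real.log (p 0 x)| ≤ F) {t : ℝ} (ht : 0 ≤ t) :
    ‖θ t‖ ≤ max ‖θ 0‖ ((C + 2 * M.τ * M.γ * F) / (M.Gam φ β - 2 * M.γ)) := by
  have hτ := M.τ_pos
  have hθc : ContinuousOn θ (Ici 0) := fun r hr => (hθ r hr).continuousWithinAt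
  by_contra! hcon
  -- At a maximum time s of |θ| on [0,t] the derivative of |θ|² cannot be negative. The log-density
  -- bound there involves only m = |θ(s)|, so coercivity makes it negative as soon as m exceeds the
  -- threshold.
  obtain ⟨s, hs, hmax⟩ := isCompact_Icc.exists_isMaxOn (nonempty_Icc.2 ht)
    ((hθc.mono Icc_subset_Ici_self).norm : ContinuousOn (fun r => ‖θ r‖) (Icc 0 t))
  set m := ‖θ s‖ with hm
  have hmt : ‖θ t‖ ≤ m := hmax ⟨ht, le_rfl⟩
  have hm0 : ‖θ 0‖ < m := (le_max_left _ _).trans_lt (hcon.trans_le hmt)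
  have hm1 : (C + 2 * M.τ * M.γ * F) / (M.Gam φ β - 2 * M.γ) < m :=
    (le_max_right _ _).trans_lt (hcon.trans_le hmt)
  have hspos : 0 < s := by
    rcases hs.1.eq_or_lt with h | h
    · rw [← h] at hm
      exact absurd hm0 (by rw [hm]; exact lt_irrefl _)
    · exact h
  have hd : HasDerivAt θ (-(η s • M.semiGradient φ β (θ s) (π s))) s :=
    (hθ s hs.1).hasDerivAt (Ici_mem_nhds hspos)
  have h0 := nonneg_of_hasDerivAt_of_le_left hspos hd.norm_sq fun r hr =>
    pow_le_pow_left₀ (norm_nonneg _) (hmax ⟨hr.1, hr.2.trans hs.2⟩) 2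
  rw [inner_neg_right, inner_smul_right] at h0
  have hL : ∀ x, |Real.log (p s x)| ≤ 2 * F + 2 * m / M.τ := fun x =>
    abs_log_density_le hφ hp hder hθc hF hs.1 (fun u hu => hmax ⟨hu.1, hu.2.trans hs.2⟩) x
  have hb : BddMeas fun x => Real.log (p s x) := ⟨(hp s hs.1).measurable.log, _, hL⟩
  have hK : ∀ s', |(klDiv ((π s).kernel s') M.μ).toReal| ≤ 2 * F + 2 * m / M.τ := fun s' =>
    abs_toReal_klDiv_le (hp s hs.1) hb fun a => (le_abs_self _).trans (hL _)
  have h1 := inner_semiGradient_ge (β := β) hφm hφ hC ((hp s hs.1).bddMeas_klDiv hb) hK (θ s)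
  have hη := hη_one s hs.1
  -- The factor τ of the entropy cancels the 1/τ of the log-density bound; the remaining slope 2γ is
  -- what Γ must exceed.
  have h2 : M.τ * M.γ * (2 * F + 2 * m / M.τ) = 2 * M.τ * M.γ * F + 2 * M.γ * m := by
    field_simp
  rw [h2, ← hm] at h1
  have hmpos : 0 < m := (norm_nonneg _).trans_lt hm0
  rw [div_lt_iff₀ (by linarith)] at hm1
  have h3 : 0 < inner ℝ (θ s) (M.semiGradient φ β (θ s) (π s)) := by
    refine lt_of_lt_of_le ?_ h1
    have : 0 < m * (m * (M.Gam φ β - 2 * M.γ) - (C + 2 * M.τ * M.γ * F)) :=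
      mul_pos hmpos (by linarith)
    nlinarith
  have h4 := mul_pos (lt_of_lt_of_le one_pos hη) h3
  linarith

theorem norm_semiGradient_le (hφ : ∀ x, ‖φ x‖ ≤ 1) {C K : ℝ}
    (hC : ∀ x, |M.c x| ≤ C) {π : Policy S A} (hK : ∀ s, |(klDiv (π.kernel s) M.μ).toReal| ≤ K)
    (θ : EuclideanSpace ℝ (Fin N)) :
    ‖M.semiGradient φ β θ π‖ ≤ ‖θ‖ + (C + M.γ * ‖θ‖ + M.τ * M.γ * K) := by
  have hd := isProbabilityMeasure_occupancy (M.stateActionKernel π) M.γ_pos M.γ_lt_one β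
  have h : ∀ x, ‖(critic φ θ x - M.bellman π (critic φ θ) x) • φ x‖ ≤
      ‖θ‖ + (C + M.γ * ‖θ‖ + M.τ * M.γ * K) := by
    intro x
    rw [norm_smul]
    refine (mul_le_of_le_one_right (norm_nonneg _) (hφ x)).trans ?_
    refine (norm_sub_le _ _).trans (add_le_add (abs_critic_le hφ θ x) ?_)
    have h0 : 0 ≤ M.τ * M.γ := mul_nonneg M.τ_pos.le M.γ_pos.le
    refine (abs_add_le _ _).trans (add_le_add ((abs_add_le _ _).trans (add_le_add (hC x) ?_)) ?_)
    · rw [abs_mul, abs_of_pos M.γ_pos]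
      exact mul_le_mul_of_nonneg_left (abs_integral_le_of_abs_le (abs_critic_le hφ θ) _) M.γ_pos.le
    · rw [abs_mul, abs_of_nonneg h0]
      exact mul_le_mul_of_nonneg_left (abs_integral_le_of_abs_le hK _) h0
  have := norm_integral_le_of_norm_le_const
    (μ := occupancy M.γ (M.stateActionKernel π) β) (ae_of_all _ h)
  rw [semiGradient]
  simpa using this

theorem abs_advantage_le (hφ : ∀ x, ‖φ x‖ ≤ 1) {π : Policy S A} {p : S × A → ℝ} {R L : ℝ}
    (hL : ∀ x, |Real.log (p x)| ≤ L) {θ : EuclideanSpace ℝ (Fin N)} (hR : ‖θ‖ ≤ R) (x : S × A) :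
    |M.advantage φ θ π p x| ≤ 2 * (R + M.τ * L) := by
  have h : ∀ x, |critic φ θ x + M.τ * Real.log (p x)| ≤ R + M.τ * L := by
    intro x
    refine (abs_add_le _ _).trans (add_le_add ((abs_critic_le hφ θ x).trans hR) ?_)
    rw [abs_mul, abs_of_pos M.τ_pos]
    exact mul_le_mul_of_nonneg_left (hL x) M.τ_pos.le
  rw [two_mul]
  exact (abs_sub _ _).trans (add_le_add (h x) (abs_integral_le_of_abs_le (fun a => h (x.1, a)) _))

end Flow

end RegMDP

end ActorCritic

/-! ### Smallness condition, integrated inequality and actor estimates -/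

namespace ActorCritic

open InformationTheory

theorem two_mul_lt_of_div_sqrt_lt_one {Γ γ τ η₀ : ℝ} (hΓ : 0 < Γ) (hγ : 0 < γ) (hτ : 0 < τ)
    (hτ1 : τ < 1) (hη : 1 / Γ < η₀) (h : 2 * √2 * γ / √(Γ ^ 2 - Γ * τ / η₀) < 1) :
    2 * γ < Γ := by
  have hη0 : 0 < η₀ := (one_div_pos.2 hΓ).trans hη
  rw [div_lt_iff₀ hΓ] at hη
  -- Positivity follows from τ < 1 < Γη₀. It must be proved first: for a nonpositive radicand the
  -- square root and the quotient are 0 by convention, and `h` would say nothing.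
  have hx : 0 < Γ ^ 2 - Γ * τ / η₀ := by
    rw [sub_pos, div_lt_iff₀ hη0]
    nlinarith
  rw [div_lt_one (Real.sqrt_pos.2 hx)] at h
  have h1 : 8 * γ ^ 2 < Γ ^ 2 - Γ * τ / η₀ := by
    have h2 := (Real.lt_sqrt (by positivity)).1 h
    rw [mul_pow, mul_pow, Real.sq_sqrt zero_le_two] at h2
    linarith
  have h3 : 0 < Γ * τ / η₀ := by positivity
  nlinarith [sq_nonneg (2 * γ)]

/-- Integrated form of `Y' ≤ κ (V - J) - ω Y + e`. -/
theorem mul_sub_le_of_deriv_le {Y Y' J e : ℝ → ℝ} {κ ω V m t : ℝ} (hκ : 0 ≤ κ) (hω : 0 < ω)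
    (ht : 0 ≤ t) (hYc : ContinuousOn Y (Ici 0)) (hec : ContinuousOn e (Ici 0))
    (hY : ∀ r, 0 < r → HasDerivAt Y (Y' r) r)
    (hY' : ∀ r, 0 < r → Y' r ≤ κ * (V - J r) - ω * Y r + e r)
    (hm : ∀ r ∈ Icc 0 t, m ≤ J r) (hYt : 0 ≤ Y t) :
    κ * (m - V) * ((Real.exp (ω * t) - 1) / ω) ≤
      Y 0 + ∫ r in (0 : ℝ)..t, Real.exp (ω * r) * e r := by
  have hsub : Icc 0 t ⊆ Ici (0 : ℝ) := Icc_subset_Ici_self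
  have hexp : Continuous fun r : ℝ => Real.exp (ω * r) := by fun_prop
  have hec' : ContinuousOn (fun r => Real.exp (ω * r) * e r) (Icc 0 t) :=
    hexp.continuousOn.mul (hec.mono hsub)
  have hcc : ContinuousOn (fun r => κ * (V - m) * Real.exp (ω * r)) (Icc 0 t) := by fun_prop
  have h := intervalIntegral.sub_le_integral_of_hasDeriv_right_of_le (a := 0) (b := t)
    (g := fun r => Real.exp (ω * r) * Y r)
    (g' := fun r => Real.exp (ω * r) * ω * Y r + Real.exp (ω * r) * Y' r)
    (φ := fun r => κ * (V - m) * Real.exp (ω * r) + Real.exp (ω * r) * e r) ht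
    (hexp.continuousOn.mul (hYc.mono hsub)) ?_ (hcc.add hec').integrableOn_Icc ?_
  · rw [intervalIntegral.integral_add (hcc.intervalIntegrable_of_Icc ht)
      (hec'.intervalIntegrable_of_Icc ht), intervalIntegral.integral_const_mul,
      integral_exp_mul_eq hω.ne'] at h
    simp only [mul_zero, Real.exp_zero, one_mul] at h
    have h1 := mul_nonneg (Real.exp_pos (ω * t)).le hYt
    linarith
  · intro r hr
    have he : HasDerivAt (fun r => Real.exp (ω * r)) (Real.exp (ω * r) * ω) r := by
      have h := ((hasDerivAt_id r).const_mul ω).exp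
      simpa only [id, mul_one] using h
    exact (he.mul (hY r hr.1)).hasDerivWithinAt
  · intro r hr
    have h1 := hY' r hr.1
    have h2 : κ * (V - J r) ≤ κ * (V - m) :=
      mul_le_mul_of_nonneg_left (by linarith [hm r ⟨hr.1.le, hr.2.le⟩]) hκ
    have h3 := mul_le_mul_of_nonneg_left (h1.trans (by linarith :
      _ ≤ κ * (V - m) - ω * Y r + e r)) (Real.exp_pos (ω * r)).le
    linarith

namespace RegMDP

variable {S A : Type*} [MeasurableSpace S] [MeasurableSpace A] {M : RegMDP S A}
  {N : ℕ} {φ : S × A → EuclideanSpace ℝ (Fin N)} {θ : ℝ → EuclideanSpace ℝ (Fin N)}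
  {π : ℝ → Policy S A} {p : ℝ → S × A → ℝ} {R L : ℝ}

theorem abs_log_density_sub_le (hφ : ∀ x, ‖φ x‖ ≤ 1)
    (hp : ∀ t, 0 ≤ t → M.IsDensity (π t) (p t))
    (hder : ∀ t, 0 ≤ t → ∀ x : S × A, HasDerivWithinAt (fun r => p r x)
      (-(M.advantage φ (θ t) (π t) (p t) x * p t x)) (Ici 0) t)
    (hR : ∀ t, 0 ≤ t → ‖θ t‖ ≤ R) (hL : ∀ t, 0 ≤ t → ∀ x, |Real.log (p t x)| ≤ L)
    {s t : ℝ} (hs : 0 ≤ s) (ht : 0 ≤ t) (x : S × A) :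
    |Real.log (p s x) - Real.log (p t x)| ≤ 2 * (R + M.τ * L) * |s - t| := by
  refine Convex.norm_image_sub_le_of_norm_hasDerivWithin_le (f := fun r => Real.log (p r x))
    (fun r hr => hasDerivWithinAt_log_density hp hder hr x) (fun r hr => ?_)
    (convex_Ici 0) (mem_Ici.2 ht) (mem_Ici.2 hs)
  rw [norm_neg]
  exact abs_advantage_le hφ (hL r hr) (hR r hr) x

theorem abs_density_sub_le (hφ : ∀ x, ‖φ x‖ ≤ 1)
    (hp : ∀ t, 0 ≤ t → M.IsDensity (π t) (p t))
    (hder : ∀ t, 0 ≤ t → ∀ x : S × A, HasDerivWithinAt (fun r => p r x)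
      (-(M.advantage φ (θ t) (π t) (p t) x * p t x)) (Ici 0) t)
    (hR : ∀ t, 0 ≤ t → ‖θ t‖ ≤ R) (hL : ∀ t, 0 ≤ t → ∀ x, |Real.log (p t x)| ≤ L)
    {s t : ℝ} (hs : 0 ≤ s) (ht : 0 ≤ t) (x : S × A) :
    |p s x - p t x| ≤ 2 * (R + M.τ * L) * Real.exp L * |s - t| := by
  refine Convex.norm_image_sub_le_of_norm_hasDerivWithin_le (f := fun r => p r x)
    (fun r hr => hder r hr x) (fun r hr => ?_) (convex_Ici 0) (mem_Ici.2 ht) (mem_Ici.2 hs)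
  have hadv := abs_advantage_le (M := M) hφ (π := π r) (hL r hr) (hR r hr) x
  rw [norm_neg, norm_mul]
  refine mul_le_mul hadv ?_ (norm_nonneg _) ((abs_nonneg _).trans hadv)
  have hpos := (hp r hr).pos x
  rw [Real.norm_of_nonneg hpos.le, ← Real.exp_log hpos]
  exact Real.exp_le_exp.2 ((le_abs_self _).trans (hL r hr x))

/-- Bounds on feature coefficients from bounds on the represented function. -/
theorem norm_le_of_abs_critic_le {β : Measure (S × A)} [IsProbabilityMeasure β]
    (hφm : Measurable φ) (hφ : ∀ x, ‖φ x‖ ≤ 1) (hβ : 0 < lambdaMin (featureCov φ β))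
    {v : EuclideanSpace ℝ (Fin N)} {D : ℝ} (hD : ∀ x, |critic φ v x| ≤ D) :
    ‖v‖ ≤ (√(lambdaMin (featureCov φ β)))⁻¹ * D := by
  have h0 : 0 ≤ D := by
    obtain ⟨x⟩ := β.nonempty_of_neZero
    exact (abs_nonneg _).trans (hD x)
  have h1 := lambdaMin_mul_sq_le hφm hφ β v
  have h2 : ∫ x, critic φ v x ^ 2 ∂β ≤ D ^ 2 := by
    refine (le_abs_self _).trans (abs_integral_le_of_abs_le (fun x => ?_) β)
    rw [abs_pow]
    exact pow_le_pow_left₀ (abs_nonneg _) (hD x) 2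
  have hs := Real.sqrt_pos.2 hβ
  rw [inv_mul_eq_div, le_div_iff₀ hs]
  refine (sq_le_sq₀ (by positivity) h0).1 ?_
  rw [mul_pow, Real.sq_sqrt hβ.le]
  linarith

theorem bddMeas_advantage {π : Policy S A} {p : S × A → ℝ}
    (hb : BddMeas fun x => Real.log (p x)) (hφm : Measurable φ)
    (hφ : ∀ x, ‖φ x‖ ≤ 1) (θ : EuclideanSpace ℝ (Fin N)) : BddMeas (M.advantage φ θ π p) := by
  have h := (bddMeas_critic hφm hφ θ).add (hb.const_mul M.τ)
  exact h.sub ((h.integral_kernel_prod π.kernel).comp measurable_fst)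

section

variable [MeasurableSpace.CountableOrCountablyGenerated S A]

/-- Lipschitz dependence of the values on time along the actor flow. -/
theorem exists_abs_realValue_sub_le (hφ : ∀ x, ‖φ x‖ ≤ 1)
    (hp : ∀ t, 0 ≤ t → M.IsDensity (π t) (p t))
    (hder : ∀ t, 0 ≤ t → ∀ x : S × A, HasDerivWithinAt (fun r => p r x)
      (-(M.advantage φ (θ t) (π t) (p t) x * p t x)) (Ici 0) t)
    (hR : ∀ t, 0 ≤ t → ‖θ t‖ ≤ R) (hL : ∀ t, 0 ≤ t → ∀ x, |Real.log (p t x)| ≤ L) :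
    ∃ K : ℝ, ∀ s t, 0 ≤ s → 0 ≤ t → ∀ y,
      |M.realValue (π s) y - M.realValue (π t) y| ≤ K * |s - t| := by
  obtain ⟨C, hC⟩ := M.bounded_c
  refine ⟨(1 - M.γ)⁻¹ * (M.τ + M.valueBound C L + M.τ * L) *
    (2 * (R + M.τ * L) * Real.exp L), fun s t hs ht y => ?_⟩
  rw [mul_assoc]
  refine abs_realValue_sub_le (hp s hs) (hp t ht) hC (hL s hs) (hL t ht)
    (abs_density_sub_le hφ hp hder hR hL hs ht) (fun x => ?_) y
  refine (abs_log_density_sub_le hφ hp hder hR hL hs ht x).trans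
    (mul_le_mul_of_nonneg_right ?_ (abs_nonneg _))
  have h0 : 0 ≤ L := (abs_nonneg _).trans (hL s hs x)
  have h1 : 0 ≤ R := (norm_nonneg _).trans (hR s hs)
  have h2 : 0 ≤ 2 * (R + M.τ * L) := by have := M.τ_pos; positivity
  exact le_mul_of_one_le_right h2 (Real.one_le_exp h0)

variable {ρ : Measure S} [IsProbabilityMeasure ρ] {πs : Policy S A}

/-- The differential inequality for the distance to the comparison policy. -/
theorem integral_advantage_le (hφm : Measurable φ) (hφ : ∀ x, ‖φ x‖ ≤ 1)
    {π : Policy S A} {p : S × A → ℝ} (hp : M.IsDensity π p)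
    (hb : BddMeas fun x => Real.log (p x)) (h : M.totalEntropy πs ρ ≠ ⊤)
    (θ ϑ : EuclideanSpace ℝ (Fin N)) (hϑ : ∀ x, M.qValue π x = critic φ ϑ x) :
    ∫ x, M.advantage φ θ π p x ∂(M.stateOcc πs ρ ⊗ₘ πs.kernel) ≤
      (1 - M.γ) * ((1 - M.γ)⁻¹ * (∫ x, M.c x ∂(M.stateOcc πs ρ ⊗ₘ πs.kernel) +
          M.τ * (M.totalEntropy πs ρ).toReal) - ∫ s, M.realValue π s ∂ρ) -
        M.τ / 2 * ((M.totalEntropy πs ρ).toReal -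
          ∫ x, Real.log (p x) ∂(M.stateOcc πs ρ ⊗ₘ πs.kernel)) + ‖θ - ϑ‖ ^ 2 / M.τ := by
  have hc := bddMeas_critic hφm hφ (φ := φ)
  have hl := hb.const_mul M.τ
  have h1 := performance_difference (π' := πs) (ρ := ρ) hp hb (M.totalEntropy πs ρ).toReal
  have h2 := integral_sub_integral_policy_le (π' := πs) (d := M.stateOcc πs ρ) hp hb h
    (hc (θ - ϑ)) (abs_critic_le hφ (θ - ϑ))
  -- The approximate soft Q-function is the exact one plus the critic error: performance difference
  -- handles the former, Pinsker the latter.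
  have hq : ∀ x, critic φ θ x + M.τ * Real.log (p x) =
      critic φ (θ - ϑ) x + (M.qValue π x + M.τ * Real.log (p x)) := by
    intro x
    rw [hϑ, critic_sub]
    ring
  have hQ : BddMeas fun x => M.qValue π x + M.τ * Real.log (p x) :=
    (hp.bddMeas_qValue hb).add hl
  have h3 : ∫ x, M.advantage φ θ π p x ∂(M.stateOcc πs ρ ⊗ₘ πs.kernel) =
      (∫ x, critic φ (θ - ϑ) x ∂(M.stateOcc πs ρ ⊗ₘ πs.kernel) -
        ∫ s, ∫ a, critic φ (θ - ϑ) (s, a) ∂π.kernel s ∂M.stateOcc πs ρ) +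
      (∫ x, (M.qValue π x + M.τ * Real.log (p x)) ∂(M.stateOcc πs ρ ⊗ₘ πs.kernel) -
        ∫ s, ∫ a, (M.qValue π (s, a) + M.τ * Real.log (p (s, a))) ∂π.kernel s
          ∂M.stateOcc πs ρ) := by
    have hi : ∀ s, ∫ a, (critic φ (θ - ϑ) (s, a) +
        (M.qValue π (s, a) + M.τ * Real.log (p (s, a)))) ∂π.kernel s =
        ∫ a, critic φ (θ - ϑ) (s, a) ∂π.kernel s +
        ∫ a, (M.qValue π (s, a) + M.τ * Real.log (p (s, a))) ∂π.kernel s := fun s =>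
      integral_add (((hc _).comp measurable_prodMk_left).integrable _)
        ((hQ.comp measurable_prodMk_left).integrable _)
    have hgk := (hc (θ - ϑ)).integral_kernel_prod π.kernel
    have hQk := hQ.integral_kernel_prod π.kernel
    have hadv : ∀ x, M.advantage φ θ π p x = (critic φ (θ - ϑ) x +
        (M.qValue π x + M.τ * Real.log (p x))) - (∫ a, critic φ (θ - ϑ) (x.1, a) ∂π.kernel x.1 +
        ∫ a, (M.qValue π (x.1, a) + M.τ * Real.log (p (x.1, a))) ∂π.kernel x.1) := by
      intro x
      rw [advantage]
      simp_rw [hq]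
      rw [hi]
    have hfst : ∀ {f : S → ℝ}, BddMeas f → ∫ x, f x.1 ∂(M.stateOcc πs ρ ⊗ₘ πs.kernel) =
        ∫ s, f s ∂M.stateOcc πs ρ := by
      intro f hf
      rw [Measure.integral_compProd ((hf.comp measurable_fst).integrable _)]
      simp
    simp_rw [hadv]
    rw [integral_sub (((hc _).add hQ).integrable _)
        (((hgk.add hQk).comp measurable_fst).integrable _),
      integral_add ((hc _).integrable _) (hQ.integrable _),
      integral_add ((hgk.comp measurable_fst).integrable _)
        ((hQk.comp measurable_fst).integrable _),
      hfst hgk, hfst hQk]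
    ring
  rw [totalEntropy] at h1 ⊢
  rw [h3]
  linarith

end

/-- Differentiation under the integral, dominated by the uniform advantage bound. The case of
interest is the state-action occupancy measure of π*. -/
theorem hasDerivAt_integral_log_density (hφm : Measurable φ) (hφ : ∀ x, ‖φ x‖ ≤ 1)
    (hp : ∀ t, 0 ≤ t → M.IsDensity (π t) (p t))
    (hder : ∀ t, 0 ≤ t → ∀ x : S × A, HasDerivWithinAt (fun r => p r x)
      (-(M.advantage φ (θ t) (π t) (p t) x * p t x)) (Ici 0) t)
    (hR : ∀ t, 0 ≤ t → ‖θ t‖ ≤ R) (hL : ∀ t, 0 ≤ t → ∀ x, |Real.log (p t x)| ≤ L)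
    (ν : Measure (S × A)) [IsProbabilityMeasure ν] {t : ℝ} (ht : 0 < t) :
    HasDerivAt (fun r => ∫ x, Real.log (p r x) ∂ν)
      (∫ x, -M.advantage φ (θ t) (π t) (p t) x ∂ν) t := by
  have hb : ∀ t, 0 ≤ t → BddMeas fun x => Real.log (p t x) := fun t ht =>
    ⟨(hp t ht).measurable.log, L, hL t ht⟩
  have hmem : Ioi (0 : ℝ) ∈ 𝓝 t := Ioi_mem_nhds ht
  refine (hasDerivAt_integral_of_dominated_loc_of_deriv_le (s := Ioi (0 : ℝ))
    (F := fun r x => Real.log (p r x)) (F' := fun r x => -M.advantage φ (θ r) (π r) (p r) x)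
    (bound := fun _ => 2 * (R + M.τ * L)) hmem ?_ ((hb t ht.le).integrable ν) ?_ ?_
    (integrable_const _) ?_).2
  · filter_upwards [hmem] with r hr
    exact (hb r (le_of_lt hr)).measurable.aestronglyMeasurable
  · exact ((bddMeas_advantage (hb t ht.le) hφm hφ _).measurable.neg).aestronglyMeasurable
  · refine ae_of_all _ fun x r hr => ?_
    rw [norm_neg]
    exact abs_advantage_le hφ (hL r (le_of_lt hr)) (hR r (le_of_lt hr)) x
  · exact ae_of_all _ fun x r hr =>
      (hasDerivWithinAt_log_density hp hder (le_of_lt hr) x).hasDerivAt (Ici_mem_nhds hr)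

end RegMDP

end ActorCritic

/-! ### Critic tracking and the convergence estimate -/

namespace ActorCritic

open InformationTheory

namespace RegMDP

variable {S A : Type*} [MeasurableSpace S] [MeasurableSpace A] {M : RegMDP S A}
  {N : ℕ} {φ : S × A → EuclideanSpace ℝ (Fin N)} {θ : ℝ → EuclideanSpace ℝ (Fin N)}
  {π : ℝ → Policy S A} {p : ℝ → S × A → ℝ} {R L : ℝ}
  {β : Measure (S × A)} {η : ℝ → ℝ}

theorem gam_pos (hβ : 0 < lambdaMin (featureCov φ β)) : 0 < M.Gam φ β := by
  have h1 : 0 < 1 - M.γ := sub_pos.2 M.γ_lt_one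
  have h2 : 0 < 1 - √M.γ := sub_pos.2 ((Real.sqrt_lt' one_pos).2 (by simpa using M.γ_lt_one))
  exact mul_pos (mul_pos hβ h1) h2

variable [IsProbabilityMeasure β]

/-- Uniform bounds on the critic parameters and on the log-densities along the flow. -/
theorem exists_flow_bounds (hφm : Measurable φ) (hφ : ∀ x, ‖φ x‖ ≤ 1)
    (hη_one : ∀ t, 0 ≤ t → 1 ≤ η t) (hΓ : 2 * M.γ < M.Gam φ β)
    (hθ : ∀ t, 0 ≤ t →
      HasDerivWithinAt θ (-(η t • M.semiGradient φ β (θ t) (π t))) (Ici 0) t)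
    (h0 : M.IsAdmissibleWith (π 0) (p 0))
    (hp : ∀ t, 0 ≤ t → M.IsDensity (π t) (p t))
    (hder : ∀ t, 0 ≤ t → ∀ x : S × A, HasDerivWithinAt (fun r => p r x)
      (-(M.advantage φ (θ t) (π t) (p t) x * p t x)) (Ici 0) t) :
    ∃ R L : ℝ, (∀ t, 0 ≤ t → ‖θ t‖ ≤ R) ∧ ∀ t, 0 ≤ t → ∀ x, |Real.log (p t x)| ≤ L := by
  obtain ⟨F, -, hF⟩ := h0.exists_abs_log_le
  obtain ⟨C, hC⟩ := M.bounded_c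
  have hR := fun t ht => norm_critic_le (t := t) hφm hφ hη_one hΓ hθ hp hder hC hF ht
  exact ⟨_, _, hR, fun t ht x => abs_log_density_le hφ hp hder
    (fun r hr => (hθ r hr).continuousWithinAt) hF ht (fun u hu => hR u hu.1) x⟩

theorem continuousOn_integral_log_density (hφ : ∀ x, ‖φ x‖ ≤ 1)
    (hp : ∀ t, 0 ≤ t → M.IsDensity (π t) (p t))
    (hder : ∀ t, 0 ≤ t → ∀ x : S × A, HasDerivWithinAt (fun r => p r x)
      (-(M.advantage φ (θ t) (π t) (p t) x * p t x)) (Ici 0) t)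
    (hR : ∀ t, 0 ≤ t → ‖θ t‖ ≤ R) (hL : ∀ t, 0 ≤ t → ∀ x, |Real.log (p t x)| ≤ L)
    (ν : Measure (S × A)) [IsProbabilityMeasure ν] :
    ContinuousOn (fun t => ∫ x, Real.log (p t x) ∂ν) (Ici 0) := by
  have hb : ∀ t, 0 ≤ t → BddMeas fun x => Real.log (p t x) := fun t ht =>
    ⟨(hp t ht).measurable.log, L, hL t ht⟩
  refine (lipschitzOnWith_of_norm_sub_le (K := 2 * (R + M.τ * L))
    fun s hs t ht => ?_).continuousOn
  rw [← integral_sub ((hb s hs).integrable _) ((hb t ht).integrable _)]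
  exact abs_integral_le_of_abs_le (abs_log_density_sub_le hφ hp hder hR hL hs ht) ν

variable [MeasurableSpace.CountableOrCountablyGenerated S A]

/-- The critic tracks the parameters of the true value functions. -/
theorem exists_tracking (hφm : Measurable φ) (hφ : ∀ x, ‖φ x‖ ≤ 1) (hreal : M.Realisable φ)
    (hβ : 0 < lambdaMin (featureCov φ β))
    (hη_mono : MonotoneOn η (Ici 0)) (hη_one : ∀ t, 0 ≤ t → 1 ≤ η t)
    (hθ : ∀ t, 0 ≤ t →
      HasDerivWithinAt θ (-(η t • M.semiGradient φ β (θ t) (π t))) (Ici 0) t)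
    (hp : ∀ t, 0 ≤ t → M.IsDensity (π t) (p t))
    (hder : ∀ t, 0 ≤ t → ∀ x : S × A, HasDerivWithinAt (fun r => p r x)
      (-(M.advantage φ (θ t) (π t) (p t) x * p t x)) (Ici 0) t)
    (hR : ∀ t, 0 ≤ t → ‖θ t‖ ≤ R) (hL : ∀ t, 0 ≤ t → ∀ x, |Real.log (p t x)| ≤ L)
    {ω : ℝ} (hω : 0 < ω) :
    ∃ ϑ : ℝ → EuclideanSpace ℝ (Fin N),
      (∀ t, 0 ≤ t → ∀ x, M.qValue (π t) x = critic φ (ϑ t) x) ∧ ContinuousOn ϑ (Ici 0) ∧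
      ∃ d : ℝ, 0 < d ∧ ∀ t, 0 < t → ∫ r in (0 : ℝ)..t, Real.exp (ω * r) * ‖θ r - ϑ r‖ ^ 2 ≤
        d * ∫ r in (0 : ℝ)..t, Real.exp (ω * r) * (1 / η r) := by
  obtain ⟨C, hC⟩ := M.bounded_c
  have hb : ∀ t, 0 ≤ t → BddMeas fun x => Real.log (p t x) := fun t ht =>
    ⟨(hp t ht).measurable.log, L, hL t ht⟩
  -- Realisability is available at every t ≥ 0 because log-densities are bounded; the value 0 at
  -- negative times only makes the choice total.
  have hex : ∀ t, ∃ v : EuclideanSpace ℝ (Fin N), 0 ≤ t →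
      ∀ x, M.qValue (π t) x = critic φ v x := by
    intro t
    by_cases ht : 0 ≤ t
    · obtain ⟨v, hv⟩ := hreal (π t) ((hp t ht).isAdmissible (hb t ht))
      exact ⟨v, fun _ => hv⟩
    · exact ⟨0, fun h => absurd h ht⟩
  choose ϑ hϑ using hex
  obtain ⟨K, hK⟩ := exists_abs_realValue_sub_le hφ hp hder hR hL
  set l := (√(lambdaMin (featureCov φ β)))⁻¹ with hl
  -- Positive definiteness of the feature covariance transfers the Lipschitz bound on Q to the
  -- parameters.
  have hLip : ∀ s t, 0 ≤ s → 0 ≤ t → ‖ϑ s - ϑ t‖ ≤ l * |K| * |s - t| := by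
    intro s t hs ht
    rw [mul_assoc]
    refine norm_le_of_abs_critic_le hφm hφ hβ fun x => ?_
    rw [critic_sub, ← hϑ s hs, ← hϑ t ht]
    refine abs_qValue_sub_le (hp s hs) (hp t ht) (hb s hs) (hb t ht) (fun y => ?_) x
    exact (hK s t hs ht y).trans (mul_le_mul_of_nonneg_right (le_abs_self _) (abs_nonneg _))
  have hbd : ∀ t, 0 ≤ t → ‖ϑ t‖ ≤ l * M.valueBound C L := fun t ht =>
    norm_le_of_abs_critic_le hφm hφ hβ fun x => by
      rw [← hϑ t ht]
      exact abs_qValue_le (hp t ht) hC (hL t ht) x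
  refine ⟨ϑ, hϑ, ?_, ?_⟩
  · exact (lipschitzOnWith_of_norm_sub_le fun s hs t ht => hLip s t hs ht).continuousOn
  · refine integral_tracking_error_le (g := fun t => M.semiGradient φ β (θ t) (π t))
      (E₀ := R + l * M.valueBound C L) (G := R + (C + M.γ * R + M.τ * M.γ * L))
      (gam_pos (M := M) hβ) hω (by positivity) hη_mono hη_one hθ
      (fun t ht => inner_semiGradient_sub_ge hφm hφ (hp t ht) (hb t ht) _ _ (hϑ t ht))
      (fun t ht => ?_) (fun t ht => ?_) hLip
    · refine (norm_semiGradient_le hφ hC (fun s => abs_toReal_klDiv_le (hp t ht) (hb t ht)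
        fun a => (le_abs_self _).trans (hL t ht _)) _).trans ?_
      have h1 := hR t ht
      have h2 := mul_le_mul_of_nonneg_left h1 M.γ_pos.le
      linarith
    · exact (norm_sub_le _ _).trans (add_le_add (hR t ht) (hbd t ht))

variable {ρ : Measure S} [IsProbabilityMeasure ρ] {πs : Policy S A}

theorem continuousOn_integral_realValue (hφ : ∀ x, ‖φ x‖ ≤ 1)
    (hp : ∀ t, 0 ≤ t → M.IsDensity (π t) (p t))
    (hder : ∀ t, 0 ≤ t → ∀ x : S × A, HasDerivWithinAt (fun r => p r x)
      (-(M.advantage φ (θ t) (π t) (p t) x * p t x)) (Ici 0) t)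
    (hR : ∀ t, 0 ≤ t → ‖θ t‖ ≤ R) (hL : ∀ t, 0 ≤ t → ∀ x, |Real.log (p t x)| ≤ L) :
    ContinuousOn (fun t => ∫ s, M.realValue (π t) s ∂ρ) (Ici 0) := by
  have hb : ∀ t, 0 ≤ t → BddMeas fun x => Real.log (p t x) := fun t ht =>
    ⟨(hp t ht).measurable.log, L, hL t ht⟩
  obtain ⟨K, hK⟩ := exists_abs_realValue_sub_le hφ hp hder hR hL
  refine (lipschitzOnWith_of_norm_sub_le (K := K) fun s hs t ht => ?_).continuousOn
  rw [← integral_sub (((hp s hs).bddMeas_realValue (hb s hs)).integrable _)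
    (((hp t ht).bddMeas_realValue (hb t ht)).integrable _)]
  exact abs_integral_le_of_abs_le (hK s t hs ht) ρ

/-- The convergence estimate for the actor-critic flow, against any lower bound `m` of the values
on `[0, t]`. -/
theorem exists_sub_le (hφm : Measurable φ) (hφ : ∀ x, ‖φ x‖ ≤ 1) (hreal : M.Realisable φ)
    (hβ : 0 < lambdaMin (featureCov φ β))
    (hη_mono : MonotoneOn η (Ici 0)) (hη_one : ∀ t, 0 ≤ t → 1 ≤ η t)
    (hθ : ∀ t, 0 ≤ t →
      HasDerivWithinAt θ (-(η t • M.semiGradient φ β (θ t) (π t))) (Ici 0) t)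
    (hp : ∀ t, 0 ≤ t → M.IsDensity (π t) (p t))
    (hder : ∀ t, 0 ≤ t → ∀ x : S × A, HasDerivWithinAt (fun r => p r x)
      (-(M.advantage φ (θ t) (π t) (p t) x * p t x)) (Ici 0) t)
    (hR : ∀ t, 0 ≤ t → ‖θ t‖ ≤ R) (hL : ∀ t, 0 ≤ t → ∀ x, |Real.log (p t x)| ≤ L)
    (h : M.totalEntropy πs ρ ≠ ⊤) {V : ℝ} (hV : M.valueAt πs ρ = (V : EReal)) :
    ∃ d : ℝ, 0 < d ∧ ∀ t m : ℝ, 0 < t → (∀ r ∈ Icc 0 t, m ≤ ∫ s, M.realValue (π r) s ∂ρ) →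
      m - V ≤ M.τ / (2 * (1 - M.γ) * (1 - Real.exp (-(M.τ / 2) * t))) *
        (Real.exp (-(M.τ / 2) * t) * (M.initialKL ρ πs (π 0)).toReal
          + d * ∫ r in (0 : ℝ)..t, Real.exp (-(M.τ / 2) * (t - r)) * (1 / η r)) := by
  have hτ := M.τ_pos
  have hω : 0 < M.τ / 2 := half_pos hτ
  have hγ : 0 < 1 - M.γ := sub_pos.2 M.γ_lt_one
  have hb : ∀ t, 0 ≤ t → BddMeas fun x => Real.log (p t x) := fun t ht =>
    ⟨(hp t ht).measurable.log, L, hL t ht⟩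
  rw [valueAt_eq_of_ne_top h, EReal.coe_eq_coe_iff] at hV
  obtain ⟨ϑ, hϑ, hϑc, d, hd, hdt⟩ :=
    exists_tracking hφm hφ hreal hβ hη_mono hη_one hθ hp hder hR hL hω
  set ν := M.stateOcc πs ρ ⊗ₘ πs.kernel with hν
  -- The averaged relative entropy of the comparison policy to π_r, in a form whose only time
  -- dependence is a bounded integrand.
  set Y : ℝ → ℝ := fun r => (M.totalEntropy πs ρ).toReal - ∫ x, Real.log (p r x) ∂ν with hY
  have hYnn : ∀ t, 0 ≤ t → 0 ≤ Y t := fun t ht =>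
    toReal_sub_integral_log_nonneg (d := M.stateOcc πs ρ) (hp t ht) (hb t ht) h
  have hY0 : (M.initialKL ρ πs (π 0)).toReal = Y 0 := by
    have h1 := lintegral_klDiv_policy (d := M.stateOcc πs ρ) (hp 0 le_rfl) (hb 0 le_rfl) h
    rw [initialKL, ← stateOcc, h1]
    exact ENNReal.toReal_ofReal (hYnn 0 le_rfl)
  have hθc : ContinuousOn θ (Ici 0) := fun r hr => (hθ r hr).continuousWithinAt
  -- The critic error enters the inequality for Y as |θ - ϑ|²/τ, hence the tracking constant divided
  -- by τ.
  refine ⟨d / M.τ, by positivity, fun t m ht hm => ?_⟩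
  have key := mul_sub_le_of_deriv_le (Y := Y) (κ := 1 - M.γ) (ω := M.τ / 2) (V := V) (m := m)
    (J := fun r => ∫ s, M.realValue (π r) s ∂ρ) (e := fun r => ‖θ r - ϑ r‖ ^ 2 / M.τ)
    (Y' := fun r => ∫ x, M.advantage φ (θ r) (π r) (p r) x ∂ν) hγ.le hω ht.le
    (continuousOn_const.sub (continuousOn_integral_log_density hφ hp hder hR hL ν))
    (((hθc.sub hϑc).norm.pow 2).div_const _)
    (fun r hr => by
      have h1 := (hasDerivAt_integral_log_density hφm hφ hp hder hR hL ν hr).const_sub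
        (M.totalEntropy πs ρ).toReal
      rwa [integral_neg, neg_neg] at h1)
    (fun r hr => by
      have h1 := integral_advantage_le hφm hφ (hp r hr.le) (hb r hr.le) h (θ r) (ϑ r)
        (hϑ r hr.le)
      rwa [hV] at h1)
    hm (hYnn t ht.le)
  have hI : ∫ r in (0 : ℝ)..t, Real.exp (M.τ / 2 * r) * (‖θ r - ϑ r‖ ^ 2 / M.τ) ≤
      d / M.τ * ∫ r in (0 : ℝ)..t, Real.exp (M.τ / 2 * r) * (1 / η r) := by
    have h1 : ∀ r, Real.exp (M.τ / 2 * r) * (‖θ r - ϑ r‖ ^ 2 / M.τ) =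
        Real.exp (M.τ / 2 * r) * ‖θ r - ϑ r‖ ^ 2 / M.τ := fun r => (mul_div_assoc _ _ _).symm
    simp_rw [h1]
    rw [intervalIntegral.integral_div, div_mul_eq_mul_div]
    exact div_le_div_of_nonneg_right (hdt t ht) hτ.le
  have hshift : ∫ r in (0 : ℝ)..t, Real.exp (-(M.τ / 2) * (t - r)) * (1 / η r) =
      Real.exp (-(M.τ / 2) * t) * ∫ r in (0 : ℝ)..t, Real.exp (M.τ / 2 * r) * (1 / η r) := by
    rw [← intervalIntegral.integral_const_mul]
    refine intervalIntegral.integral_congr fun r _ => ?_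
    rw [← mul_assoc, ← Real.exp_add]
    ring_nf
  rw [hshift, hY0]
  have hE : Real.exp (-(M.τ / 2) * t) < 1 := Real.exp_lt_one_iff.2 (by nlinarith)
  have hEE : Real.exp (-(M.τ / 2) * t) * Real.exp (M.τ / 2 * t) = 1 := by
    rw [← Real.exp_add, neg_mul, neg_add_cancel, Real.exp_zero]
  set I := ∫ r in (0 : ℝ)..t, Real.exp (M.τ / 2 * r) * (1 / η r)
  set E := Real.exp (-(M.τ / 2) * t) with hEdef
  have hEpos : 0 < E := Real.exp_pos _
  have h1 : (1 - M.γ) * (m - V) * ((1 - E) / (M.τ / 2)) ≤ E * Y 0 + d / M.τ * (E * I) := by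
    have h2 := mul_le_mul_of_nonneg_left (key.trans (add_le_add_right hI _)) hEpos.le
    have h3 : E * ((1 - M.γ) * (m - V) * ((Real.exp (M.τ / 2 * t) - 1) / (M.τ / 2))) =
        (1 - M.γ) * (m - V) * ((E * Real.exp (M.τ / 2 * t) - E) / (M.τ / 2)) := by ring
    rw [h3, hEE] at h2
    linarith
  have hE1 : 0 < 1 - E := sub_pos.2 hE
  calc m - V = M.τ / (2 * (1 - M.γ) * (1 - E)) *
        ((1 - M.γ) * (m - V) * ((1 - E) / (M.τ / 2))) := by field_simp
    _ ≤ _ := mul_le_mul_of_nonneg_left h1 (by positivity)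

end RegMDP

/-- The rate `1 / √t` for the choice `η t = √t + η 0`. -/
theorem isBigO_one_div_sqrt {f η : ℝ → ℝ} {τ κ Y d : ℝ} (hτ : 0 < τ) (hκ : 0 < κ) (hY : 0 ≤ Y)
    (hd : 0 ≤ d) (hη0 : 1 ≤ η 0) (hη : ∀ t, 0 ≤ t → η t = √t + η 0)
    (hf0 : ∀ t, 0 ≤ t → 0 ≤ f t)
    (hf : ∀ t, 0 < t → f t ≤ τ / (2 * κ * (1 - Real.exp (-(τ / 2) * t))) *
      (Real.exp (-(τ / 2) * t) * Y +
        d * ∫ r in (0 : ℝ)..t, Real.exp (-(τ / 2) * (t - r)) * (1 / η r))) :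
    f =O[atTop] fun t => 1 / √t := by
  have hω : 0 < τ / 2 := half_pos hτ
  have hE1 : Real.exp (-(τ / 2)) < 1 := Real.exp_lt_one_iff.2 (by linarith)
  set D := (2 + 2 / (τ / 2)) * (2 / (τ / 2))
  refine IsBigO.of_bound (τ / (2 * κ * (1 - Real.exp (-(τ / 2)))) * (Y / (τ / 2) + d * D)) ?_
  filter_upwards [eventually_ge_atTop 1] with t ht
  have ht0 : 0 < t := one_pos.trans_le ht
  have hs : 0 < √t := Real.sqrt_pos.2 ht0
  rw [Real.norm_of_nonneg (hf0 t ht0.le), Real.norm_of_nonneg (by positivity), mul_one_div,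
    le_div_iff₀ hs]
  have hEt : Real.exp (-(τ / 2) * t) ≤ Real.exp (-(τ / 2)) := Real.exp_le_exp.2 (by nlinarith)
  have h1 : √t * Real.exp (-(τ / 2) * t) ≤ 1 / (τ / 2) := by
    have h2 : √t ≤ t := by
      rw [Real.sqrt_le_left ht0.le]
      nlinarith
    have h3 : τ / 2 * t ≤ Real.exp (τ / 2 * t) := by
      have := Real.add_one_le_exp (τ / 2 * t)
      linarith
    rw [neg_mul, Real.exp_neg, ← div_eq_mul_inv, div_le_div_iff₀ (Real.exp_pos _) hω]
    nlinarith
  have h4 : √t * ∫ r in (0 : ℝ)..t, Real.exp (-(τ / 2) * (t - r)) * (1 / η r) ≤ D := by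
    refine le_trans (le_of_eq ?_) (sqrt_mul_integral_exp_le hη0 hω ht0.le)
    congr 1
    refine intervalIntegral.integral_congr fun r hr => ?_
    rw [uIcc_of_le ht0.le] at hr
    rw [hη r hr.1]
  have hI : 0 ≤ ∫ r in (0 : ℝ)..t, Real.exp (-(τ / 2) * (t - r)) * (1 / η r) := by
    refine intervalIntegral.integral_nonneg ht0.le fun r hr => ?_
    have : 0 ≤ η r := by
      rw [hη r hr.1]
      positivity
    positivity
  have h1E : 0 < 1 - Real.exp (-(τ / 2)) := sub_pos.2 hE1
  -- The prefactor blows up only as t tends to 0; from t = 1 on it is at most its value at 1.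
  have hpre : τ / (2 * κ * (1 - Real.exp (-(τ / 2) * t))) ≤
      τ / (2 * κ * (1 - Real.exp (-(τ / 2)))) :=
    div_le_div_of_nonneg_left hτ.le (by positivity)
      (mul_le_mul_of_nonneg_left (by linarith) (by positivity))
  have h5 := (hf t ht0).trans (mul_le_mul_of_nonneg_right hpre (by positivity))
  refine (mul_le_mul_of_nonneg_right h5 hs.le).trans ?_
  rw [mul_assoc]
  refine mul_le_mul_of_nonneg_left ?_ (by positivity)
  have h6 := mul_le_mul_of_nonneg_left h1 hY
  have h7 := mul_le_mul_of_nonneg_left h4 hd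
  rw [mul_one_div] at h6
  linarith

end ActorCritic

theorem corollary5
    {S A : Type*}
    [TopologicalSpace S] [PolishSpace S] [MeasurableSpace S] [BorelSpace S]
    [TopologicalSpace A] [PolishSpace A] [MeasurableSpace A] [BorelSpace A]
    (M : ActorCritic.RegMDP S A) (hτ : M.τ < 1)
    {N : ℕ} (φ : S × A → EuclideanSpace ℝ (Fin N)) (hφ_meas : Measurable φ)
    (hφ : ∀ x, ‖φ x‖ ≤ 1) (hreal : M.Realisable φ)
    (β : Measure (S × A)) [IsProbabilityMeasure β]
    (hβ : 0 < ActorCritic.lambdaMin (ActorCritic.featureCov φ β))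
    (ρ : Measure S) [IsProbabilityMeasure ρ]
    (η : ℝ → ℝ) (hη_mono : MonotoneOn η (Ici 0)) (hη_one : ∀ t, 0 ≤ t → 1 ≤ η t)
    (hη_zero : 1 / M.Gam φ β < η 0)
    (hγ : 2 * √2 * M.γ / √(M.Gam φ β ^ 2 - M.Gam φ β * M.τ / η 0) < 1)
    (θ : ℝ → EuclideanSpace ℝ (Fin N)) (π : ℝ → ActorCritic.Policy S A)
    (hflow : M.IsFlow φ β η θ π)
    (πstar : ActorCritic.Policy S A) (hopt : M.IsOptimal ρ πstar) :
    ∃ (vstar : ℝ) (m : ℝ → ℝ),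
      M.valueAt πstar ρ = (vstar : EReal) ∧
      (∀ t, 0 ≤ t → IsLeast ((fun r => M.valueAt (π r) ρ) '' Icc 0 t) (m t : EReal)) ∧
      M.initialKL ρ πstar (π 0) ≠ ⊤ ∧
      (∃ d₁ : ℝ, 0 < d₁ ∧ ∀ t, 0 < t →
        m t - vstar ≤
          M.τ / (2 * (1 - M.γ) * (1 - Real.exp (-(M.τ / 2) * t))) *
            (Real.exp (-(M.τ / 2) * t) * (M.initialKL ρ πstar (π 0)).toReal
              + d₁ * ∫ r in (0 : ℝ)..t, Real.exp (-(M.τ / 2) * (t - r)) * (1 / η r))) ∧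
      ((∀ t, 0 ≤ t → η t = √t + η 0) →
        (fun t => m t - vstar) =O[atTop] fun t => 1 / √t) := by
  obtain ⟨hθ, p, h0, hp, hder⟩ := hflow
  have hΓ : 2 * M.γ < M.Gam φ β := ActorCritic.two_mul_lt_of_div_sqrt_lt_one
    (ActorCritic.RegMDP.gam_pos hβ) M.γ_pos M.τ_pos hτ hη_zero hγ
  obtain ⟨R, L, hR, hL⟩ :=
    ActorCritic.RegMDP.exists_flow_bounds hφ_meas hφ hη_one hΓ hθ h0 hp hder
  have hb : ∀ t, 0 ≤ t → ActorCritic.BddMeas fun x => Real.log (p t x) := fun t ht =>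
    ⟨(hp t ht).measurable.log, L, hL t ht⟩
  have hval : ∀ t, 0 ≤ t → M.valueAt (π t) ρ = ((∫ s, M.realValue (π t) s ∂ρ : ℝ) : EReal) :=
    fun t ht => (hp t ht).valueAt_eq (hb t ht) ρ
  -- π_0 has bounded log-density and therefore finite value, and optimality passes this on to π*.
  have htop : M.valueAt πstar ρ ≠ ⊤ := by
    refine ((hopt (π 0)).trans_lt ?_).ne
    rw [hval 0 le_rfl]
    exact EReal.coe_lt_top _
  have hent := ActorCritic.RegMDP.totalEntropy_ne_top htop
  have hv := ActorCritic.RegMDP.valueAt_eq_of_ne_top hent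
  set vstar : ℝ := (1 - M.γ)⁻¹ * (∫ x, M.c x ∂(M.stateOcc πstar ρ ⊗ₘ πstar.kernel) +
    M.τ * (M.totalEntropy πstar ρ).toReal)
  have hJc := ActorCritic.RegMDP.continuousOn_integral_realValue (ρ := ρ) hφ hp hder hR hL
  -- The value is continuous in time along the flow, so the minimum over the compact interval [0,t]
  -- is attained.
  have hmin : ∀ t : ℝ, ∃ r : ℝ, 0 ≤ t → r ∈ Icc 0 t ∧
      ∀ u ∈ Icc 0 t, ∫ s, M.realValue (π r) s ∂ρ ≤ ∫ s, M.realValue (π u) s ∂ρ := by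
    intro t
    by_cases ht : 0 ≤ t
    · obtain ⟨r, hr, hru⟩ := isCompact_Icc.exists_isMinOn (nonempty_Icc.2 ht)
        (hJc.mono Icc_subset_Ici_self)
      exact ⟨r, fun _ => ⟨hr, fun u hu => hru hu⟩⟩
    · exact ⟨0, fun h => absurd h ht⟩
  choose a ha using hmin
  obtain ⟨d, hd, hdt⟩ := ActorCritic.RegMDP.exists_sub_le hφ_meas hφ hreal hβ hη_mono hη_one hθ
    hp hder hR hL hent hv
  have hbound := fun t (ht : 0 < t) => hdt t _ ht (ha t ht.le).2
  refine ⟨vstar, fun t => ∫ s, M.realValue (π (a t)) s ∂ρ, hv, fun t ht => ⟨?_, ?_⟩, ?_,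
    ⟨d, hd, hbound⟩, fun hη => ?_⟩
  · exact ⟨a t, (ha t ht).1, hval _ (ha t ht).1.1⟩
  · rintro _ ⟨u, hu, rfl⟩
    simp only
    rw [hval u hu.1]
    exact EReal.coe_le_coe_iff.2 ((ha t ht).2 u hu)
  · have h1 := ActorCritic.RegMDP.lintegral_klDiv_policy (d := M.stateOcc πstar ρ)
      (hp 0 le_rfl) (hb 0 le_rfl) hent
    rw [ActorCritic.RegMDP.initialKL, ← ActorCritic.RegMDP.stateOcc, h1]
    exact ENNReal.ofReal_ne_top
  · refine ActorCritic.isBigO_one_div_sqrt M.τ_pos (sub_pos.2 M.γ_lt_one) ENNReal.toReal_nonneg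
      hd.le (hη_one 0 le_rfl) hη (fun t ht => ?_) hbound
    have h1 := hopt (π (a t))
    rw [hv, hval _ (ha t ht).1.1, EReal.coe_le_coe_iff] at h1
    exact sub_nonneg.2 h1
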